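/- Let $(M,g,J)$ be a $4$-dimensional (real dimension) locally conformal Kähler manifold: $(M,g,J)$ is a smooth Hermitian manifold (so $J$ is integrable), and each point has an open neighbourhood $U$ and a smooth function $\gamma:U\to\mathbb{R}$ such that $e^{-2\gamma}g$ is a Kähler metric on $(U,J)$. Let $R(X,Y)Z=\nabla_X\nabla_YZ-\nabla_Y\nabla_XZ-\nabla_{[X,Y]}Z$ be the curvature of the Levi-Civita connection of $g$, let $\mathrm{Ric}(X,Y)=\operatorname{tr}\big(Z\mapsto R(Z,X)Y\big)$ be its Ricci tensor and $s=\operatorname{tr}_g\mathrm{Ric}$ its scalar curvature, and let $\mathrm{Ric}^*(X,Y)=\operatorname{tr}\big(Z\mapsto R(X,JZ)JY\big)$ and $s^*=\operatorname{tr}_g\mathrm{Ric}^*$ be the $*$-Ricci tensor and the $*$-scalar curvature. Suppose that $\mathrm{Ric}(JX,JY)=\mathrm{Ric}(X,Y)$ for all tangent vectors $X,Y$, and that $s=s^*$ on $M$. Let $(N,h,J^N)$ be any smooth almost Hermitian manifold that is $(1,2)$-symplectic, i.e. the $(1,2)$-part of $d\Omega^N$ vanishes, where $\Omega^N(X,Y)=h(X,J^NY)$.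 Then every holomorphic map $\varphi:M\to N$ (a smooth map with $d\varphi\circ J=J^N\circ d\varphi$) is biharmonic, i.e. its bitension field $$\tau_2(\varphi)=\operatorname{tr}_g(\nabla^\varphi)^2\,\tau(\varphi)+\sum_{i=1}^4R^N\big(\tau(\varphi),d\varphi(e_i)\big)d\varphi(e_i)$$ vanishes identically on $M$. Here $\tau(\varphi)=\operatorname{tr}_g\nabla d\varphi$ is the tension field, $\nabla^\varphi$ is the pull-back connection on $\varphi^{-1}TN$, $R^N$ is the curvature of $(N,h)$ with the sign convention above, $\{e_i\}$ is any local $g$-orthonormal frame on $M$, and $\operatorname{tr}_g(\nabla^\varphi)^2v=\sum_{i=1}^4\big(\nabla^\varphi_{e_i}\nabla^\varphi_{e_i}v-\nabla^\varphi_{\nabla_{e_i}e_i}v\big)$. -/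

import Mathlib

open scoped Manifold ContDiff

/-! ## Tensor calculus in coordinates on `ℝ^m`

Functions are defined on all of `ℝ^m`; only their germs at the point of evaluation matter. -/

namespace Coord

/-- The partial derivative `∂_i f` at `y`. -/
noncomputable def pd {m : ℕ} (i : Fin m) (f : EuclideanSpace ℝ (Fin m) → ℝ)
    (y : EuclideanSpace ℝ (Fin m)) : ℝ :=
  fderiv ℝ f y (EuclideanSpace.single i 1)

/-- The Christoffel symbols `Γ^k_{ij}` of the Levi-Civita connection of the metric `G`:
`∇_{∂_i} ∂_j = ∑ k, Γ^k_{ij} ∂_k`. -/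
noncomputable def christoffel {m : ℕ} (G : EuclideanSpace ℝ (Fin m) → Matrix (Fin m) (Fin m) ℝ)
    (y : EuclideanSpace ℝ (Fin m)) (k i j : Fin m) : ℝ :=
  (1 / 2) * ∑ l, (G y)⁻¹ k l *
    (pd i (fun z => G z j l) y + pd j (fun z => G z i l) y - pd l (fun z => G z i j) y)

/-- The curvature `R(X, Y) Z = ∇_X ∇_Y Z - ∇_Y ∇_X Z - ∇_{[X, Y]} Z`:
`curv G y l i j k` is the component of `R(∂_i, ∂_j) ∂_k` along `∂_l`. -/
noncomputable def curv {m : ℕ} (G : EuclideanSpace ℝ (Fin m) → Matrix (Fin m) (Fin m) ℝ)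
    (y : EuclideanSpace ℝ (Fin m)) (l i j k : Fin m) : ℝ :=
  pd i (fun z => christoffel G z l j k) y - pd j (fun z => christoffel G z l i k) y
    + ∑ p, (christoffel G y l i p * christoffel G y p j k
      - christoffel G y l j p * christoffel G y p i k)

/-- The Ricci tensor `Ric(Y, Z) = trace (X ↦ R(X, Y) Z)`. -/
noncomputable def ricci {m : ℕ} (G : EuclideanSpace ℝ (Fin m) → Matrix (Fin m) (Fin m) ℝ)
    (y : EuclideanSpace ℝ (Fin m)) (j k : Fin m) : ℝ :=
  ∑ i, curv G y i i j k

/-- The scalar curvature `s = tr_g Ric`. -/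
noncomputable def scalar {m : ℕ} (G : EuclideanSpace ℝ (Fin m) → Matrix (Fin m) (Fin m) ℝ)
    (y : EuclideanSpace ℝ (Fin m)) : ℝ :=
  ∑ j, ∑ k, (G y)⁻¹ j k * ricci G y j k

/-- The `*`-Ricci tensor `Ric*(X, Y) = trace (Z ↦ R(X, J Z) (J Y))`, where
`J ∂_j = ∑ i, J^i_j ∂_i` and `J y i j` is `J^i_j` at `y`. -/
noncomputable def starRicci {m : ℕ} (G J : EuclideanSpace ℝ (Fin m) → Matrix (Fin m) (Fin m) ℝ)
    (y : EuclideanSpace ℝ (Fin m)) (i j : Fin m) : ℝ :=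
  ∑ k, ∑ a, ∑ b, J y a k * J y b j * curv G y k i a b

/-- The `*`-scalar curvature `s* = tr_g Ric*`. -/
noncomputable def starScalar {m : ℕ} (G J : EuclideanSpace ℝ (Fin m) → Matrix (Fin m) (Fin m) ℝ)
    (y : EuclideanSpace ℝ (Fin m)) : ℝ :=
  ∑ i, ∑ j, (G y)⁻¹ i j * starRicci G J y i j

/-- The fundamental form `Ω(X, Y) = g(X, J Y)`. -/
noncomputable def fundForm {m : ℕ} (G J : EuclideanSpace ℝ (Fin m) → Matrix (Fin m) (Fin m) ℝ)
    (y : EuclideanSpace ℝ (Fin m)) (i j : Fin m) : ℝ :=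
  ∑ a, G y i a * J y a j

/-- The exterior derivative `dΩ(∂_i, ∂_j, ∂_k)` of the fundamental form. -/
noncomputable def dFundForm {m : ℕ} (G J : EuclideanSpace ℝ (Fin m) → Matrix (Fin m) (Fin m) ℝ)
    (y : EuclideanSpace ℝ (Fin m)) (i j k : Fin m) : ℝ :=
  pd i (fun z => fundForm G J z j k) y + pd j (fun z => fundForm G J z k i) y
    + pd k (fun z => fundForm G J z i j) y

/-- The Nijenhuis tensor `N(X, Y) = [J X, J Y] - J [J X, Y] - J [X, J Y] - [X, Y]`:
`nijenhuis J y k i j` is the component of `N(∂_i, ∂_j)` along `∂_k`. -/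
noncomputable def nijenhuis {m : ℕ} (J : EuclideanSpace ℝ (Fin m) → Matrix (Fin m) (Fin m) ℝ)
    (y : EuclideanSpace ℝ (Fin m)) (k i j : Fin m) : ℝ :=
  ∑ a, (J y a i * pd a (fun z => J z k j) y - J y a j * pd a (fun z => J z k i) y
    - J y k a * (pd i (fun z => J z a j) y - pd j (fun z => J z a i) y))

/-- The pull-back connection `∇^φ` on vector fields `v` along a map `F` into a space with metric
`H`: the component `α` of `∇^φ_{∂_i} v`. -/
noncomputable def covAlong {m n : ℕ}
    (H : EuclideanSpace ℝ (Fin n) → Matrix (Fin n) (Fin n) ℝ)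
    (F : EuclideanSpace ℝ (Fin m) → EuclideanSpace ℝ (Fin n))
    (v : EuclideanSpace ℝ (Fin m) → Fin n → ℝ) (i : Fin m)
    (y : EuclideanSpace ℝ (Fin m)) (α : Fin n) : ℝ :=
  pd i (fun z => v z α) y
    + ∑ β, ∑ δ, christoffel H (F y) α β δ * pd i (fun z => F z β) y * v y δ

/-- The tension field `τ(F) = tr_g ∇dF`, with
`(∇dF)(∂_i, ∂_j) = ∇^φ_{∂_i} (dF ∂_j) - dF (∇_{∂_i} ∂_j)`. -/
noncomputable def tension {m n : ℕ}
    (G : EuclideanSpace ℝ (Fin m) → Matrix (Fin m) (Fin m) ℝ)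
    (H : EuclideanSpace ℝ (Fin n) → Matrix (Fin n) (Fin n) ℝ)
    (F : EuclideanSpace ℝ (Fin m) → EuclideanSpace ℝ (Fin n))
    (y : EuclideanSpace ℝ (Fin m)) (α : Fin n) : ℝ :=
  ∑ i, ∑ j, (G y)⁻¹ i j *
    (covAlong H F (fun z β => pd j (fun w => F w β) z) i y α
      - ∑ k, christoffel G y k i j * pd k (fun z => F z α) y)

/-- The rough Laplacian `tr_g (∇^φ)^2 v` of a vector field `v` along `F`. -/
noncomputable def roughLaplacian {m n : ℕ}
    (G : EuclideanSpace ℝ (Fin m) → Matrix (Fin m) (Fin m) ℝ)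
    (H : EuclideanSpace ℝ (Fin n) → Matrix (Fin n) (Fin n) ℝ)
    (F : EuclideanSpace ℝ (Fin m) → EuclideanSpace ℝ (Fin n))
    (v : EuclideanSpace ℝ (Fin m) → Fin n → ℝ)
    (y : EuclideanSpace ℝ (Fin m)) (α : Fin n) : ℝ :=
  ∑ i, ∑ j, (G y)⁻¹ i j *
    (covAlong H F (covAlong H F v j) i y α
      - ∑ k, christoffel G y k i j * covAlong H F v k y α)

/-- The operator `Ric^φ v = tr_g R^N(v, dF ·) dF ·`. -/
noncomputable def ricciAlong {m n : ℕ}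
    (G : EuclideanSpace ℝ (Fin m) → Matrix (Fin m) (Fin m) ℝ)
    (H : EuclideanSpace ℝ (Fin n) → Matrix (Fin n) (Fin n) ℝ)
    (F : EuclideanSpace ℝ (Fin m) → EuclideanSpace ℝ (Fin n))
    (v : EuclideanSpace ℝ (Fin m) → Fin n → ℝ)
    (y : EuclideanSpace ℝ (Fin m)) (α : Fin n) : ℝ :=
  ∑ i, ∑ j, (G y)⁻¹ i j * ∑ β, ∑ δ, ∑ ε,
    curv H (F y) α β δ ε * v y β * pd i (fun z => F z δ) y * pd j (fun z => F z ε) y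

/-- The bitension field `τ_2(F) = (tr_g (∇^φ)^2 + Ric^φ) (τ(F))`. -/
noncomputable def bitension {m n : ℕ}
    (G : EuclideanSpace ℝ (Fin m) → Matrix (Fin m) (Fin m) ℝ)
    (H : EuclideanSpace ℝ (Fin n) → Matrix (Fin n) (Fin n) ℝ)
    (F : EuclideanSpace ℝ (Fin m) → EuclideanSpace ℝ (Fin n))
    (y : EuclideanSpace ℝ (Fin m)) (α : Fin n) : ℝ :=
  roughLaplacian G H F (tension G H F) y α + ricciAlong G H F (tension G H F) y α

end Coord

/-! ## Almost Hermitian manifolds -/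

/-- A smooth almost Hermitian structure `(g, J)` on a smooth `m`-manifold `M`. -/
structure AlmostHermitian (m : ℕ) (M : Type*) [TopologicalSpace M]
    [ChartedSpace (EuclideanSpace ℝ (Fin m)) M] [IsManifold (𝓡 m) ∞ M] where
  /-- The Riemannian metric. -/
  g : Bundle.ContMDiffRiemannianMetric (𝓡 m) ∞ (EuclideanSpace ℝ (Fin m))
    (fun x : M => TangentSpace (𝓡 m) x)
  /-- The almost complex structure, a smooth field of endomorphisms of the tangent spaces. -/
  J : ContMDiffSection (𝓡 m)
    (EuclideanSpace ℝ (Fin m) →L[ℝ] EuclideanSpace ℝ (Fin m)) ∞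
    (fun x : M => TangentSpace (𝓡 m) x →L[ℝ] TangentSpace (𝓡 m) x)
  J_sq : ∀ (x : M) (v : TangentSpace (𝓡 m) x), J x (J x v) = -v
  J_isometry : ∀ (x : M) (v w : TangentSpace (𝓡 m) x),
    g.inner x (J x v) (J x w) = g.inner x v w

section Charts

variable {m : ℕ} {M : Type*} [TopologicalSpace M] [ChartedSpace (EuclideanSpace ℝ (Fin m)) M]

/-- The coordinate vector `∂_i` of the chart `c`, at the point with coordinates `y`. -/
noncomputable def coordVec (c : OpenPartialHomeomorph M (EuclideanSpace ℝ (Fin m)))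
    (y : EuclideanSpace ℝ (Fin m)) (i : Fin m) : TangentSpace (𝓡 m) (c.symm y) :=
  mfderiv (𝓡 m) (𝓡 m) c.symm y (EuclideanSpace.single i (1 : ℝ))

/-- The matrix `h_{ij} = h(∂_i, ∂_j)` of a field `h` of bilinear forms in the chart `c`. -/
noncomputable def metricMatrix
    (h : ∀ x : M, TangentSpace (𝓡 m) x →L[ℝ] TangentSpace (𝓡 m) x →L[ℝ] ℝ)
    (c : OpenPartialHomeomorph M (EuclideanSpace ℝ (Fin m)))
    (y : EuclideanSpace ℝ (Fin m)) : Matrix (Fin m) (Fin m) ℝ :=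
  Matrix.of fun i j => h (c.symm y) (coordVec c y i) (coordVec c y j)

/-- The matrix `A^i_j`, with `A ∂_j = ∑ i, A^i_j ∂_i`, of a field `A` of endomorphisms in the
chart `c`. -/
noncomputable def endoMatrix
    (A : ∀ x : M, TangentSpace (𝓡 m) x →L[ℝ] TangentSpace (𝓡 m) x)
    (c : OpenPartialHomeomorph M (EuclideanSpace ℝ (Fin m)))
    (y : EuclideanSpace ℝ (Fin m)) : Matrix (Fin m) (Fin m) ℝ :=
  Matrix.of fun i j =>
    (show EuclideanSpace ℝ (Fin m) from
      mfderiv (𝓡 m) (𝓡 m) c (c.symm y) (A (c.symm y) (coordVec c y j))) i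

/-- `h` is a Kähler metric for `J` on the open set `U`, where `h` is a field of inner products:
`h` is Hermitian, `J` is integrable, and the fundamental form of `h` is closed. Tensors are
evaluated in all smooth charts. -/
structure IsKahlerOn
    (h : ∀ x : M, TangentSpace (𝓡 m) x →L[ℝ] TangentSpace (𝓡 m) x →L[ℝ] ℝ)
    (J : ∀ x : M, TangentSpace (𝓡 m) x →L[ℝ] TangentSpace (𝓡 m) x) (U : Set M) : Prop where
  hermitian : ∀ x ∈ U, ∀ v w : TangentSpace (𝓡 m) x, h x (J x v) (J x w) = h x v w
  integrable : ∀ c ∈ IsManifold.maximalAtlas (𝓡 m) ∞ M, ∀ y ∈ c.target, c.symm y ∈ U →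
    ∀ k i j, Coord.nijenhuis (endoMatrix J c) y k i j = 0
  closed : ∀ c ∈ IsManifold.maximalAtlas (𝓡 m) ∞ M, ∀ y ∈ c.target, c.symm y ∈ U →
    ∀ i j k, Coord.dFundForm (metricMatrix h c) (endoMatrix J c) y i j k = 0

end Charts

namespace AlmostHermitian

variable {m : ℕ} {M : Type*} [TopologicalSpace M] [ChartedSpace (EuclideanSpace ℝ (Fin m)) M]
  [IsManifold (𝓡 m) ∞ M]

/-- The matrix `g_{ij}` of the metric in a chart. -/
noncomputable def gMat (S : AlmostHermitian m M)
    (c : OpenPartialHomeomorph M (EuclideanSpace ℝ (Fin m))) :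
    EuclideanSpace ℝ (Fin m) → Matrix (Fin m) (Fin m) ℝ :=
  metricMatrix S.g.inner c

/-- The matrix `J^i_j` of the almost complex structure in a chart. -/
noncomputable def jMat (S : AlmostHermitian m M)
    (c : OpenPartialHomeomorph M (EuclideanSpace ℝ (Fin m))) :
    EuclideanSpace ℝ (Fin m) → Matrix (Fin m) (Fin m) ℝ :=
  endoMatrix (fun x => S.J x) c

/-- `(M, g, J)` is Hermitian: `J` is integrable, i.e. its Nijenhuis tensor vanishes. -/
def IsHermitian (S : AlmostHermitian m M) : Prop :=
  ∀ c ∈ IsManifold.maximalAtlas (𝓡 m) ∞ M, ∀ y ∈ c.target,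
    ∀ k i j, Coord.nijenhuis (S.jMat c) y k i j = 0

/-- `(M, g, J)` is locally conformal Kähler: it is Hermitian, and each point has an open
neighbourhood `U` with a smooth function `γ` on `U` such that `g = e^{2γ} h` on `U` for a Kähler
metric `h`. -/
def IsLCK (S : AlmostHermitian m M) : Prop :=
  S.IsHermitian ∧ ∀ p : M, ∃ U : Set M, IsOpen U ∧ p ∈ U ∧
    ∃ γ : M → ℝ, ContMDiffOn (𝓡 m) 𝓘(ℝ, ℝ) ∞ γ U ∧
      IsKahlerOn (fun x => Real.exp (-2 * γ x) • S.g.inner x) (fun x => S.J x) U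

/-- The Ricci tensor is `J`-invariant: `Ric(J X, J Y) = Ric(X, Y)`. -/
def RicciJInvariant (S : AlmostHermitian m M) : Prop :=
  ∀ c ∈ IsManifold.maximalAtlas (𝓡 m) ∞ M, ∀ y ∈ c.target, ∀ i j,
    ∑ a, ∑ b, S.jMat c y a i * S.jMat c y b j * Coord.ricci (S.gMat c) y a b
      = Coord.ricci (S.gMat c) y i j

/-- The scalar and `*`-scalar curvatures coincide at every point. -/
def ScalarEqStarScalar (S : AlmostHermitian m M) : Prop :=
  ∀ c ∈ IsManifold.maximalAtlas (𝓡 m) ∞ M, ∀ y ∈ c.target,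
    Coord.scalar (S.gMat c) y = Coord.starScalar (S.gMat c) (S.jMat c) y

/-- The complex tangent vector with components `Z` is of type `(1,0)`: `J Z = i Z`. -/
def IsType10 (S : AlmostHermitian m M)
    (c : OpenPartialHomeomorph M (EuclideanSpace ℝ (Fin m)))
    (y : EuclideanSpace ℝ (Fin m)) (Z : Fin m → ℂ) : Prop :=
  ∀ k, ∑ a, (S.jMat c y k a : ℂ) * Z a = Complex.I * Z k

/-- The complex tangent vector with components `Z` is of type `(0,1)`: `J Z = -i Z`. -/
def IsType01 (S : AlmostHermitian m M)
    (c : OpenPartialHomeomorph M (EuclideanSpace ℝ (Fin m)))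
    (y : EuclideanSpace ℝ (Fin m)) (Z : Fin m → ℂ) : Prop :=
  ∀ k, ∑ a, (S.jMat c y k a : ℂ) * Z a = -(Complex.I * Z k)

/-- `(M, g, J)` is `(1,2)`-symplectic: the `(1,2)`-part of `dΩ` vanishes, that is, the complex
trilinear extension of `dΩ` vanishes on one vector of type `(1,0)` and two of type `(0,1)`. -/
def IsOneTwoSymplectic (S : AlmostHermitian m M) : Prop :=
  ∀ c ∈ IsManifold.maximalAtlas (𝓡 m) ∞ M, ∀ y ∈ c.target, ∀ Z W V : Fin m → ℂ,
    S.IsType10 c y Z → S.IsType01 c y W → S.IsType01 c y V →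
      ∑ i, ∑ j, ∑ k,
        (Coord.dFundForm (S.gMat c) (S.jMat c) y i j k : ℂ) * Z i * W j * V k = 0

variable {n : ℕ} {N : Type*} [TopologicalSpace N] [ChartedSpace (EuclideanSpace ℝ (Fin n)) N]
  [IsManifold (𝓡 n) ∞ N]

/-- A smooth map `φ : M → N` is holomorphic: `dφ ∘ J = J^N ∘ dφ`. -/
def IsHolomorphic (S : AlmostHermitian m M) (T : AlmostHermitian n N) (φ : M → N) : Prop :=
  ContMDiff (𝓡 m) (𝓡 n) ∞ φ ∧ ∀ (x : M) (v : TangentSpace (𝓡 m) x),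
    mfderiv (𝓡 m) (𝓡 n) φ x (S.J x v) = T.J (φ x) (mfderiv (𝓡 m) (𝓡 n) φ x v)

/-- A smooth map `φ : M → N` is biharmonic: its bitension field, computed in local coordinates
on `M` and `N`, vanishes at every point. -/
def IsBiharmonic (S : AlmostHermitian m M) (T : AlmostHermitian n N) (φ : M → N) : Prop :=
  ContMDiff (𝓡 m) (𝓡 n) ∞ φ ∧
    ∀ c ∈ IsManifold.maximalAtlas (𝓡 m) ∞ M, ∀ d ∈ IsManifold.maximalAtlas (𝓡 n) ∞ N,
      ∀ y ∈ c.target, φ (c.symm y) ∈ d.source → ∀ α,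
        Coord.bitension (S.gMat c) (T.gMat d) (fun z => d (φ (c.symm z))) y α = 0

end AlmostHermitian

/-! The statement is local, so write g = e^{2γ} h with h Kähler, and let u be the h-gradient of γ.
Two facts about h drive the proof.

On the source, the curvature of g differs from that of h by terms in A = ∇u - u ⊗ u + |u|²/2. In
real dimension four, Ric changes by -2 h(A·,·) - (tr A) h, and the h-traces of Ric and Ric* come to
differ by -4 tr A. The Kähler Ricci tensor is J-invariant and equals its *-Ricci tensor, so the
hypotheses say that ∇u - u ⊗ u commutes with J and has trace -2|u|². These quadratic conditions
simplify for ψ = e^{-γ} and P = grad ψ = -ψ u, because ∇P = -ψ (∇u - u ⊗ u). They say that P is a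
holomorphic vector field and that ψ Δψ = 2|P|². A holomorphic field on a Kähler manifold satisfies
ΔP + Ric P = 0.

On the map, let B be the second fundamental form computed with h. Since h is Kähler and the target
is (1,2)-symplectic, B(JX, JY) = -B(X, Y). Hence the h-trace of B vanishes, as does that of ∇_V B
and of B(·, L·) for any L commuting with J. The tension field for g therefore comes only from the
conformal change: it is τ = dφ(2 e^{-2γ} u) = dφ(-2ψ P).

The bitension field is e^{-2γ} times the h-Jacobi operator on τ plus 2∇_u τ, where 2u = -(2/ψ) P. By
the Codazzi equation, the Jacobi operator on dφ(V) is dφ(ΔV + Ric V) + 2 tr B(·, ∇V) + tr ∇_V B.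
With V = -2ψ P this is dφ(-2(Δψ) P - 4∇_P P) - 4B(P, P). The term -(2/ψ) ∇_P τ contributes
dφ(4|P|²ψ⁻¹ P + 4∇_P P) + 4B(P, P). The sum is a multiple of ψ Δψ - 2|P|², hence zero.

The argument is carried by `sff_J_J`, `cov₂_pushforward_eq`, `IsKahlerData.sum_cov₂_add_ricOp`,
`IsKahlerData.conformal_conditions` and `bitension_core`; the rest translates between charts,
matrices and bundled multilinear maps. -/

set_option maxSynthPendingDepth 3

namespace TensorCalc

open Filter Topology

/-! ### Connections on trivial bundles over a vector space, their curvature and pull-backs -/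

section Connections

variable {E E' W : Type*} [NormedAddCommGroup E] [NormedSpace ℝ E]
  [NormedAddCommGroup E'] [NormedSpace ℝ E'] [NormedAddCommGroup W] [NormedSpace ℝ W]

lemma smooth_differentiableAt {v : E → W} {y : E} (hv : ContDiffAt ℝ ∞ v y) :
    DifferentiableAt ℝ v y := hv.differentiableAt (by simp)

lemma smooth_fderiv {v : E → W} {y : E} (hv : ContDiffAt ℝ ∞ v y) :
    ContDiffAt ℝ ∞ (fderiv ℝ v) y := hv.fderiv_right (by simp)

lemma smooth_fderiv_symm {v : E → W} {y : E} (hv : ContDiffAt ℝ ∞ v y) (X Y : E) :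
    fderiv ℝ (fderiv ℝ v) y X Y = fderiv ℝ (fderiv ℝ v) y Y X :=
  hv.isSymmSndFDerivAt (by
    rw [minSmoothness_of_isRCLikeNormedField]; exact WithTop.coe_le_coe.mpr le_top) X Y

lemma fderiv_clm {F : Type*} [NormedAddCommGroup F] [NormedSpace ℝ F]
    {c : E → F →L[ℝ] W} {u : E → F} {y : E} (hc : DifferentiableAt ℝ c y)
    (hu : DifferentiableAt ℝ u y) (X : E) :
    fderiv ℝ (fun z => c z (u z)) y X = fderiv ℝ c y X (u y) + c y (fderiv ℝ u y X) := by
  rw [(hc.hasFDerivAt.clm_apply hu.hasFDerivAt).fderiv]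
  simp [add_comm]

lemma fderiv_clm_const {F : Type*} [NormedAddCommGroup F] [NormedSpace ℝ F]
    {c : E → F →L[ℝ] W} {y : E} (hc : DifferentiableAt ℝ c y) (u : F) (X : E) :
    fderiv ℝ (fun z => c z u) y X = fderiv ℝ c y X u := by
  simpa using fderiv_clm hc (differentiableAt_const u) X

lemma fderiv_clm₂ {F G : Type*} [NormedAddCommGroup F] [NormedSpace ℝ F]
    [NormedAddCommGroup G] [NormedSpace ℝ G]
    {b : E → F →L[ℝ] G →L[ℝ] W} {u : E → F} {v : E → G} {y : E} (hb : DifferentiableAt ℝ b y)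
    (hu : DifferentiableAt ℝ u y) (hv : DifferentiableAt ℝ v y) (X : E) :
    fderiv ℝ (fun z => b z (u z) (v z)) y X
      = fderiv ℝ b y X (u y) (v y) + b y (fderiv ℝ u y X) (v y)
        + b y (u y) (fderiv ℝ v y X) := by
  rw [fderiv_clm (hb.clm_apply hu) hv, fderiv_clm hb hu]
  simp

/-- The covariant derivative of the section `v` of a trivial bundle, for the connection form `θ`. -/
noncomputable def cov (θ : E → E →L[ℝ] W →L[ℝ] W) (v : E → W) (y : E) : E →L[ℝ] W :=
  fderiv ℝ v y + (θ y).flip (v y)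

@[simp] lemma cov_apply (θ : E → E →L[ℝ] W →L[ℝ] W) (v : E → W) (y X : E) :
    cov θ v y X = fderiv ℝ v y X + θ y X (v y) := by simp [cov]

lemma smooth_flip {F : Type*} [NormedAddCommGroup F] [NormedSpace ℝ F]
    {b : E → E' →L[ℝ] F →L[ℝ] W} {y : E} (hb : ContDiffAt ℝ ∞ b y) :
    ContDiffAt ℝ ∞ (fun z => (b z).flip) y := by
  have h : ContDiff ℝ ∞ (fun c : E' →L[ℝ] F →L[ℝ] W => c.flip) :=
    IsBoundedLinearMap.contDiff ⟨⟨fun _ _ => rfl, fun _ _ => rfl⟩, 1, one_pos, fun c => by simp⟩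
  exact h.contDiffAt.comp y hb

lemma smooth_cov {θ : E → E →L[ℝ] W →L[ℝ] W} {v : E → W} {y : E}
    (hθ : ContDiffAt ℝ ∞ θ y) (hv : ContDiffAt ℝ ∞ v y) : ContDiffAt ℝ ∞ (cov θ v) y :=
  (smooth_fderiv hv).add ((smooth_flip hθ).clm_apply hv)

lemma cov_congr {θ : E → E →L[ℝ] W →L[ℝ] W} {v w : E → W} {y : E} (h : v =ᶠ[𝓝 y] w) :
    cov θ v y = cov θ w y := by
  simp [cov, h.fderiv_eq, h.eq_of_nhds]

/-- The curvature of the connection form `θ`, as an endomorphism-valued 2-form. -/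
noncomputable def curvature (θ : E → E →L[ℝ] W →L[ℝ] W) (y X Y : E) (w : W) : W :=
  fderiv ℝ θ y X Y w - fderiv ℝ θ y Y X w + θ y X (θ y Y w) - θ y Y (θ y X w)

/-- The second covariant derivative `∇²_{X,Y} v`. -/
noncomputable def cov₂ (Γ : E → E →L[ℝ] E →L[ℝ] E) (θ : E → E →L[ℝ] W →L[ℝ] W) (v : E → W)
    (y X Y : E) : W :=
  cov θ (fun z => cov θ v z Y) y X - cov θ v y (Γ y X Y)

/-- The vectors X and Y are constant fields, so no bracket term occurs. The expansion gives the
Ricci identity after antisymmetrisation, and the bilinearity of `cov₂`. -/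
lemma cov_cov {θ : E → E →L[ℝ] W →L[ℝ] W} {v : E → W} {y : E}
    (hθ : ContDiffAt ℝ ∞ θ y) (hv : ContDiffAt ℝ ∞ v y) (X Y : E) :
    cov θ (fun z => cov θ v z Y) y X = fderiv ℝ (fderiv ℝ v) y X Y + fderiv ℝ θ y X Y (v y)
      + θ y Y (fderiv ℝ v y X) + θ y X (fderiv ℝ v y Y) + θ y X (θ y Y (v y)) := by
  have hd := smooth_differentiableAt hθ
  have hv' := smooth_differentiableAt hv
  have hv'' := smooth_differentiableAt (smooth_fderiv hv)
  simp only [cov_apply, map_add]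
  rw [fderiv_fun_add (hv''.clm_apply (differentiableAt_const _))
    ((hd.clm_apply (differentiableAt_const _)).clm_apply hv'), add_apply,
    fderiv_clm_const hv'', fderiv_clm₂ hd (differentiableAt_const _) hv']
  simp
  abel

/-- The Ricci identity. -/
lemma cov_cov_sub {θ : E → E →L[ℝ] W →L[ℝ] W} {v : E → W} {y : E}
    (hθ : ContDiffAt ℝ ∞ θ y) (hv : ContDiffAt ℝ ∞ v y) (X Y : E) :
    cov θ (fun z => cov θ v z Y) y X - cov θ (fun z => cov θ v z X) y Y
      = curvature θ y X Y (v y) := by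
  rw [cov_cov hθ hv, cov_cov hθ hv, smooth_fderiv_symm hv X Y, curvature]
  abel

lemma cov₂_sub {Γ : E → E →L[ℝ] E →L[ℝ] E} {θ : E → E →L[ℝ] W →L[ℝ] W} {v : E → W} {y : E}
    (hθ : ContDiffAt ℝ ∞ θ y) (hv : ContDiffAt ℝ ∞ v y)
    (hΓ : ∀ X Y, Γ y X Y = Γ y Y X) (X Y : E) :
    cov₂ Γ θ v y X Y - cov₂ Γ θ v y Y X = curvature θ y X Y (v y) := by
  rw [← cov_cov_sub hθ hv, cov₂, cov₂, hΓ X Y]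
  abel

lemma curvature_swap (θ : E → E →L[ℝ] W →L[ℝ] W) (y X Y : E) (w : W) :
    curvature θ y X Y w = -curvature θ y Y X w := by
  simp only [curvature]; abel

lemma cov_const (θ : E → E →L[ℝ] W →L[ℝ] W) (w : W) (y X : E) :
    cov θ (fun _ => w) y X = θ y X w := by simp

lemma cov_add {θ : E → E →L[ℝ] W →L[ℝ] W} {v w : E → W} {y : E}
    (hv : DifferentiableAt ℝ v y) (hw : DifferentiableAt ℝ w y) (X : E) :
    cov θ (fun z => v z + w z) y X = cov θ v y X + cov θ w y X := by
  simp [fderiv_fun_add hv hw]; abel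

lemma cov_sub {θ : E → E →L[ℝ] W →L[ℝ] W} {v w : E → W} {y : E}
    (hv : DifferentiableAt ℝ v y) (hw : DifferentiableAt ℝ w y) (X : E) :
    cov θ (fun z => v z - w z) y X = cov θ v y X - cov θ w y X := by
  simp [fderiv_fun_sub hv hw]; abel

lemma cov_smul {θ : E → E →L[ℝ] W →L[ℝ] W} {f : E → ℝ} {v : E → W} {y : E}
    (hf : DifferentiableAt ℝ f y) (hv : DifferentiableAt ℝ v y) (X : E) :
    cov θ (fun z => f z • v z) y X = fderiv ℝ f y X • v y + f y • cov θ v y X := by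
  simp [fderiv_fun_smul hf hv]; abel

/-- The first Bianchi identity. -/
lemma bianchi {Γ : E → E →L[ℝ] E →L[ℝ] E} {y : E} (hΓ : ContDiffAt ℝ ∞ Γ y)
    (hs : ∀ᶠ z in 𝓝 y, ∀ X Y, Γ z X Y = Γ z Y X) (X Y Z : E) :
    curvature Γ y X Y Z + curvature Γ y Y Z X + curvature Γ y Z X Y = 0 := by
  have hd := smooth_differentiableAt hΓ
  -- Vanishing torsion near y, not only at y, makes the derivative of Γ symmetric as well.
  have key : ∀ A B C : E, fderiv ℝ Γ y A B C = fderiv ℝ Γ y A C B := fun A B C => by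
    have h : (fun z => Γ z B C) =ᶠ[𝓝 y] fun z => Γ z C B := hs.mono fun z hz => hz B C
    have h' := DFunLike.congr_fun (h.fderiv_eq (𝕜 := ℝ)) A
    simpa [fderiv_clm_const (c := fun z => Γ z B) (hd.clm_apply (differentiableAt_const B)),
      fderiv_clm_const (c := fun z => Γ z C) (hd.clm_apply (differentiableAt_const C)),
      fderiv_clm_const hd] using h'
  have h0 := hs.self_of_nhds
  unfold curvature
  rw [key X Y Z, key Y Z X, key Z X Y, h0 Y Z, h0 Z X, h0 X Y]
  abel

/-- The pull-back along `F` of the connection form `Γ`. -/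
noncomputable def pullback (Γ : E' → E' →L[ℝ] W →L[ℝ] W) (F : E → E') (y : E) :
    E →L[ℝ] W →L[ℝ] W := (Γ (F y)).comp (fderiv ℝ F y)

@[simp] lemma pullback_apply (Γ : E' → E' →L[ℝ] W →L[ℝ] W) (F : E → E') (y X : E) :
    pullback Γ F y X = Γ (F y) (fderiv ℝ F y X) := rfl

lemma smooth_pullback {Γ : E' → E' →L[ℝ] W →L[ℝ] W} {F : E → E'} {y : E}
    (hΓ : ContDiffAt ℝ ∞ Γ (F y)) (hF : ContDiffAt ℝ ∞ F y) :
    ContDiffAt ℝ ∞ (pullback Γ F) y :=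
  (hΓ.comp y hF).clm_comp (smooth_fderiv hF)

/-- The second derivative of F enters the derivative of the pulled-back form, but it is symmetric
and drops out of the curvature. -/
lemma curvature_pullback {Γ : E' → E' →L[ℝ] W →L[ℝ] W} {F : E → E'} {y : E}
    (hΓ : ContDiffAt ℝ ∞ Γ (F y)) (hF : ContDiffAt ℝ ∞ F y) (X Y : E) (w : W) :
    curvature (pullback Γ F) y X Y w
      = curvature Γ (F y) (fderiv ℝ F y X) (fderiv ℝ F y Y) w := by
  have hd := smooth_differentiableAt hΓ
  have hF' := smooth_differentiableAt hF
  have hF'' := smooth_differentiableAt (smooth_fderiv hF)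
  have key : ∀ A B : E, fderiv ℝ (pullback Γ F) y A B
      = fderiv ℝ Γ (F y) (fderiv ℝ F y A) (fderiv ℝ F y B)
        + Γ (F y) (fderiv ℝ (fderiv ℝ F) y A B) := fun A B => by
    have hp := smooth_differentiableAt (smooth_pullback hΓ hF)
    rw [← fderiv_clm_const hp]
    simp only [pullback_apply]
    have hc : DifferentiableAt ℝ (fun z => Γ (F z)) y := hd.comp y hF'
    rw [fderiv_clm hc (hF''.clm_apply (differentiableAt_const _)), fderiv_clm_const hF'']
    have : fderiv ℝ (fun z => Γ (F z)) y = (fderiv ℝ Γ (F y)).comp (fderiv ℝ F y) :=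
      fderiv_comp y hd hF'
    rw [this]; rfl
  simp only [curvature, key, pullback_apply, add_apply]
  rw [smooth_fderiv_symm hF X Y]
  abel

end Connections

/-! ### Second fundamental form of a map, Codazzi equation, Jacobi operator on tangential fields -/

section SecondFundamentalForm

variable {E E' : Type*} [NormedAddCommGroup E] [NormedSpace ℝ E]
  [NormedAddCommGroup E'] [NormedSpace ℝ E']

/-- The second fundamental form `∇dF` of the map `F`. -/
noncomputable def sff (Γ : E → E →L[ℝ] E →L[ℝ] E) (Γ' : E' → E' →L[ℝ] E' →L[ℝ] E') (F : E → E')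
    (y : E) : E →L[ℝ] E →L[ℝ] E' :=
  fderiv ℝ (fderiv ℝ F) y + ((pullback Γ' F y).flip.comp (fderiv ℝ F y)).flip
    - (ContinuousLinearMap.compL ℝ E E E' (fderiv ℝ F y)).comp (Γ y)

variable {Γ : E → E →L[ℝ] E →L[ℝ] E} {Γ' : E' → E' →L[ℝ] E' →L[ℝ] E'} {F : E → E'} {y : E}

lemma sff_apply (X Y : E) :
    sff Γ Γ' F y X Y = fderiv ℝ (fderiv ℝ F) y X Y
      + Γ' (F y) (fderiv ℝ F y X) (fderiv ℝ F y Y) - fderiv ℝ F y (Γ y X Y) := by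
  simp [sff]

lemma smooth_sff (hΓ : ContDiffAt ℝ ∞ Γ y) (hΓ' : ContDiffAt ℝ ∞ Γ' (F y))
    (hF : ContDiffAt ℝ ∞ F y) : ContDiffAt ℝ ∞ (sff Γ Γ' F) y := by
  have h1 := smooth_fderiv hF
  refine ((smooth_fderiv h1).add (smooth_flip
    ((smooth_flip (smooth_pullback hΓ' hF)).clm_comp h1))).sub (ContDiffAt.clm_comp ?_ hΓ)
  exact contDiffAt_const.clm_apply h1

lemma sff_symm (hF : ContDiffAt ℝ ∞ F y) (hs : ∀ X Y, Γ y X Y = Γ y Y X)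
    (hs' : ∀ X Y, Γ' (F y) X Y = Γ' (F y) Y X) (X Y : E) :
    sff Γ Γ' F y X Y = sff Γ Γ' F y Y X := by
  rw [sff_apply, sff_apply, smooth_fderiv_symm hF, hs, hs']

/-- The Gauss formula for a map. No torsion condition is needed here, and Γ may be any connection on
the source. -/
lemma cov_pushforward (hF : ContDiffAt ℝ ∞ F y) {V : E → E} (hV : DifferentiableAt ℝ V y) (X : E) :
    cov (pullback Γ' F) (fun z => fderiv ℝ F z (V z)) y X
      = fderiv ℝ F y (cov Γ V y X) + sff Γ Γ' F y X (V y) := by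
  rw [cov_apply, fderiv_clm (smooth_differentiableAt (smooth_fderiv hF)) hV, sff_apply]
  simp
  abel

/-- The covariant derivative `(∇_Z b)(X, Y)` of a bilinear form `b` with values in a bundle. -/
noncomputable def covBil {W : Type*} [NormedAddCommGroup W] [NormedSpace ℝ W]
    (Γ : E → E →L[ℝ] E →L[ℝ] E) (θ : E → E →L[ℝ] W →L[ℝ] W)
    (b : E → E →L[ℝ] E →L[ℝ] W) (y Z X Y : E) : W :=
  cov θ (fun z => b z X Y) y Z - b y (Γ y Z X) Y - b y X (Γ y Z Y)

lemma cov_bil {W : Type*} [NormedAddCommGroup W] [NormedSpace ℝ W]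
    {θ : E → E →L[ℝ] W →L[ℝ] W} {b : E → E →L[ℝ] E →L[ℝ] W} {u v : E → E}
    (hb : DifferentiableAt ℝ b y) (hu : DifferentiableAt ℝ u y) (hv : DifferentiableAt ℝ v y)
    (Z : E) :
    cov θ (fun z => b z (u z) (v z)) y Z
      = covBil Γ θ b y Z (u y) (v y) + b y (cov Γ u y Z) (v y) + b y (u y) (cov Γ v y Z) := by
  rw [cov_apply, fderiv_clm₂ hb hu hv, covBil, cov_apply,
    fderiv_clm₂ hb (differentiableAt_const _) (differentiableAt_const _)]
  simp
  abel

/-- The Codazzi equation for the second fundamental form of a map. -/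
lemma covBil_sff_sub (hΓ : ContDiffAt ℝ ∞ Γ y) (hΓ' : ContDiffAt ℝ ∞ Γ' (F y))
    (hF : ∀ᶠ z in 𝓝 y, ContDiffAt ℝ ∞ F z) (hs : ∀ X Y, Γ y X Y = Γ y Y X) (Y V X : E) :
    covBil Γ (pullback Γ' F) (sff Γ Γ' F) y Y V X - covBil Γ (pullback Γ' F) (sff Γ Γ' F) y V Y X
      = curvature Γ' (F y) (fderiv ℝ F y Y) (fderiv ℝ F y V) (fderiv ℝ F y X)
        - fderiv ℝ F y (curvature Γ y Y V X) := by
  have hFy := hF.self_of_nhds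
  have hF1 := smooth_fderiv hFy
  have hθ := smooth_pullback hΓ' hFy
  have hsX : ContDiffAt ℝ ∞ (fun z => fderiv ℝ F z X) y := hF1.clm_apply contDiffAt_const
  have hgam : ∀ A : E, ContDiffAt ℝ ∞ (fun z => Γ z A X) y := fun A =>
    (hΓ.clm_apply contDiffAt_const).clm_apply contDiffAt_const
  -- By the Gauss formula B(A, X) = ∇_A(dF X) - dF(∇_A X). Differentiating once more leaves iterated
  -- derivatives of dF X and of X, to which the Ricci identity applies upstairs and downstairs.
  have e : ∀ A B : E, cov (pullback Γ' F) (fun z => sff Γ Γ' F z A X) y B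
      = cov (pullback Γ' F) (fun z => cov (pullback Γ' F) (fun w => fderiv ℝ F w X) z A) y B
        - fderiv ℝ F y (cov Γ (fun z => cov Γ (fun _ => X) z A) y B)
        - sff Γ Γ' F y B (Γ y A X) := fun A B => by
    have h1 : (fun z => sff Γ Γ' F z A X) =ᶠ[𝓝 y]
        fun z => cov (pullback Γ' F) (fun w => fderiv ℝ F w X) z A
          - fderiv ℝ F z (Γ z A X) := by
      filter_upwards [hF] with z hz
      rw [cov_pushforward (Γ := Γ) hz (differentiableAt_const _)]
      simp
    rw [cov_congr h1, cov_sub (smooth_differentiableAt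
      ((smooth_cov hθ hsX).clm_apply contDiffAt_const))
      (smooth_differentiableAt (hF1.clm_apply (hgam A))),
      cov_pushforward (Γ := Γ) hFy (smooth_differentiableAt (hgam A))]
    simp only [cov_const]
    abel
  have r1 := cov_cov_sub hθ hsX Y V
  have r2 := cov_cov_sub hΓ (contDiffAt_const (c := X)) Y V
  rw [curvature_pullback hΓ' hFy] at r1
  rw [covBil, covBil, e V Y, e Y V, ← r1, ← r2, map_sub, hs V Y]
  abel

/-- The second covariant derivative of a field `dF(V)` along `F`. -/
lemma cov₂_pushforward (hΓ : ContDiffAt ℝ ∞ Γ y) (hΓ' : ContDiffAt ℝ ∞ Γ' (F y))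
    (hF : ∀ᶠ z in 𝓝 y, ContDiffAt ℝ ∞ F z) {V : E → E} (hV : ∀ᶠ z in 𝓝 y, ContDiffAt ℝ ∞ V z)
    (Y X : E) :
    cov₂ Γ (pullback Γ' F) (fun z => fderiv ℝ F z (V z)) y Y X
      = fderiv ℝ F y (cov₂ Γ Γ V y Y X) + sff Γ Γ' F y Y (cov Γ V y X)
        + sff Γ Γ' F y X (cov Γ V y Y)
        + covBil Γ (pullback Γ' F) (sff Γ Γ' F) y Y X (V y) := by
  have hFy := hF.self_of_nhds
  have hVy := hV.self_of_nhds
  have hB := smooth_sff hΓ hΓ' hFy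
  have hcV : ContDiffAt ℝ ∞ (fun z => cov Γ V z X) y :=
    (smooth_cov hΓ hVy).clm_apply contDiffAt_const
  have h1 : (fun z => cov (pullback Γ' F) (fun w => fderiv ℝ F w (V w)) z X) =ᶠ[𝓝 y]
      fun z => fderiv ℝ F z (cov Γ V z X) + sff Γ Γ' F z X (V z) := by
    filter_upwards [hF, hV] with z hz hz'
    rw [cov_pushforward hz (smooth_differentiableAt hz')]
  rw [cov₂, cov_congr h1, cov_add (smooth_differentiableAt ((smooth_fderiv hFy).clm_apply hcV))
    (smooth_differentiableAt ((hB.clm_apply contDiffAt_const).clm_apply hVy)),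
    cov_pushforward (Γ := Γ) hFy (smooth_differentiableAt hcV),
    cov_pushforward (Γ := Γ) hFy (smooth_differentiableAt hVy),
    cov_bil (Γ := Γ) (smooth_differentiableAt hB) (differentiableAt_const _)
      (smooth_differentiableAt hVy), cov_const, cov₂, map_sub]
  abel

/-- The Jacobi operator on `dF(V)`, before contraction. -/
lemma cov₂_pushforward_eq (hΓ : ContDiffAt ℝ ∞ Γ y) (hΓ' : ContDiffAt ℝ ∞ Γ' (F y))
    (hF : ∀ᶠ z in 𝓝 y, ContDiffAt ℝ ∞ F z) {V : E → E} (hV : ∀ᶠ z in 𝓝 y, ContDiffAt ℝ ∞ V z)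
    (hs : ∀ᶠ z in 𝓝 y, ∀ X Y, Γ z X Y = Γ z Y X)
    (hs' : ∀ᶠ z in 𝓝 (F y), ∀ X Y, Γ' z X Y = Γ' z Y X) (Y X : E) :
    cov₂ Γ (pullback Γ' F) (fun z => fderiv ℝ F z (V z)) y Y X
        + curvature Γ' (F y) (fderiv ℝ F y (V y)) (fderiv ℝ F y Y) (fderiv ℝ F y X)
      = fderiv ℝ F y (cov₂ Γ Γ V y Y X + curvature Γ y (V y) Y X)
        + sff Γ Γ' F y Y (cov Γ V y X) + sff Γ Γ' F y X (cov Γ V y Y)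
        + covBil Γ (pullback Γ' F) (sff Γ Γ' F) y (V y) Y X := by
  have hsF := hF.self_of_nhds.continuousAt.eventually hs'
  have hB : covBil Γ (pullback Γ' F) (sff Γ Γ' F) y Y X (V y)
      = covBil Γ (pullback Γ' F) (sff Γ Γ' F) y Y (V y) X := by
    have h1 : (fun z => sff Γ Γ' F z X (V y)) =ᶠ[𝓝 y] fun z => sff Γ Γ' F z (V y) X := by
      filter_upwards [hF, hs, hsF] with z h1 h2 h3
      exact sff_symm h1 h2 h3 _ _
    have h2 := sff_symm (Γ := Γ) (Γ' := Γ') hF.self_of_nhds hs.self_of_nhds hsF.self_of_nhds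
    rw [covBil, covBil, cov_congr h1, h2 _ (V y), h2 X]
    abel
  -- Codazzi exchanges the direction Y of differentiation with V; the two curvature terms it
  -- produces are those of the Jacobi operators of the target and of the source.
  have hc := covBil_sff_sub hΓ hΓ' hF hs.self_of_nhds Y (V y) X
  rw [cov₂_pushforward hΓ hΓ' hF hV, hB, sub_eq_iff_eq_add.mp hc, map_add,
    curvature_swap Γ' _ (fderiv ℝ F y Y), curvature_swap Γ _ Y, map_neg]
  abel

end SecondFundamentalForm

end TensorCalc

namespace TensorCalc

open Filter Topology

/-! ### Traces over dual frames -/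

section DualFrames

variable {E W : Type*} [NormedAddCommGroup E] [NormedSpace ℝ E]
  [AddCommGroup W] [Module ℝ W] {ι : Type*} [Fintype ι]

/-- `e` and `f` are dual frames for the inner product `g`. -/
structure IsDualFrame (g : E →L[ℝ] E →L[ℝ] ℝ) (e f : ι → E) : Prop where
  left : ∀ X, ∑ i, g (f i) X • e i = X
  right : ∀ X, ∑ i, g (e i) X • f i = X

/-- Bilinearity of an unbundled map. -/
structure IsBilin (b : E → E → W) : Prop where
  left : ∀ Y, IsLinearMap ℝ fun X => b X Y
  right : ∀ X, IsLinearMap ℝ (b X)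

lemma IsBilin.sum_smul_left {b : E → E → W} (hb : IsBilin b) (c : ι → ℝ) (x : ι → E) (Y : E) :
    b (∑ i, c i • x i) Y = ∑ i, c i • b (x i) Y := by
  have := map_sum ((hb.left Y).mk' _) (fun i => c i • x i) Finset.univ
  simp only [map_smul] at this
  exact this

lemma IsBilin.sum_smul_right {b : E → E → W} (hb : IsBilin b) (c : ι → ℝ) (x : ι → E) (X : E) :
    b X (∑ i, c i • x i) = ∑ i, c i • b X (x i) := by
  have := map_sum ((hb.right X).mk' _) (fun i => c i • x i) Finset.univ
  simp only [map_smul] at this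
  exact this

lemma IsBilin.of_clm {W : Type*} [NormedAddCommGroup W] [NormedSpace ℝ W]
    (b : E →L[ℝ] E →L[ℝ] W) : IsBilin fun X Y => b X Y :=
  ⟨fun Y => ⟨fun _ _ => by simp, fun _ _ => by simp⟩,
    fun X => ⟨fun _ _ => by simp, fun _ _ => by simp⟩⟩

lemma IsBilin.comp {E' : Type*} [NormedAddCommGroup E'] [NormedSpace ℝ E'] {b : E → E → W}
    (hb : IsBilin b) (L M : E' →L[ℝ] E) : IsBilin fun X Y => b (L X) (M Y) :=
  ⟨fun Y => ⟨fun _ _ => by simp [(hb.left _).map_add], fun _ _ => by simp [(hb.left _).map_smul]⟩,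
    fun X => ⟨fun _ _ => by simp [(hb.right _).map_add],
      fun _ _ => by simp [(hb.right _).map_smul]⟩⟩

variable {g : E →L[ℝ] E →L[ℝ] ℝ} {e f : ι → E}

/-- Both sides expand to the contraction of b(f_i, f_k) with the Gram matrix of e, which is
symmetric; b itself need not be. -/
lemma IsDualFrame.sum_swap (h : IsDualFrame g e f) {b : E → E → W} (hb : IsBilin b)
    (hsymm : ∀ X Y, g X Y = g Y X) : ∑ i, b (f i) (e i) = ∑ i, b (e i) (f i) := by
  have h1 : ∀ i, b (f i) (e i) = ∑ k, g (e k) (e i) • b (f i) (f k) := fun i => by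
    conv_lhs => rw [← h.right (e i)]
    exact hb.sum_smul_right _ _ _
  have h2 : ∀ k, b (e k) (f k) = ∑ i, g (e i) (e k) • b (f i) (f k) := fun k => by
    conv_lhs => rw [← h.right (e k)]
    exact hb.sum_smul_left _ _ _
  simp only [h1, h2]
  rw [Finset.sum_comm]
  exact Finset.sum_congr rfl fun k _ => Finset.sum_congr rfl fun i _ => by rw [hsymm]

/-- A skew J with J² = -1 is an isometry, so (Je, Jf) is again a pair of dual frames, and the trace
does not depend on the pair. -/
lemma IsDualFrame.sum_J (h : IsDualFrame g e f) {b : E → E → W} (hb : IsBilin b)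
    {J : E →L[ℝ] E} (hsq : ∀ X, J (J X) = -X) (hskew : ∀ X Y, g (J X) Y = -g X (J Y))
    (hsymm : ∀ X Y, g X Y = g Y X) :
    ∑ i, b (J (e i)) (J (f i)) = ∑ i, b (e i) (f i) := by
  have h1 : ∀ i, b (J (e i)) (J (f i)) = ∑ k, g (f k) (J (e i)) • b (e k) (J (f i)) := fun i => by
    conv_lhs => rw [← h.left (J (e i))]
    exact hb.sum_smul_left _ _ _
  have h2 : ∀ k, f k = J (∑ i, g (f k) (J (e i)) • f i) := fun k => by
    have : ∑ i, g (f k) (J (e i)) • f i = -J (f k) := by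
      conv_rhs => rw [← h.right (J (f k))]
      rw [← Finset.sum_neg_distrib]
      refine Finset.sum_congr rfl fun i _ => ?_
      rw [← neg_smul, hsymm (e i), hskew, neg_neg]
    rw [this, map_neg, hsq, neg_neg]
  simp only [h1]
  rw [Finset.sum_comm]
  refine Finset.sum_congr rfl fun k _ => ?_
  conv_rhs => rw [h2 k, map_sum]
  simp only [map_smul]
  exact (hb.sum_smul_right _ _ _).symm

/-- The trace is unchanged by J and also changes sign. Every vanishing trace involving the second
fundamental form comes from this. -/
lemma IsDualFrame.sum_eq_zero (h : IsDualFrame g e f) {b : E → E → W} (hb : IsBilin b)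
    {J : E →L[ℝ] E} (hsq : ∀ X, J (J X) = -X) (hskew : ∀ X Y, g (J X) Y = -g X (J Y))
    (hsymm : ∀ X Y, g X Y = g Y X) (hbJ : ∀ X Y, b (J X) (J Y) = -b X Y) :
    ∑ i, b (e i) (f i) = 0 := by
  have h := h.sum_J hb hsq hskew hsymm
  simp only [hbJ, Finset.sum_neg_distrib] at h
  have h2 : (2 : ℝ) • ∑ i, b (e i) (f i) = 0 := by
    rw [two_smul]; nth_rewrite 1 [← h]; abel
  exact (smul_eq_zero.mp h2).resolve_left (by norm_num)

lemma IsDualFrame.sum_smul (h : IsDualFrame g e f) {L : E → W} (hL : IsLinearMap ℝ L) (X : E) :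
    ∑ i, g (e i) X • L (f i) = L X := by
  have := map_sum (hL.mk' _) (fun i => g (e i) X • f i) Finset.univ
  rw [h.right X] at this
  simp only [map_smul] at this
  exact this.symm

lemma IsDualFrame.sum_smul' (h : IsDualFrame g e f) {L : E → W} (hL : IsLinearMap ℝ L) (X : E) :
    ∑ i, g (f i) X • L (e i) = L X := by
  have := map_sum (hL.mk' _) (fun i => g (f i) X • e i) Finset.univ
  rw [h.left X] at this
  simp only [map_smul] at this
  exact this.symm

end DualFrames

/-! ### Hermitian and Kähler curvature identities; holomorphic vector fields -/

section Kahler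

variable {E : Type*} [NormedAddCommGroup E] [NormedSpace ℝ E]

/-- An almost Hermitian structure `(g, J)` with a torsion-free metric connection `Γ` on the open
set `Ω` of a vector space. -/
structure IsHermitianData (Ω : Set E) (g : E → E →L[ℝ] E →L[ℝ] ℝ) (J : E → E →L[ℝ] E)
    (Γ : E → E →L[ℝ] E →L[ℝ] E) : Prop where
  isOpen : IsOpen Ω
  smooth_g : ∀ y ∈ Ω, ContDiffAt ℝ ∞ g y
  smooth_J : ∀ y ∈ Ω, ContDiffAt ℝ ∞ J y
  smooth_Γ : ∀ y ∈ Ω, ContDiffAt ℝ ∞ Γ y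
  g_symm : ∀ y ∈ Ω, ∀ X Y, g y X Y = g y Y X
  g_pos : ∀ y ∈ Ω, ∀ X, X ≠ 0 → 0 < g y X X
  J_sq : ∀ y ∈ Ω, ∀ X, J y (J y X) = -X
  J_isometry : ∀ y ∈ Ω, ∀ X Y, g y (J y X) (J y Y) = g y X Y
  torsion_free : ∀ y ∈ Ω, ∀ X Y, Γ y X Y = Γ y Y X
  metric : ∀ y ∈ Ω, ∀ X Y Z, fderiv ℝ g y X Y Z = g y (Γ y X Y) Z + g y Y (Γ y X Z)

/-- The covariant derivative `(∇_X J) Y`. -/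
noncomputable def covJ (J : E → E →L[ℝ] E) (Γ : E → E →L[ℝ] E →L[ℝ] E) (y X Y : E) : E :=
  fderiv ℝ J y X Y + Γ y X (J y Y) - J y (Γ y X Y)

/-- A Kähler structure `(g, J)` with Levi-Civita connection `Γ` on the open set `Ω`. -/
structure IsKahlerData (Ω : Set E) (g : E → E →L[ℝ] E →L[ℝ] ℝ) (J : E → E →L[ℝ] E)
    (Γ : E → E →L[ℝ] E →L[ℝ] E) : Prop extends IsHermitianData Ω g J Γ where
  parallel : ∀ y ∈ Ω, ∀ X Y, covJ J Γ y X Y = 0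

variable {Ω : Set E} {g : E → E →L[ℝ] E →L[ℝ] ℝ} {J : E → E →L[ℝ] E}
    {Γ : E → E →L[ℝ] E →L[ℝ] E} {y : E}

lemma cov_J_apply (hJ : DifferentiableAt ℝ J y) {v : E → E} (hv : DifferentiableAt ℝ v y) (X : E) :
    cov Γ (fun z => J z (v z)) y X = covJ J Γ y X (v y) + J y (cov Γ v y X) := by
  rw [cov_apply, fderiv_clm hJ hv, covJ, cov_apply, map_add]
  abel

namespace IsHermitianData

variable (H : IsHermitianData Ω g J Γ)
include H

lemma skew (hy : y ∈ Ω) (X Y : E) : g y (J y X) Y = -g y X (J y Y) := by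
  have := H.J_isometry y hy X (J y Y)
  rw [H.J_sq y hy, map_neg] at this
  linarith

lemma eq_of_inner (hy : y ∈ Ω) {X X' : E} (h : ∀ Z, g y X Z = g y X' Z) : X = X' := by
  by_contra hne
  have := H.g_pos y hy (X - X') (sub_ne_zero.mpr hne)
  rw [map_sub (g y), sub_apply, h, sub_self] at this
  exact lt_irrefl _ this

lemma eventually_mem (hy : y ∈ Ω) : ∀ᶠ z in 𝓝 y, z ∈ Ω := H.isOpen.mem_nhds hy

lemma fderiv_inner (hy : y ∈ Ω) {u v : E → E} (hu : DifferentiableAt ℝ u y)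
    (hv : DifferentiableAt ℝ v y) (X : E) :
    fderiv ℝ (fun z => g z (u z) (v z)) y X
      = g y (cov Γ u y X) (v y) + g y (u y) (cov Γ v y X) := by
  rw [fderiv_clm₂ (smooth_differentiableAt (H.smooth_g y hy)) hu hv, H.metric y hy]
  simp
  abel

/-- Differentiate J² = -1. -/
lemma covJ_J (hy : y ∈ Ω) (X Y : E) : covJ J Γ y X (J y Y) = -J y (covJ J Γ y X Y) := by
  have hJ := smooth_differentiableAt (H.smooth_J y hy)
  have h1 : (fun z => J z (J z Y)) =ᶠ[𝓝 y] fun _ => -Y := by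
    filter_upwards [H.eventually_mem hy] with z hz using H.J_sq z hz Y
  have h2 := cov_J_apply (Γ := Γ) hJ (hJ.clm_apply (differentiableAt_const Y)) X
  rw [cov_congr h1, cov_J_apply hJ (differentiableAt_const Y), cov_const, cov_const,
    map_add, H.J_sq y hy] at h2
  have h3 : covJ J Γ y X (J y Y) + J y (covJ J Γ y X Y) = 0 := by
    rw [map_neg] at h2
    have : -(Γ y X) Y = (covJ J Γ y X (J y Y) + J y (covJ J Γ y X Y)) + -(Γ y X) Y := by
      rw [add_assoc]; exact h2
    simpa using this
  exact eq_neg_of_add_eq_zero_left h3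

/-- Differentiate the skew-symmetry of J, using that the connection is metric. -/
lemma covJ_skew (hy : y ∈ Ω) (X Y Z : E) :
    g y (covJ J Γ y X Y) Z = -g y Y (covJ J Γ y X Z) := by
  have hJ := smooth_differentiableAt (H.smooth_J y hy)
  have h1 : (fun z => g z (J z Y) Z) =ᶠ[𝓝 y] fun z => -g z Y (J z Z) := by
    filter_upwards [H.eventually_mem hy] with z hz using H.skew hz Y Z
  have hc : ∀ A : E, DifferentiableAt ℝ (fun z => J z A) y := fun A =>
    hJ.clm_apply (differentiableAt_const A)
  have h2 := DFunLike.congr_fun (h1.fderiv_eq (𝕜 := ℝ)) X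
  rw [fderiv_fun_neg, neg_apply, H.fderiv_inner hy (hc Y) (differentiableAt_const _),
    H.fderiv_inner hy (differentiableAt_const _) (hc Z), cov_J_apply hJ (differentiableAt_const _),
    cov_J_apply hJ (differentiableAt_const _)] at h2
  simp only [cov_const, map_add, add_apply] at h2
  rw [H.skew hy, H.skew hy] at h2
  linarith

/-- The second derivative of the function g(Z, W), for constant Z and W, is symmetric in its two
directions. Expanded by metricity, its mixed terms are already symmetric, and what remains is the
claim. -/
lemma curvature_skew (hy : y ∈ Ω) (X Y Z W : E) :
    g y (curvature Γ y X Y Z) W = -g y Z (curvature Γ y X Y W) := by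
  have hG := H.smooth_Γ y hy
  have hf : ContDiffAt ℝ ∞ (fun z => g z Z W) y :=
    ((H.smooth_g y hy).clm_apply contDiffAt_const).clm_apply contDiffAt_const
  have hc : ∀ A B : E, DifferentiableAt ℝ (fun z => cov Γ (fun _ => A) z B) y := fun A B =>
    smooth_differentiableAt ((smooth_cov hG contDiffAt_const).clm_apply contDiffAt_const)
  have key : ∀ A B : E, fderiv ℝ (fderiv ℝ (fun z => g z Z W)) y A B
      = g y (cov Γ (fun z => cov Γ (fun _ => Z) z B) y A) W
        + g y (Γ y B Z) (Γ y A W) + g y (Γ y A Z) (Γ y B W)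
        + g y Z (cov Γ (fun z => cov Γ (fun _ => W) z B) y A) := fun A B => by
    have h1 : (fun z => fderiv ℝ (fun z => g z Z W) z B) =ᶠ[𝓝 y]
        fun z => g z (cov Γ (fun _ => Z) z B) W + g z Z (cov Γ (fun _ => W) z B) := by
      filter_upwards [H.eventually_mem hy] with z hz
      exact H.fderiv_inner hz (differentiableAt_const _) (differentiableAt_const _) B
    have hg := smooth_differentiableAt (H.smooth_g y hy)
    rw [← fderiv_clm_const (smooth_differentiableAt (smooth_fderiv hf)), h1.fderiv_eq,
      fderiv_fun_add ((hg.clm_apply (hc Z B)).clm_apply (differentiableAt_const _))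
        ((hg.clm_apply (differentiableAt_const _)).clm_apply (hc W B)), add_apply,
      H.fderiv_inner hy (hc Z B) (differentiableAt_const _),
      H.fderiv_inner hy (differentiableAt_const _) (hc W B)]
    simp only [cov_const]
    abel
  have h := smooth_fderiv_symm hf X Y
  rw [key, key] at h
  rw [← cov_cov_sub hG (contDiffAt_const (c := Z)), ← cov_cov_sub hG (contDiffAt_const (c := W)),
    map_sub, map_sub, sub_apply]
  linarith

lemma bianchi (hy : y ∈ Ω) (X Y Z : E) :
    curvature Γ y X Y Z + curvature Γ y Y Z X + curvature Γ y Z X Y = 0 :=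
  TensorCalc.bianchi (H.smooth_Γ y hy)
    ((H.eventually_mem hy).mono fun z hz => H.torsion_free z hz) X Y Z

end IsHermitianData

lemma curvature_isBilin (Γ : E → E →L[ℝ] E →L[ℝ] E) (y X : E) :
    IsBilin fun Y Z => curvature Γ y X Y Z := by
  constructor <;> intro Y <;> constructor <;> intros <;> simp [curvature, smul_sub] <;> abel

lemma curvature_isBilin' (Γ : E → E →L[ℝ] E →L[ℝ] E) (y Z : E) :
    IsBilin fun X Y => curvature Γ y X Y Z := by
  constructor <;> intro Y <;> constructor <;> intros <;> simp [curvature, smul_sub] <;> abel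

/-- The Ricci operator, as a contraction over dual frames. -/
noncomputable def ricOp {ι : Type*} [Fintype ι] (Γ : E → E →L[ℝ] E →L[ℝ] E) (e f : ι → E)
    (y P : E) : E := ∑ i, curvature Γ y P (e i) (f i)

lemma cov₂_isBilin {V W : Type*} [NormedAddCommGroup V] [NormedSpace ℝ V]
    [NormedAddCommGroup W] [NormedSpace ℝ W] {Γ : V → V →L[ℝ] V →L[ℝ] V}
    {θ : V → V →L[ℝ] W →L[ℝ] W} {y : V} (hθ : ContDiffAt ℝ ∞ θ y) {v : V → W}
    (hv : ContDiffAt ℝ ∞ v y) : IsBilin (cov₂ Γ θ v y) := by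
  have : cov₂ Γ θ v y = fun X Y => fderiv ℝ (fderiv ℝ v) y X Y + fderiv ℝ θ y X Y (v y)
      + θ y Y (fderiv ℝ v y X) + θ y X (fderiv ℝ v y Y) + θ y X (θ y Y (v y))
      - (fderiv ℝ v y (Γ y X Y) + θ y (Γ y X Y) (v y)) := by
    ext X Y
    rw [cov₂, cov_cov hθ hv, cov_apply]
  rw [this]
  constructor <;> intro Y <;> constructor <;> intros <;> simp [smul_sub, smul_add] <;> abel

namespace IsKahlerData

variable (K : IsKahlerData Ω g J Γ) {ι : Type*} [Fintype ι] {e f : ι → E}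
include K

lemma cov_J (hy : y ∈ Ω) {v : E → E} (hv : DifferentiableAt ℝ v y) (X : E) :
    cov Γ (fun z => J z (v z)) y X = J y (cov Γ v y X) := by
  rw [cov_J_apply (smooth_differentiableAt (K.smooth_J y hy)) hv, K.parallel y hy, zero_add]

/-- A parallel J passes through iterated covariant derivatives, hence through the Ricci identity. -/
lemma curvature_J (hy : y ∈ Ω) (X Y Z : E) :
    curvature Γ y X Y (J y Z) = J y (curvature Γ y X Y Z) := by
  have hG := K.smooth_Γ y hy
  have hJ : ContDiffAt ℝ ∞ (fun z => J z Z) y := (K.smooth_J y hy).clm_apply contDiffAt_const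
  have h1 : ∀ A B : E, cov Γ (fun z => cov Γ (fun w => J w Z) z B) y A
      = J y (cov Γ (fun z => cov Γ (fun _ => Z) z B) y A) := fun A B => by
    have : (fun z => cov Γ (fun w => J w Z) z B) =ᶠ[𝓝 y]
        fun z => J z (cov Γ (fun _ => Z) z B) := by
      filter_upwards [K.eventually_mem hy] with z hz
      exact K.cov_J hz (differentiableAt_const Z) B
    rw [cov_congr this, K.cov_J hy (smooth_differentiableAt
      ((smooth_cov hG contDiffAt_const).clm_apply contDiffAt_const))]
  have h2 := cov_cov_sub hG hJ X Y
  rw [h1, h1, ← map_sub, cov_cov_sub hG contDiffAt_const] at h2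
  exact h2.symm

/-- The first Bianchi identity rewrites each summand as two curvature terms with P in the first
slot. Once J has been moved across, each of them traces to -Ric P. -/
lemma sum_J_curvature (hy : y ∈ Ω) (hF : IsDualFrame (g y) e f) (P : E) :
    ∑ i, J y (curvature Γ y (J y (e i)) (f i) P) = (-2 : ℝ) • ricOp Γ e f y P := by
  have h1 : ∀ i, J y (curvature Γ y (J y (e i)) (f i) P)
      = -curvature Γ y P (f i) (e i) - curvature Γ y P (J y (e i)) (J y (f i)) := fun i => by
    have h := K.bianchi hy (J y (e i)) (f i) P
    have h' : curvature Γ y (J y (e i)) (f i) P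
        = -curvature Γ y (f i) P (J y (e i)) - curvature Γ y P (J y (e i)) (f i) := by
      rw [add_assoc] at h
      rw [eq_neg_of_add_eq_zero_left h]; abel
    rw [h', map_sub, map_neg, K.curvature_J hy, K.J_sq y hy, ← K.curvature_J hy,
      curvature_swap Γ y (f i)]
    simp
  simp only [h1, Finset.sum_sub_distrib, Finset.sum_neg_distrib]
  rw [hF.sum_swap (curvature_isBilin Γ y P) (K.g_symm y hy),
    hF.sum_J (curvature_isBilin Γ y P) (K.J_sq y hy) (K.skew hy) (K.g_symm y hy), ricOp]
  module

/-- The contraction in `sum_J_curvature` visibly commutes with J in P, and it is a nonzero multiple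
of the Ricci operator. -/
lemma ricOp_J (hy : y ∈ Ω) (hF : IsDualFrame (g y) e f) (P : E) :
    ricOp Γ e f y (J y P) = J y (ricOp Γ e f y P) := by
  have h1 := K.sum_J_curvature hy hF (J y P)
  have h2 := congrArg (J y) (K.sum_J_curvature hy hF P)
  simp only [K.curvature_J hy] at h1
  rw [map_sum, h1, map_smul] at h2
  exact smul_right_injective E (by norm_num : (-2 : ℝ) ≠ 0) h2

/-- If `∇P` commutes with `J` then `P` is holomorphic, and `ΔP + Ric P = 0`. -/
lemma sum_cov₂_add_ricOp (hy : y ∈ Ω) (hF : IsDualFrame (g y) e f) {P : E → E}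
    (hP : ContDiffAt ℝ ∞ P y)
    (hPJ : ∀ᶠ z in 𝓝 y, ∀ X, cov Γ P z (J z X) = J z (cov Γ P z X)) :
    ∑ i, cov₂ Γ Γ P y (e i) (f i) + ricOp Γ e f y (P y) = 0 := by
  have hG := K.smooth_Γ y hy
  have hL := smooth_cov hG hP
  have hcov : ∀ Y : E, DifferentiableAt ℝ (fun z => cov Γ P z Y) y := fun Y =>
    smooth_differentiableAt (hL.clm_apply contDiffAt_const)
  -- Differentiating ∇P ∘ J = J ∘ ∇P with ∇J = 0 makes ∇²P complex linear in its second slot.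
  have key : ∀ X Y, cov₂ Γ Γ P y X (J y Y) = J y (cov₂ Γ Γ P y X Y) := fun X Y => by
    have h1 : (fun z => cov Γ P z (J z Y)) =ᶠ[𝓝 y] fun z => J z (cov Γ P z Y) :=
      hPJ.mono fun z hz => hz Y
    have hJ : DifferentiableAt ℝ (fun z => J z Y) y :=
      smooth_differentiableAt ((K.smooth_J y hy).clm_apply contDiffAt_const)
    have h2 : cov Γ (fun z => cov Γ P z (J z Y)) y X
        = cov Γ (fun z => cov Γ P z (J y Y)) y X - cov Γ P y (Γ y X (J y Y))
          + cov Γ P y (cov Γ (fun z => J z Y) y X) := by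
      rw [cov_apply _ (fun z => cov Γ P z (J z Y)), cov_apply _ (fun z => cov Γ P z (J y Y)),
        fderiv_clm (smooth_differentiableAt hL) hJ,
        fderiv_clm_const (smooth_differentiableAt hL), cov_apply _ (fun z => J z Y), map_add]
      abel
    rw [cov_congr h1, K.cov_J hy (hcov Y), K.cov_J hy (differentiableAt_const Y), cov_const,
      hPJ.self_of_nhds] at h2
    rw [cov₂, cov₂, map_sub, h2]
    abel
  have hb := cov₂_isBilin (Γ := Γ) hG hP
  have h1 := hF.sum_J hb (K.J_sq y hy) (K.skew hy) (K.g_symm y hy)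
  -- To free the first slot of J, swap the slots by the Ricci identity and use linearity in the
  -- second; the price is a curvature term whose trace is -2 Ric P. As the trace is also
  -- J-invariant, this gives ΔP = -ΔP - 2 Ric P.
  have h2 : ∀ i, cov₂ Γ Γ P y (J y (e i)) (J y (f i))
      = -cov₂ Γ Γ P y (f i) (e i) + J y (curvature Γ y (J y (e i)) (f i) (P y)) := fun i => by
    rw [key, ← cov₂_sub hG hP (K.torsion_free y hy), map_sub, key, K.J_sq y hy]
    abel
  simp only [h2, Finset.sum_add_distrib, Finset.sum_neg_distrib] at h1
  rw [hF.sum_swap hb (K.g_symm y hy), K.sum_J_curvature hy hF] at h1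
  have h3 : (2 : ℝ) • (∑ i, cov₂ Γ Γ P y (e i) (f i) + ricOp Γ e f y (P y)) = 0 := by
    rw [smul_add, two_smul]
    nth_rewrite 1 [← h1]
    module
  exact (smul_eq_zero.mp h3).resolve_left (by norm_num)

end IsKahlerData

end Kahler

end TensorCalc

namespace TensorCalc

open Filter Topology

/-! ### Holomorphic maps, the (1,2)-symplectic condition, closed fundamental forms -/

section Holomorphic

variable {E E' : Type*} [NormedAddCommGroup E] [NormedSpace ℝ E]
  [NormedAddCommGroup E'] [NormedSpace ℝ E']
  {Ω : Set E} {g : E → E →L[ℝ] E →L[ℝ] ℝ} {J : E → E →L[ℝ] E} {Γ : E → E →L[ℝ] E →L[ℝ] E}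
  {Ω' : Set E'} {g' : E' → E' →L[ℝ] E' →L[ℝ] ℝ} {J' : E' → E' →L[ℝ] E'}
  {Γ' : E' → E' →L[ℝ] E' →L[ℝ] E'} {F : E → E'} {y : E}

/-- The second fundamental form of a holomorphic map from a Kähler to a quasi-Kähler manifold has
no `(1,1)`-part. -/
lemma sff_J_J (K : IsKahlerData Ω g J Γ) (H : IsHermitianData Ω' g' J' Γ') (hy : y ∈ Ω)
    (hFy : F y ∈ Ω') (hF : ContDiffAt ℝ ∞ F y)
    (hhol : ∀ᶠ z in 𝓝 y, ∀ X, fderiv ℝ F z (J z X) = J' (F z) (fderiv ℝ F z X))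
    (hQ : ∀ X Y, covJ J' Γ' (F y) (J' (F y) X) (J' (F y) Y) = -covJ J' Γ' (F y) X Y) (X Y : E) :
    sff Γ Γ' F y (J y X) (J y Y) = -sff Γ Γ' F y X Y := by
  have hF1 := smooth_fderiv hF
  have hJ' := smooth_differentiableAt (H.smooth_J _ hFy)
  have hJ := smooth_differentiableAt (K.smooth_J y hy)
  have hQ' : ∀ A B, covJ J' Γ' (F y) (J' (F y) A) B = covJ J' Γ' (F y) A (J' (F y) B) :=
    fun A B => by
    have h := hQ A (J' (F y) B)
    rw [H.J_sq _ hFy] at h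
    have hneg : covJ J' Γ' (F y) (J' (F y) A) (-B) = -covJ J' Γ' (F y) (J' (F y) A) B := by
      simp [covJ]; abel
    rw [hneg] at h
    exact neg_injective h
  -- Differentiate dF ∘ J = J' ∘ dF. As J is parallel, the only defect from complex linearity is
  -- ∇J'.
  have step : ∀ A B, sff Γ Γ' F y A (J y B)
      = J' (F y) (sff Γ Γ' F y A B)
        + covJ J' Γ' (F y) (fderiv ℝ F y A) (fderiv ℝ F y B) := fun A B => by
    have h1 : (fun z => fderiv ℝ F z (J z B)) =ᶠ[𝓝 y] fun z => J' (F z) (fderiv ℝ F z B) :=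
      hhol.mono fun z hz => hz B
    have h2 := cov_pushforward (Γ := Γ) (Γ' := Γ') hF (hJ.clm_apply (differentiableAt_const B)) A
    have h3 := cov_pushforward (Γ := Γ) (Γ' := Γ') hF (differentiableAt_const B) A
    rw [cov_congr h1, K.cov_J hy (differentiableAt_const B), cov_const, hhol.self_of_nhds] at h2
    rw [cov_const] at h3
    have h4 : cov (pullback Γ' F) (fun z => J' (F z) (fderiv ℝ F z B)) y A
        = covJ J' Γ' (F y) (fderiv ℝ F y A) (fderiv ℝ F y B)
          + J' (F y) (cov (pullback Γ' F) (fun z => fderiv ℝ F z B) y A) := by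
      have hJF : DifferentiableAt ℝ (fun z => J' (F z)) y :=
        hJ'.comp y (smooth_differentiableAt hF)
      have hc : fderiv ℝ (fun z => J' (F z)) y = (fderiv ℝ J' (F y)).comp (fderiv ℝ F y) :=
        fderiv_comp y hJ' (smooth_differentiableAt hF)
      rw [cov_apply, cov_apply, fderiv_clm hJF
        ((smooth_differentiableAt hF1).clm_apply (differentiableAt_const B)), hc, covJ]
      simp
      abel
    rw [h4, h3, map_add] at h2
    have h5 : sff Γ Γ' F y A (J y B) = (covJ J' Γ' (F y) (fderiv ℝ F y A) (fderiv ℝ F y B)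
        + (J' (F y) (fderiv ℝ F y (Γ y A B)) + J' (F y) (sff Γ Γ' F y A B)))
        - J' (F y) (fderiv ℝ F y (Γ y A B)) := by rw [h2]; abel
    rw [h5]; abel
  have hsymm := sff_symm (Γ := Γ) (Γ' := Γ') hF (K.torsion_free y hy) (H.torsion_free _ hFy)
  have hhy := hhol.self_of_nhds
  set Q := covJ J' Γ' (F y) with hQdef
  -- The error term is antisymmetric in A and B while the second fundamental form is symmetric, so
  -- adding the two orders removes it.
  have e : ∀ A B, sff Γ Γ' F y (J y A) (J y B) = -sff Γ Γ' F y A B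
      + (J' (F y) (Q (fderiv ℝ F y B) (fderiv ℝ F y A))
        - J' (F y) (Q (fderiv ℝ F y A) (fderiv ℝ F y B))) := fun A B => by
    rw [step, hsymm (J y A) B, step, hhy, hQ', hQdef, H.covJ_J hFy, map_add, H.J_sq _ hFy,
      hsymm B A]
    abel
  have h1 := e X Y
  have h2 := e Y X
  rw [hsymm (J y Y), hsymm Y X] at h2
  have h3 : (2 : ℝ) • sff Γ Γ' F y (J y X) (J y Y) = (2 : ℝ) • -sff Γ Γ' F y X Y := by
    rw [two_smul, two_smul]
    nth_rewrite 1 [h1]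
    rw [h2]
    abel
  exact smul_right_injective E' (by norm_num : (2 : ℝ) ≠ 0) h3

/-- Differentiate the identity for b; J is parallel, so it is not affected. -/
lemma covBil_J_J {W : Type*} [NormedAddCommGroup W] [NormedSpace ℝ W]
    {θ : E → E →L[ℝ] W →L[ℝ] W} {b : E → E →L[ℝ] E →L[ℝ] W}
    (K : IsKahlerData Ω g J Γ) (hy : y ∈ Ω) (hb : DifferentiableAt ℝ b y)
    (hbJ : ∀ᶠ z in 𝓝 y, ∀ X Y, b z (J z X) (J z Y) = -b z X Y) (Z X Y : E) :
    covBil Γ θ b y Z (J y X) (J y Y) = -covBil Γ θ b y Z X Y := by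
  have hJ := smooth_differentiableAt (K.smooth_J y hy)
  have hJX : ∀ A : E, DifferentiableAt ℝ (fun z => J z A) y := fun A =>
    hJ.clm_apply (differentiableAt_const A)
  have h1 : (fun z => b z (J z X) (J z Y)) =ᶠ[𝓝 y] fun z => -b z X Y :=
    hbJ.mono fun z hz => hz X Y
  have h2 := cov_bil (Γ := Γ) (θ := θ) hb (hJX X) (hJX Y) Z
  have hbJy := hbJ.self_of_nhds
  rw [cov_congr h1, K.cov_J hy (differentiableAt_const X),
    K.cov_J hy (differentiableAt_const Y), cov_const, cov_const, hbJy, hbJy] at h2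
  have h3 : cov θ (fun z => -b z X Y) y Z = -cov θ (fun z => b z X Y) y Z := by
    simp; abel
  rw [h3] at h2
  have h4 : covBil Γ θ b y Z (J y X) (J y Y) = -cov θ (fun z => b z X Y) y Z
      + b y (Γ y Z X) Y + b y X (Γ y Z Y) := by rw [h2]; abel
  rw [h4, covBil]
  abel

/-- The exterior derivative of the fundamental form `g(X, JY)`. -/
noncomputable def dFund (g : E → E →L[ℝ] E →L[ℝ] ℝ) (J : E → E →L[ℝ] E) (y X Y Z : E) : ℝ :=
  fderiv ℝ (fun z => g z Y (J z Z)) y X + fderiv ℝ (fun z => g z Z (J z X)) y Y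
    + fderiv ℝ (fun z => g z X (J z Y)) y Z

/-- The Nijenhuis tensor. -/
noncomputable def nijTensor (J : E → E →L[ℝ] E) (y X Y : E) : E :=
  fderiv ℝ J y (J y X) Y - fderiv ℝ J y (J y Y) X - J y (fderiv ℝ J y X Y - fderiv ℝ J y Y X)

namespace IsHermitianData

lemma inner_covJ_J (H : IsHermitianData Ω g J Γ) (hy : y ∈ Ω) (X Y Z : E) :
    g y Y (covJ J Γ y X (J y Z)) = g y (J y Y) (covJ J Γ y X Z) := by
  rw [H.covJ_J hy, map_neg, H.skew hy]

lemma inner_covJ_J_J (H : IsHermitianData Ω g J Γ) (hy : y ∈ Ω) (X Y Z : E) :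
    g y (J y Y) (covJ J Γ y X (J y Z)) = -g y Y (covJ J Γ y X Z) := by
  rw [H.inner_covJ_J hy, H.J_sq y hy]; simp

/-- The Christoffel terms cancel because the connection is torsion-free and J is skew, so dΩ depends
only on ∇J. -/
lemma dFund_eq (H : IsHermitianData Ω g J Γ) (hy : y ∈ Ω) (X Y Z : E) :
    dFund g J y X Y Z = g y Y (covJ J Γ y X Z) + g y Z (covJ J Γ y Y X)
      + g y X (covJ J Γ y Z Y) := by
  have hJ := smooth_differentiableAt (H.smooth_J y hy)
  have key : ∀ A B C, fderiv ℝ (fun z => g z B (J z C)) y A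
      = g y (Γ y A B) (J y C) + g y B (covJ J Γ y A C) + g y B (J y (Γ y A C)) := fun A B C => by
    rw [H.fderiv_inner hy (differentiableAt_const _) (hJ.clm_apply (differentiableAt_const _)),
      cov_J_apply hJ (differentiableAt_const _), cov_const, cov_const, map_add]
    abel
  have sk : ∀ A B, g y A (J y B) = -g y B (J y A) := fun A B => by
    rw [H.g_symm y hy A, H.skew hy]
  rw [dFund, key, key, key, sk Y (Γ y X Z), sk Z (Γ y Y X), sk X (Γ y Z Y),
    H.torsion_free y hy X Z, H.torsion_free y hy Y X, H.torsion_free y hy Z Y]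
  ring

/-- If the `(1,2)`-part of `dΩ` vanishes then `(∇_{JX} J) JY = -(∇_X J) Y`. -/
lemma covJ_J_J (H : IsHermitianData Ω g J Γ) (hy : y ∈ Ω)
    (h : ∀ X Y V, dFund g J y X Y V - dFund g J y X (J y Y) (J y V)
      + dFund g J y (J y X) (J y Y) V + dFund g J y (J y X) Y (J y V) = 0) (X V : E) :
    covJ J Γ y (J y X) (J y V) = -covJ J Γ y X V := by
  refine H.eq_of_inner hy fun Y => ?_
  have h1 := h X Y V
  -- The terms that differentiate J along Y, V, JY or JV cancel in pairs. Those along X and JX add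
  -- up to twice the wanted identity paired with Y.
  simp only [H.dFund_eq hy, H.inner_covJ_J_J hy, H.inner_covJ_J hy] at h1
  have h2 := H.inner_covJ_J hy (J y X) Y V
  rw [H.g_symm y hy _ Y, H.g_symm y hy _ Y, map_neg, h2]
  linarith

end IsHermitianData

/-- A Hermitian metric with closed fundamental form is Kähler: `∇J = 0`. -/
lemma IsHermitianData.isKahlerData (H : IsHermitianData Ω g J Γ)
    (hd : ∀ y ∈ Ω, ∀ X Y Z, dFund g J y X Y Z = 0) (hn : ∀ y ∈ Ω, ∀ X Y, nijTensor J y X Y = 0) :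
    IsKahlerData Ω g J Γ := by
  refine ⟨H, fun y hy X Y => ?_⟩
  have q := H.covJ_J_J hy (by simp [hd y hy])
  have q' : ∀ A B, covJ J Γ y (J y A) B = -J y (covJ J Γ y A B) := fun A B => by
    have h := congrArg (J y) (q A B)
    rw [H.covJ_J hy, map_neg, map_neg, H.J_sq y hy, neg_neg] at h
    exact h
  -- With `q'`, the Nijenhuis tensor is -2J times the antisymmetric part of ∇J.
  have s : ∀ A B, covJ J Γ y A B = covJ J Γ y B A := fun A B => by
    have h : nijTensor J y A B = (covJ J Γ y (J y A) B - J y (covJ J Γ y A B))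
        - (covJ J Γ y (J y B) A - J y (covJ J Γ y B A)) := by
      simp only [nijTensor, covJ, map_sub, map_add]
      rw [H.torsion_free y hy (J y A) B, H.torsion_free y hy (J y B) A,
        H.torsion_free y hy (J y A) (J y B), H.torsion_free y hy A B]
      abel
    rw [hn y hy, q', q'] at h
    have h' : (2 : ℝ) • J y (covJ J Γ y A B) = (2 : ℝ) • J y (covJ J Γ y B A) := by
      rw [← sub_eq_zero, ← neg_eq_zero]
      conv_rhs => rw [h]
      module
    have h'' := congrArg (J y) (smul_right_injective E (by norm_num : (2 : ℝ) ≠ 0) h')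
    rw [H.J_sq y hy, H.J_sq y hy] at h''
    exact neg_injective h''
  have k : ∀ A B C, g y (covJ J Γ y A B) C = -g y (covJ J Γ y A C) B := fun A B C => by
    rw [H.covJ_skew hy, H.g_symm y hy B]
  refine H.eq_of_inner hy fun Z => ?_
  -- A trilinear form symmetric in the first two arguments and skew in the last two vanishes: three
  -- swaps of each kind return it with the opposite sign.
  have : g y (covJ J Γ y X Y) Z = -g y (covJ J Γ y X Y) Z := by
    conv_lhs => rw [k, s, k, s, k, s, neg_neg]
  rw [map_zero, zero_apply]
  linarith

end Holomorphic

end TensorCalc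

namespace TensorCalc

open Filter Topology

/-! ### Curvature under a conformal change -/

section Conformal

variable {E : Type*} [NormedAddCommGroup E] [NormedSpace ℝ E]
  {Ω : Set E} {g : E → E →L[ℝ] E →L[ℝ] ℝ} {J : E → E →L[ℝ] E} {Γ Γc : E → E →L[ℝ] E →L[ℝ] E}
  {u : E → E} {y : E}

/-- `Γc` is the Levi-Civita connection of `e^{2γ} g`, where `Γ` is that of `g` and `u` is the
`g`-gradient of `γ`. -/
def IsConformalChange (g : E → E →L[ℝ] E →L[ℝ] ℝ) (u : E → E) (Γ Γc : E → E →L[ℝ] E →L[ℝ] E)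
    (y : E) : Prop :=
  ∀ X Y, Γc y X Y = Γ y X Y + g y (u y) X • Y + g y (u y) Y • X - g y X Y • u y

/-- The endomorphism `X ↦ ∇_X u - ⟨u, X⟩ u + |u|² X / 2`. -/
noncomputable def schoutenShift (g : E → E →L[ℝ] E →L[ℝ] ℝ) (u : E → E)
    (Γ : E → E →L[ℝ] E →L[ℝ] E) (y X : E) : E :=
  cov Γ u y X - g y (u y) X • u y + (1 / 2 * g y (u y) (u y)) • X

lemma schoutenShift_isLinearMap : IsLinearMap ℝ (schoutenShift g u Γ y) := by
  constructor <;> intros <;> simp only [schoutenShift, map_add, map_smul, smul_eq_mul] <;> module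

/-- Insert the difference of the connections into the Ricci identity for a constant field Z. The
quadratic terms in u complete ∇u to `schoutenShift`. The symmetry of ∇u, available because u is a
gradient, removes the remaining multiple of Z. -/
lemma IsHermitianData.curvature_conformal (H : IsHermitianData Ω g J Γ) (hy : y ∈ Ω)
    (hΓc : ContDiffAt ℝ ∞ Γc y) (hu : ContDiffAt ℝ ∞ u y)
    (hc : ∀ᶠ z in 𝓝 y, IsConformalChange g u Γ Γc z)
    (hsym : ∀ X Y, g y (cov Γ u y X) Y = g y (cov Γ u y Y) X) (X Y Z : E) :
    curvature Γc y X Y Z = curvature Γ y X Y Z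
      - g y (schoutenShift g u Γ y Y) Z • X + g y (schoutenShift g u Γ y X) Z • Y
      - g y Y Z • schoutenShift g u Γ y X + g y X Z • schoutenShift g u Γ y Y := by
  have hG := H.smooth_Γ y hy
  have hg := H.smooth_g y hy
  have hcy : IsConformalChange g u Γ Γc y := hc.self_of_nhds
  have hu' := smooth_differentiableAt hu
  have dg : ∀ A B : E, DifferentiableAt ℝ (fun z => g z A B) y := fun A B =>
    smooth_differentiableAt ((hg.clm_apply contDiffAt_const).clm_apply contDiffAt_const)
  have dgu : ∀ A : E, DifferentiableAt ℝ (fun z => g z (u z) A) y := fun A =>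
    smooth_differentiableAt ((hg.clm_apply hu).clm_apply contDiffAt_const)
  have dG : ∀ A B : E, DifferentiableAt ℝ (fun z => Γ z A B) y := fun A B =>
    smooth_differentiableAt ((hG.clm_apply contDiffAt_const).clm_apply contDiffAt_const)
  have covc : ∀ (w : E → E) (A : E), cov Γc w y A
      = cov Γ w y A + g y (u y) A • w y + g y (u y) (w y) • A - g y A (w y) • u y := fun w A => by
    rw [cov_apply, cov_apply, hcy]; abel
  have key : ∀ A B, cov Γc (fun z => cov Γc (fun _ => Z) z B) y A
      = cov Γ (fun z => cov Γ (fun _ => Z) z B) y A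
        + ((g y (cov Γ u y A) B + g y (u y) (Γ y A B)) • Z + g y (u y) B • Γ y A Z)
        + ((g y (cov Γ u y A) Z + g y (u y) (Γ y A Z)) • B + g y (u y) Z • Γ y A B)
        - ((g y (Γ y A B) Z + g y B (Γ y A Z)) • u y + g y B Z • cov Γ u y A)
        + g y (u y) A • Γc y B Z + g y (u y) (Γc y B Z) • A - g y A (Γc y B Z) • u y :=
      fun A B => by
    have h1 : (fun z => cov Γc (fun _ => Z) z B) =ᶠ[𝓝 y] fun z =>
        Γ z B Z + g z (u z) B • Z + g z (u z) Z • B - g z B Z • u z := by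
      filter_upwards [hc] with z hz
      rw [cov_const, hz]
    have h2 : cov Γ (fun z => Γ z B Z + g z (u z) B • Z + g z (u z) Z • B - g z B Z • u z) y A
        = cov Γ (fun z => Γ z B Z) y A
        + ((g y (cov Γ u y A) B + g y (u y) (Γ y A B)) • Z + g y (u y) B • Γ y A Z)
        + ((g y (cov Γ u y A) Z + g y (u y) (Γ y A Z)) • B + g y (u y) Z • Γ y A B)
        - ((g y (Γ y A B) Z + g y B (Γ y A Z)) • u y + g y B Z • cov Γ u y A) := by
      have d1 : DifferentiableAt ℝ (fun z => g z (u z) B • Z) y :=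
        (dgu B).smul (differentiableAt_const Z)
      have d2 : DifferentiableAt ℝ (fun z => g z (u z) Z • B) y :=
        (dgu Z).smul (differentiableAt_const B)
      have d3 : DifferentiableAt ℝ (fun z => g z B Z • u z) y := (dg B Z).smul hu'
      rw [cov_sub (((dG B Z).fun_add d1).fun_add d2) d3, cov_add ((dG B Z).fun_add d1) d2,
        cov_add (dG B Z) d1,
        cov_smul (dgu B) (differentiableAt_const Z), cov_smul (dgu Z) (differentiableAt_const B),
        cov_smul (dg B Z) hu', H.fderiv_inner hy hu' (differentiableAt_const B),
        H.fderiv_inner hy hu' (differentiableAt_const Z),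
        H.fderiv_inner hy (differentiableAt_const B) (differentiableAt_const Z)]
      simp only [cov_const]
    rw [covc, cov_congr h1, h2]
    simp only [cov_const]
  rw [← cov_cov_sub hΓc contDiffAt_const, ← cov_cov_sub hG contDiffAt_const, key, key,
    hcy X Z, hcy Y Z, hsym X Y, H.torsion_free y hy Y X]
  simp only [schoutenShift, map_add, map_sub, map_smul, add_apply, sub_apply, smul_apply,
    smul_eq_mul]
  rw [H.g_symm y hy Y (u y), H.g_symm y hy X (u y), H.g_symm y hy Y X]
  module

end Conformal

/-! ### Ricci and *-Ricci tensors under a conformal change in dimension four -/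

section Contractions

variable {E : Type*} [NormedAddCommGroup E] [NormedSpace ℝ E] {ι : Type*} [Fintype ι]
  {Ω : Set E} {g : E → E →L[ℝ] E →L[ℝ] ℝ} {J : E → E →L[ℝ] E} {Γ Γc : E → E →L[ℝ] E →L[ℝ] E}
  {u : E → E} {y : E} {e f : ι → E}

/-- The Ricci tensor as a contraction over dual frames. -/
noncomputable def ricTensor (g : E →L[ℝ] E →L[ℝ] ℝ) (R : E → E → E → E) (e f : ι → E)
    (Y Z : E) : ℝ := ∑ i, g (f i) (R (e i) Y Z)

/-- The `*`-Ricci tensor as a contraction over dual frames. -/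
noncomputable def starTensor (g : E →L[ℝ] E →L[ℝ] ℝ) (R : E → E → E → E) (J : E →L[ℝ] E)
    (e f : ι → E) (X Y : E) : ℝ := ∑ i, g (f i) (R X (J (e i)) (J Y))

lemma IsKahlerData.ricTensor_eq (K : IsKahlerData Ω g J Γ) (hy : y ∈ Ω) (Y Z : E) :
    ricTensor (g y) (curvature Γ y) e f Y Z = g y Z (ricOp Γ e f y Y) := by
  rw [ricTensor, ricOp, map_sum]
  refine Finset.sum_congr rfl fun i _ => ?_
  rw [K.g_symm y hy, K.curvature_skew hy, curvature_swap, map_neg, neg_neg]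

lemma IsKahlerData.ricTensor_J (K : IsKahlerData Ω g J Γ) (hy : y ∈ Ω)
    (hF : IsDualFrame (g y) e f) (Y Z : E) :
    ricTensor (g y) (curvature Γ y) e f (J y Y) (J y Z)
      = ricTensor (g y) (curvature Γ y) e f Y Z := by
  rw [K.ricTensor_eq hy, K.ricTensor_eq hy, K.ricOp_J hy hF, K.J_isometry y hy]

/-- The curvature commutes with J, so both factors J can be moved onto the dual frames, where they
do not change the trace. -/
lemma IsKahlerData.starTensor_eq (K : IsKahlerData Ω g J Γ) (hy : y ∈ Ω)
    (hF : IsDualFrame (g y) e f) (X Y : E) :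
    starTensor (g y) (curvature Γ y) (J y) e f X Y
      = ricTensor (g y) (curvature Γ y) e f X Y := by
  have hb : IsBilin fun A B => g y B (curvature Γ y X A Y) := by
    have h := (curvature_isBilin' Γ y Y).right X
    exact ⟨fun B =>
      ⟨fun _ _ => by rw [h.map_add, map_add], fun _ _ => by rw [h.map_smul, map_smul]⟩,
      fun A => ⟨fun _ _ => by simp, fun _ _ => by simp⟩⟩
  have h := hF.sum_J hb (K.J_sq y hy) (K.skew hy) (K.g_symm y hy)
  have h1 : ∀ i, g y (f i) (curvature Γ y X (J y (e i)) (J y Y))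
      = -g y (J y (f i)) (curvature Γ y X (J y (e i)) Y) := fun i => by
    rw [K.curvature_J hy, K.skew hy, neg_neg]
  rw [starTensor, ricTensor]
  simp only [h1, Finset.sum_neg_distrib]
  rw [h, ← Finset.sum_neg_distrib]
  refine Finset.sum_congr rfl fun i _ => ?_
  rw [curvature_swap, map_neg, neg_neg]

/-- J is skew, hence trace-free. -/
lemma IsHermitianData.sum_inner_J (H : IsHermitianData Ω g J Γ) (hy : y ∈ Ω)
    (hF : IsDualFrame (g y) e f) : ∑ i, g y (f i) (J y (e i)) = 0 := by
  have h := hF.sum_swap ((IsBilin.of_clm (g y)).comp (ContinuousLinearMap.id ℝ E) (J y))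
    (H.g_symm y hy)
  have h1 : ∀ i, g y (e i) (J y (f i)) = -g y (f i) (J y (e i)) := fun i => by
    rw [H.g_symm y hy, H.skew hy]
  simp only [ContinuousLinearMap.id_apply, h1, Finset.sum_neg_distrib] at h
  linarith

/-- The conformal change of the Ricci tensor in real dimension four. -/
lemma IsHermitianData.ricTensor_conformal (H : IsHermitianData Ω g J Γ) (hy : y ∈ Ω)
    (hF : IsDualFrame (g y) e f) (hdim : ∑ i, g y (f i) (e i) = 4) {A : E → E}
    (hA : IsLinearMap ℝ A) {R R' : E → E → E → E}
    (hR : ∀ X Y Z, R' X Y Z = R X Y Z - g y (A Y) Z • X + g y (A X) Z • Y - g y Y Z • A X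
      + g y X Z • A Y) (Y Z : E) :
    ricTensor (g y) R' e f Y Z = ricTensor (g y) R e f Y Z - 2 * g y (A Y) Z
      - (∑ i, g y (A (e i)) (f i)) * g y Y Z := by
  have h1 : ∑ i, g y (A (e i)) Z * g y (f i) Y = g y (A Y) Z := by
    have := hF.sum_smul' (L := fun X => g y (A X) Z)
      ⟨fun _ _ => by simp [hA.map_add], fun _ _ => by simp [hA.map_smul]⟩ Y
    rw [← this]
    exact Finset.sum_congr rfl fun i _ => mul_comm _ _
  have h2 : ∑ i, g y (e i) Z * g y (f i) (A Y) = g y (A Y) Z := by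
    have := hF.sum_smul (L := fun X => g y X (A Y)) ⟨fun _ _ => by simp, fun _ _ => by simp⟩ Z
    rw [H.g_symm y hy (A Y), ← this]
    rfl
  have h3 : ∑ i, g y Y Z * g y (f i) (A (e i)) = g y Y Z * ∑ i, g y (A (e i)) (f i) := by
    rw [Finset.mul_sum]
    exact Finset.sum_congr rfl fun i _ => by rw [H.g_symm y hy (f i)]
  have h4 : ∑ i, g y (A Y) Z * g y (f i) (e i) = g y (A Y) Z * 4 := by
    rw [← hdim, Finset.mul_sum]
  simp only [ricTensor, hR, map_add, map_sub, map_smul, smul_eq_mul, Finset.sum_add_distrib,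
    Finset.sum_sub_distrib]
  rw [h1, h2, h3, h4]
  ring

/-- The conformal change of the `*`-Ricci tensor. -/
lemma IsHermitianData.starTensor_conformal (H : IsHermitianData Ω g J Γ) (hy : y ∈ Ω)
    (hF : IsDualFrame (g y) e f) {A : E → E}
    (hA : IsLinearMap ℝ A) {R R' : E → E → E → E}
    (hR : ∀ X Y Z, R' X Y Z = R X Y Z - g y (A Y) Z • X + g y (A X) Z • Y - g y Y Z • A X
      + g y X Z • A Y) (X Y : E) :
    starTensor (g y) R' (J y) e f X Y = starTensor (g y) R (J y) e f X Y
      - g y (A (J y X)) (J y Y) - g y (A X) Y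
      + g y X (J y Y) * ∑ i, g y (f i) (A (J y (e i))) := by
  have h1 : ∑ i, g y (A (J y (e i))) (J y Y) * g y (f i) X = g y (A (J y X)) (J y Y) := by
    have := hF.sum_smul' (L := fun X => g y (A (J y X)) (J y Y))
      ⟨fun _ _ => by simp [hA.map_add], fun _ _ => by simp [hA.map_smul]⟩ X
    rw [← this]
    exact Finset.sum_congr rfl fun i _ => mul_comm _ _
  have h2 : ∑ i, g y (J y (e i)) (J y Y) * g y (f i) (A X) = g y (A X) Y := by
    have := hF.sum_smul (L := fun Z => g y Z (A X)) ⟨fun _ _ => by simp, fun _ _ => by simp⟩ Y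
    rw [H.g_symm y hy (A X), ← this]
    exact Finset.sum_congr rfl fun i _ => by rw [H.J_isometry y hy]; rfl
  have h3 : ∑ i, g y (A X) (J y Y) * g y (f i) (J y (e i)) = 0 := by
    rw [← Finset.mul_sum, H.sum_inner_J hy hF, mul_zero]
  have h4 : ∑ i, g y X (J y Y) * g y (f i) (A (J y (e i)))
      = g y X (J y Y) * ∑ i, g y (f i) (A (J y (e i))) := by rw [Finset.mul_sum]
  simp only [starTensor, hR, map_add, map_sub, map_smul, smul_eq_mul, Finset.sum_add_distrib,
    Finset.sum_sub_distrib]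
  rw [h1, h2, h3, h4]
  ring

/-- The difference of the contracted Ricci and `*`-Ricci tensors under a conformal change of a
Kähler metric in real dimension four. -/
lemma IsKahlerData.sum_ricTensor_sub (K : IsKahlerData Ω g J Γ) (hy : y ∈ Ω)
    (hF : IsDualFrame (g y) e f) (hdim : ∑ i, g y (f i) (e i) = 4) {A : E → E}
    (hA : IsLinearMap ℝ A) {R' : E → E → E → E}
    (hR : ∀ X Y Z, R' X Y Z = curvature Γ y X Y Z - g y (A Y) Z • X + g y (A X) Z • Y
      - g y Y Z • A X + g y X Z • A Y) :
    ∑ j, ricTensor (g y) R' e f (e j) (f j) - ∑ j, starTensor (g y) R' (J y) e f (e j) (f j)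
      = -4 * ∑ i, g y (A (e i)) (f i) := by
  have h1 : ∑ j, g y (A (J y (e j))) (J y (f j)) = ∑ i, g y (A (e i)) (f i) :=
    hF.sum_J (b := fun X Y => g y (A X) Y)
      ⟨fun _ => ⟨fun _ _ => by simp [hA.map_add], fun _ _ => by simp [hA.map_smul]⟩,
        fun _ => ⟨fun _ _ => by simp, fun _ _ => by simp⟩⟩
      (K.J_sq y hy) (K.skew hy) (K.g_symm y hy)
  have h2 : ∑ j, g y (e j) (J y (f j)) = 0 := by
    have h := K.sum_inner_J hy hF
    have h1 : ∀ i, g y (e i) (J y (f i)) = -g y (f i) (J y (e i)) := fun i => by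
      rw [K.g_symm y hy, K.skew hy]
    simp only [h1, Finset.sum_neg_distrib, h, neg_zero]
  have h3 : ∑ i, g y (e i) (f i) = 4 := by
    rw [← hdim]; exact Finset.sum_congr rfl fun i _ => K.g_symm y hy _ _
  simp only [K.ricTensor_conformal hy hF hdim hA hR, K.starTensor_conformal hy hF hA hR,
    Finset.sum_add_distrib, Finset.sum_sub_distrib, ← Finset.mul_sum, ← Finset.sum_mul, h1, h2, h3,
    K.starTensor_eq hy hF]
  ring

/-- In real dimension four, for a metric conformal to a Kähler metric `g`: if the Ricci tensor is
`J`-invariant and the scalar and `*`-scalar curvatures agree, then `∇u - u ⊗ u` commutes with `J`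
and has trace `-2 |u|²`, where `u` is the gradient of the logarithmic conformal factor. -/
lemma IsKahlerData.conformal_conditions (K : IsKahlerData Ω g J Γ) (hy : y ∈ Ω)
    (hF : IsDualFrame (g y) e f) (hdim : ∑ i, g y (f i) (e i) = 4)
    (hΓc : ContDiffAt ℝ ∞ Γc y) (hu : ContDiffAt ℝ ∞ u y)
    (hc : ∀ᶠ z in 𝓝 y, IsConformalChange g u Γ Γc z)
    (hsym : ∀ X Y, g y (cov Γ u y X) Y = g y (cov Γ u y Y) X)
    (hRic : ∀ Y Z, ricTensor (g y) (curvature Γc y) e f (J y Y) (J y Z)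
      = ricTensor (g y) (curvature Γc y) e f Y Z)
    (hs : ∑ j, ricTensor (g y) (curvature Γc y) e f (e j) (f j)
      = ∑ j, starTensor (g y) (curvature Γc y) (J y) e f (e j) (f j)) :
    (∀ X, cov Γ u y (J y X) - g y (u y) (J y X) • u y
      = J y (cov Γ u y X - g y (u y) X • u y)) ∧
    ∑ i, g y (cov Γ u y (e i) - g y (u y) (e i) • u y) (f i) = -2 * g y (u y) (u y) := by
  have hR := K.curvature_conformal hy hΓc hu hc hsym
  have hA := schoutenShift_isLinearMap (g := g) (u := u) (Γ := Γ) (y := y)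
  constructor
  · intro X
    refine K.eq_of_inner hy fun Z => ?_
    -- The argument -JZ satisfies J(-JZ) = Z. The Kähler Ricci tensor and the metric term are
    -- J-invariant and drop out, leaving that A commutes with J.
    have h := hRic X (-J y Z)
    rw [K.ricTensor_conformal hy hF hdim hA hR, K.ricTensor_conformal hy hF hdim hA hR,
      K.ricTensor_J hy hF, K.J_isometry y hy] at h
    have h' : g y (schoutenShift g u Γ y (J y X)) Z
        = -g y (schoutenShift g u Γ y X) (J y Z) := by
      have : J y (-J y Z) = Z := by rw [map_neg, K.J_sq y hy, neg_neg]
      have hneg : g y (schoutenShift g u Γ y X) (-J y Z)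
          = -g y (schoutenShift g u Γ y X) (J y Z) := map_neg _ _
      rw [this, hneg] at h
      linarith
    rw [K.skew hy]
    simp only [schoutenShift, map_add, map_sub, map_smul, add_apply, sub_apply, smul_apply,
      smul_eq_mul, K.skew hy] at h' ⊢
    linarith
  · have h := K.sum_ricTensor_sub hy hF hdim hA hR
    rw [hs, sub_self] at h
    have h1 : ∑ i, g y (e i) (f i) = 4 := by
      rw [← hdim]; exact Finset.sum_congr rfl fun i _ => K.g_symm y hy _ _
    -- In dimension four the term |u|²/2 of A has trace 2|u|², so tr A = 0 becomes the second claim.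
    have h2 : ∑ i, g y (schoutenShift g u Γ y (e i)) (f i)
        = ∑ i, g y (cov Γ u y (e i) - g y (u y) (e i) • u y) (f i)
          + (1 / 2 * g y (u y) (u y)) * ∑ i, g y (e i) (f i) := by
      rw [Finset.mul_sum, ← Finset.sum_add_distrib]
      refine Finset.sum_congr rfl fun i _ => ?_
      simp [schoutenShift]
    rw [h1] at h2
    linarith

end Contractions

end TensorCalc

namespace TensorCalc

open Filter Topology

/-! ### The bitension field in terms of the Kähler metric -/

section Bitension

variable {E E' : Type*} [NormedAddCommGroup E] [NormedSpace ℝ E]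
  [NormedAddCommGroup E'] [NormedSpace ℝ E'] {ι : Type*} [Fintype ι]
  {Ω : Set E} {g : E → E →L[ℝ] E →L[ℝ] ℝ} {J : E → E →L[ℝ] E} {Γ : E → E →L[ℝ] E →L[ℝ] E}
  {Ω' : Set E'} {g' : E' → E' →L[ℝ] E' →L[ℝ] ℝ} {J' : E' → E' →L[ℝ] E'}
  {Γ' : E' → E' →L[ℝ] E' →L[ℝ] E'} {F : E → E'} {y : E} {e f : ι → E} {ψ : E → ℝ} {P : E → E}

lemma covBil_isBilin {θ : E → E →L[ℝ] E' →L[ℝ] E'} {b : E → E →L[ℝ] E →L[ℝ] E'}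
    (hb : DifferentiableAt ℝ b y) (Z : E) : IsBilin (covBil Γ θ b y Z) := by
  have : covBil Γ θ b y Z = fun X Y => fderiv ℝ b y Z X Y + θ y Z (b y X Y)
      - b y (Γ y Z X) Y - b y X (Γ y Z Y) := by
    ext X Y
    rw [covBil, cov_apply, fderiv_clm₂ hb (differentiableAt_const _) (differentiableAt_const _)]
    simp
  rw [this]
  constructor <;> intro Y <;> constructor <;> intros <;>
    simp only [map_add, map_smul, add_apply, smul_apply, smul_sub, smul_add] <;> abel

lemma cov_gradient_smul (hψ : DifferentiableAt ℝ ψ y) (hP : DifferentiableAt ℝ P y)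
    (hψP : ∀ X, g y (P y) X = fderiv ℝ ψ y X) (X : E) :
    cov Γ (fun z => (-2 * ψ z) • P z) y X
      = (-2 * g y (P y) X) • P y + (-2 * ψ y) • cov Γ P y X := by
  rw [cov_smul (hψ.const_mul _) hP, fderiv_const_mul hψ, smul_apply, hψP, smul_eq_mul]

/-- The Leibniz rule twice. As P is the gradient of ψ, derivatives of ψ turn into inner products
with P and with ∇P. -/
lemma IsHermitianData.cov₂_gradient_smul (H : IsHermitianData Ω g J Γ) (hy : y ∈ Ω)
    (hψ : ∀ᶠ z in 𝓝 y, ContDiffAt ℝ ∞ ψ z) (hP : ∀ᶠ z in 𝓝 y, ContDiffAt ℝ ∞ P z)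
    (hψP : ∀ᶠ z in 𝓝 y, ∀ X, g z (P z) X = fderiv ℝ ψ z X) (X Y : E) :
    cov₂ Γ Γ (fun z => (-2 * ψ z) • P z) y X Y
      = (-2 * g y (cov Γ P y X) Y) • P y + (-2 * g y (P y) Y) • cov Γ P y X
        + (-2 * g y (P y) X) • cov Γ P y Y + (-2 * ψ y) • cov₂ Γ Γ P y X Y := by
  have hψy := smooth_differentiableAt hψ.self_of_nhds
  have hPy := smooth_differentiableAt hP.self_of_nhds
  have hg := smooth_differentiableAt (H.smooth_g y hy)
  have hcP : DifferentiableAt ℝ (fun z => cov Γ P z Y) y := smooth_differentiableAt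
    ((smooth_cov (H.smooth_Γ y hy) hP.self_of_nhds).clm_apply contDiffAt_const)
  have hgP : DifferentiableAt ℝ (fun z => g z (P z) Y) y :=
    (hg.clm_apply hPy).clm_apply (differentiableAt_const Y)
  have h1 : (fun z => cov Γ (fun z => (-2 * ψ z) • P z) z Y) =ᶠ[𝓝 y]
      fun z => (-2 * g z (P z) Y) • P z + (-2 * ψ z) • cov Γ P z Y := by
    filter_upwards [hψ, hP, hψP] with z h1 h2 h3
    exact cov_gradient_smul (smooth_differentiableAt h1) (smooth_differentiableAt h2) h3 Y
  rw [cov₂, cov_congr h1, cov_add ((hgP.const_mul _).fun_smul hPy) ((hψy.const_mul _).fun_smul hcP),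
    cov_smul (hgP.const_mul _) hPy, cov_smul (hψy.const_mul _) hcP, fderiv_const_mul hgP,
    fderiv_const_mul hψy, cov_gradient_smul hψy hPy hψP.self_of_nhds, smul_apply,
    H.fderiv_inner hy hPy (differentiableAt_const Y), cov_const, smul_apply,
    ← hψP.self_of_nhds, cov₂]
  simp only [smul_eq_mul]
  module

/-- The analytic core: the bitension field of a holomorphic map vanishes, expressed through the
Kähler metric `g` in the conformal class. -/
theorem bitension_core (K : IsKahlerData Ω g J Γ) (H' : IsHermitianData Ω' g' J' Γ') (hy : y ∈ Ω)
    (hFy : F y ∈ Ω') (hdual : IsDualFrame (g y) e f) (hF : ∀ᶠ z in 𝓝 y, ContDiffAt ℝ ∞ F z)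
    (hhol : ∀ᶠ z in 𝓝 y, ∀ X, fderiv ℝ F z (J z X) = J' (F z) (fderiv ℝ F z X))
    (hQ : ∀ z ∈ Ω', ∀ X Y, covJ J' Γ' z (J' z X) (J' z Y) = -covJ J' Γ' z X Y)
    (hψ : ∀ᶠ z in 𝓝 y, ContDiffAt ℝ ∞ ψ z) (hP : ∀ᶠ z in 𝓝 y, ContDiffAt ℝ ∞ P z)
    (hψP : ∀ᶠ z in 𝓝 y, ∀ X, g z (P z) X = fderiv ℝ ψ z X) (hψ0 : ψ y ≠ 0)
    (hPJ : ∀ᶠ z in 𝓝 y, ∀ X, cov Γ P z (J z X) = J z (cov Γ P z X))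
    (htr : ψ y * ∑ i, g y (cov Γ P y (e i)) (f i) = 2 * g y (P y) (P y)) :
    ∑ i, (cov₂ Γ (pullback Γ' F) (fun z => fderiv ℝ F z ((-2 * ψ z) • P z)) y (e i) (f i)
        + curvature Γ' (F y) (fderiv ℝ F y ((-2 * ψ y) • P y)) (fderiv ℝ F y (e i))
          (fderiv ℝ F y (f i)))
      - (2 / ψ y) • cov (pullback Γ' F) (fun z => fderiv ℝ F z ((-2 * ψ z) • P z)) y (P y) = 0 := by
  have hFs := hF.self_of_nhds
  have hΓ := K.smooth_Γ y hy
  have hΓ' := H'.smooth_Γ _ hFy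
  have hmem' : ∀ᶠ z in 𝓝 y, F z ∈ Ω' :=
    hFs.continuousAt.eventually (H'.eventually_mem hFy)
  have hV : ∀ᶠ z in 𝓝 y, ContDiffAt ℝ ∞ (fun z => (-2 * ψ z) • P z) z := by
    filter_upwards [hψ, hP] with z h1 h2 using (contDiffAt_const.mul h1).smul h2
  have hs : ∀ᶠ z in 𝓝 y, ∀ X Y, Γ z X Y = Γ z Y X :=
    (K.eventually_mem hy).mono fun z hz => K.torsion_free z hz
  have hs' : ∀ᶠ z in 𝓝 (F y), ∀ X Y, Γ' z X Y = Γ' z Y X :=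
    (H'.eventually_mem hFy).mono fun z hz => H'.torsion_free z hz
  have hBJ : ∀ᶠ z in 𝓝 y, ∀ X Y, sff Γ Γ' F z (J z X) (J z Y) = -sff Γ Γ' F z X Y := by
    filter_upwards [hF, hmem', K.eventually_mem hy, hhol.eventually_nhds] with z h1 h2 h3 h4 X Y
    exact sff_J_J K H' h3 h2 h1 h4 (hQ _ h2) X Y
  have hB := smooth_sff hΓ hΓ' hFs
  have sumJ : ∀ {b : E → E → E'}, IsBilin b → (∀ X Y, b (J y X) (J y Y) = -b X Y) →
      ∑ i, b (e i) (f i) = 0 := fun {b} hb hbJ =>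
    hdual.sum_eq_zero hb (K.J_sq y hy) (K.skew hy) (K.g_symm y hy) hbJ
  have hPJy := hPJ.self_of_nhds
  have hBJy := hBJ.self_of_nhds
  set B := sff Γ Γ' F y with hBdef
  set D := fderiv ℝ F y with hD
  set L := cov Γ P y with hL
  have c1 : ∑ i, covBil Γ (pullback Γ' F) (sff Γ Γ' F) y ((-2 * ψ y) • P y) (e i) (f i) = 0 := by
    exact sumJ (covBil_isBilin (smooth_differentiableAt hB) _)
      fun X Y => covBil_J_J K hy (smooth_differentiableAt hB) hBJ _ X Y
  -- L = ∇P commutes with J, so B(X, LY) changes sign under J just as B does.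
  have c2 : ∑ i, B (e i) (L (f i)) = 0 :=
    sumJ ((IsBilin.of_clm B).comp (ContinuousLinearMap.id ℝ E) L) fun X Y => by
      simp [hPJy, hBJy]
  have c3 : ∑ i, B (f i) (L (e i)) = 0 := by
    have h := hdual.sum_swap ((IsBilin.of_clm B).comp (ContinuousLinearMap.id ℝ E) L)
      (K.g_symm y hy)
    exact h.trans c2
  have covV : ∀ X, cov Γ (fun z => (-2 * ψ z) • P z) y X
      = (-2 * g y (P y) X) • P y + (-2 * ψ y) • L X :=
    cov_gradient_smul (smooth_differentiableAt hψ.self_of_nhds)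
      (smooth_differentiableAt hP.self_of_nhds) hψP.self_of_nhds
  -- In ∇V = -2 g(P, ·) P - 2ψ L only the rank-one part survives the trace against B.
  have c4 : ∑ i, B (e i) (cov Γ (fun z => (-2 * ψ z) • P z) y (f i))
      = (-2 : ℝ) • B (P y) (P y) := by
    have h := hdual.sum_smul' (L := fun X => B X (P y)) ⟨fun _ _ => by simp, fun _ _ => by simp⟩
      (P y)
    simp only [covV]
    simp only [map_add, map_smul, Finset.sum_add_distrib, ← Finset.smul_sum, c2, smul_zero,
      add_zero, mul_smul, K.g_symm y hy (P y) (f _), h]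
  have c5 : ∑ i, B (f i) (cov Γ (fun z => (-2 * ψ z) • P z) y (e i))
      = (-2 : ℝ) • B (P y) (P y) := by
    have h := hdual.sum_smul (L := fun X => B X (P y)) ⟨fun _ _ => by simp, fun _ _ => by simp⟩
      (P y)
    simp only [covV]
    simp only [map_add, map_smul, Finset.sum_add_distrib, ← Finset.smul_sum, c3, smul_zero,
      add_zero, mul_smul, K.g_symm y hy (P y) (e _), h]
  -- The terms carrying -2ψ combine to ΔP + Ric P = 0; only the derivatives that fall on ψ are left.
  have c6 : ∑ i, (cov₂ Γ Γ (fun z => (-2 * ψ z) • P z) y (e i) (f i)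
      + curvature Γ y ((-2 * ψ y) • P y) (e i) (f i))
      = (-2 * ∑ i, g y (L (e i)) (f i)) • P y + (-4 : ℝ) • L (P y) := by
    have h1 := hdual.sum_smul' (L := L) ⟨fun _ _ => by simp, fun _ _ => by simp⟩ (P y)
    have h2 := hdual.sum_smul (L := L) ⟨fun _ _ => by simp, fun _ _ => by simp⟩ (P y)
    have h3 := K.sum_cov₂_add_ricOp hy hdual hP.self_of_nhds hPJ
    have h4 : ∑ i, curvature Γ y ((-2 * ψ y) • P y) (e i) (f i)
        = (-2 * ψ y) • ricOp Γ e f y (P y) := by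
      rw [ricOp, Finset.smul_sum]
      exact Finset.sum_congr rfl fun i _ => ((curvature_isBilin' Γ y (f i)).left (e i)).map_smul _ _
    rw [Finset.sum_add_distrib, h4]
    simp only [K.cov₂_gradient_smul hy hψ hP hψP]
    simp only [Finset.sum_add_distrib, ← Finset.smul_sum,
      ← Finset.sum_smul, mul_smul, K.g_symm y hy (P y) (f _),
      K.g_symm y hy (P y) (e _), ← hL]
    rw [h1, h2, eq_neg_of_add_eq_zero_left h3]
    module
  rw [Finset.sum_congr rfl fun i _ => cov₂_pushforward_eq hΓ hΓ' hF hV hs hs' (e i) (f i),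
    Finset.sum_add_distrib, Finset.sum_add_distrib, Finset.sum_add_distrib, c1, c4, c5,
      cov_pushforward (Γ := Γ) hFs (smooth_differentiableAt hV.self_of_nhds), covV,
    ← hBdef, ← hD, ← map_sum, c6]
  -- The trace condition ψ Δψ = 2|P|², which matches the last coefficients of dF(P); the terms in
  -- B(P, P) and dF(∇_P P) cancel without it.
  have ht : ∑ i, g y (L (e i)) (f i) = 2 * g y (P y) (P y) / ψ y := by
    field_simp; linarith
  rw [ht]
  simp only [map_add, map_smul, smul_add, smul_smul]
  match_scalars <;> field_simp <;> ring

end Bitension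

end TensorCalc

namespace TensorCalc

open Filter Topology

/-! ### Matrices and coefficient arrays as multilinear maps on ℝ^m -/

section Coordinates

variable {m : ℕ}

/-- The standard basis vectors of `ℝ^m`. -/
noncomputable abbrev stdVec (i : Fin m) : EuclideanSpace ℝ (Fin m) := EuclideanSpace.single i 1

lemma sum_stdVec (X : EuclideanSpace ℝ (Fin m)) : ∑ i, X i • stdVec i = X := by
  ext k
  simp [stdVec, Pi.single_apply]

lemma linear_expand {W : Type*} [AddCommGroup W] [Module ℝ W] {L : EuclideanSpace ℝ (Fin m) → W}
    (hL : IsLinearMap ℝ L)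
    (X : EuclideanSpace ℝ (Fin m)) : L X = ∑ i, X i • L (stdVec i) := by
  have := map_sum (hL.mk' _) (fun i => X i • stdVec i) Finset.univ
  rw [sum_stdVec] at this
  simp only [map_smul] at this
  exact this

lemma linear_ext {W : Type*} [AddCommGroup W] [Module ℝ W] {L L' : EuclideanSpace ℝ (Fin m) → W}
    (hL : IsLinearMap ℝ L)
    (hL' : IsLinearMap ℝ L') (h : ∀ i, L (stdVec i) = L' (stdVec i))
    (X : EuclideanSpace ℝ (Fin m)) : L X = L' X := by
  rw [linear_expand hL, linear_expand hL']
  simp only [h]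

/-- The bilinear form with matrix `A`. -/
noncomputable def bilin (A : Matrix (Fin m) (Fin m) ℝ) :
    EuclideanSpace ℝ (Fin m) →L[ℝ] EuclideanSpace ℝ (Fin m) →L[ℝ] ℝ :=
  ∑ i, ∑ j, A i j • (EuclideanSpace.proj i : EuclideanSpace ℝ (Fin m) →L[ℝ] ℝ).smulRight
    (EuclideanSpace.proj j : EuclideanSpace ℝ (Fin m) →L[ℝ] ℝ)

lemma bilin_apply (A : Matrix (Fin m) (Fin m) ℝ) (X Y : EuclideanSpace ℝ (Fin m)) :
    bilin A X Y = ∑ i, ∑ j, A i j * X i * Y j := by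
  simp [bilin, mul_assoc]

@[simp] lemma bilin_stdVec (A : Matrix (Fin m) (Fin m) ℝ) (i j : Fin m) :
    bilin A (stdVec i) (stdVec j) = A i j := by
  simp [bilin_apply]

/-- The endomorphism with matrix `A`. -/
noncomputable def endo (A : Matrix (Fin m) (Fin m) ℝ) :
    EuclideanSpace ℝ (Fin m) →L[ℝ] EuclideanSpace ℝ (Fin m) :=
  ∑ i, ∑ j, A i j • (EuclideanSpace.proj j : EuclideanSpace ℝ (Fin m) →L[ℝ] ℝ).smulRight (stdVec i)

lemma endo_apply (A : Matrix (Fin m) (Fin m) ℝ) (X : EuclideanSpace ℝ (Fin m)) (k : Fin m) :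
    endo A X k = ∑ a, A k a * X a := by
  simp [endo, sum_apply, Pi.single_apply]

@[simp] lemma endo_stdVec (A : Matrix (Fin m) (Fin m) ℝ) (j k : Fin m) :
    endo A (stdVec j) k = A k j := by
  simp [endo_apply]

lemma endo_stdVec_eq (A : Matrix (Fin m) (Fin m) ℝ) (j : Fin m) :
    endo A (stdVec j) = ∑ a, A a j • stdVec a := by
  rw [← sum_stdVec (endo A (stdVec j))]
  simp

/-- The bilinear map with the coefficients `c k i j`. -/
noncomputable def conn (c : Fin m → Fin m → Fin m → ℝ) :
    EuclideanSpace ℝ (Fin m) →L[ℝ] EuclideanSpace ℝ (Fin m) →L[ℝ] EuclideanSpace ℝ (Fin m) :=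
  ∑ i, ∑ j, (EuclideanSpace.proj i : EuclideanSpace ℝ (Fin m) →L[ℝ] ℝ).smulRight
    ((EuclideanSpace.proj j : EuclideanSpace ℝ (Fin m) →L[ℝ] ℝ).smulRight (∑ k, c k i j • stdVec k))

lemma conn_apply (c : Fin m → Fin m → Fin m → ℝ) (X Y : EuclideanSpace ℝ (Fin m)) (k : Fin m) :
    conn c X Y k = ∑ i, ∑ j, c k i j * X i * Y j := by
  simp [conn, sum_apply, Pi.single_apply]
  exact Finset.sum_congr rfl fun i _ => Finset.sum_congr rfl fun j _ => by ring

@[simp] lemma conn_stdVec (c : Fin m → Fin m → Fin m → ℝ) (i j k : Fin m) :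
    conn c (stdVec i) (stdVec j) k = c k i j := by
  simp [conn_apply]

variable {V : Type*} [NormedAddCommGroup V] [NormedSpace ℝ V] {y : V}

lemma smooth_bilin {A : V → Matrix (Fin m) (Fin m) ℝ}
    (hA : ∀ i j, ContDiffAt ℝ ∞ (fun z => A z i j) y) :
    ContDiffAt ℝ ∞ (fun z => bilin (A z)) y :=
  ContDiffAt.sum fun i _ => ContDiffAt.sum fun j _ => (hA i j).smul contDiffAt_const

lemma smooth_endo {A : V → Matrix (Fin m) (Fin m) ℝ}
    (hA : ∀ i j, ContDiffAt ℝ ∞ (fun z => A z i j) y) :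
    ContDiffAt ℝ ∞ (fun z => endo (A z)) y :=
  ContDiffAt.sum fun i _ => ContDiffAt.sum fun j _ => (hA i j).smul contDiffAt_const

lemma smooth_conn {c : V → Fin m → Fin m → Fin m → ℝ}
    (hc : ∀ k i j, ContDiffAt ℝ ∞ (fun z => c z k i j) y) :
    ContDiffAt ℝ ∞ (fun z => conn (c z)) y := by
  have : (fun z => conn (c z)) = fun z => ∑ i, ∑ j, ∑ k, c z k i j •
      (EuclideanSpace.proj i : EuclideanSpace ℝ (Fin m) →L[ℝ] ℝ).smulRight
        ((EuclideanSpace.proj j : EuclideanSpace ℝ (Fin m) →L[ℝ] ℝ).smulRight (stdVec k)) := by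
    ext z X Y l
    simp [conn, sum_apply, Pi.single_apply]
    exact Finset.sum_congr rfl fun i _ => Finset.sum_congr rfl fun j _ => by ring
  rw [this]
  exact ContDiffAt.sum fun i _ => ContDiffAt.sum fun j _ => ContDiffAt.sum fun k _ =>
    (hc k i j).smul contDiffAt_const

lemma smooth_det {A : V → Matrix (Fin m) (Fin m) ℝ}
    (hA : ∀ i j, ContDiffAt ℝ ∞ (fun z => A z i j) y) :
    ContDiffAt ℝ ∞ (fun z => (A z).det) y := by
  simp only [Matrix.det_apply']
  exact ContDiffAt.sum fun σ _ => contDiffAt_const.mul (contDiffAt_prod fun i _ => hA _ _)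

lemma smooth_inv {A : V → Matrix (Fin m) (Fin m) ℝ}
    (hA : ∀ i j, ContDiffAt ℝ ∞ (fun z => A z i j) y) (hdet : (A y).det ≠ 0) (i j : Fin m) :
    ContDiffAt ℝ ∞ (fun z => (A z)⁻¹ i j) y := by
  simp only [Matrix.inv_def, Ring.inverse_eq_inv', Matrix.smul_apply, smul_eq_mul,
    Matrix.adjugate_apply]
  refine ((smooth_det hA).inv hdet).mul (smooth_det fun k l => ?_)
  by_cases hk : k = j
  · subst hk; simpa using contDiffAt_const
  · simpa [Matrix.updateRow_ne hk] using hA k l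

end Coordinates

/-! ### The Levi-Civita connection of a matrix-valued metric -/

section Charts

variable {m : ℕ}

lemma smooth_pd {f : EuclideanSpace ℝ (Fin m) → ℝ} {y : EuclideanSpace ℝ (Fin m)}
    (hf : ContDiffAt ℝ ∞ f y) (i : Fin m) :
    ContDiffAt ℝ ∞ (fun z => Coord.pd i f z) y :=
  (smooth_fderiv hf).clm_apply contDiffAt_const

/-- A smooth almost Hermitian structure on an open subset of `ℝ^m`, in terms of matrices. -/
structure IsHermitianMatrix (Ω : Set (EuclideanSpace ℝ (Fin m)))
    (G J : EuclideanSpace ℝ (Fin m) → Matrix (Fin m) (Fin m) ℝ) : Prop where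
  isOpen : IsOpen Ω
  smooth_G : ∀ y ∈ Ω, ∀ i j, ContDiffAt ℝ ∞ (fun z => G z i j) y
  smooth_J : ∀ y ∈ Ω, ∀ i j, ContDiffAt ℝ ∞ (fun z => J z i j) y
  symm : ∀ y ∈ Ω, ∀ X Y, bilin (G y) X Y = bilin (G y) Y X
  pos : ∀ y ∈ Ω, ∀ X, X ≠ 0 → 0 < bilin (G y) X X
  J_sq : ∀ y ∈ Ω, ∀ X, endo (J y) (endo (J y) X) = -X
  J_isometry : ∀ y ∈ Ω, ∀ X Y, bilin (G y) (endo (J y) X) (endo (J y) Y) = bilin (G y) X Y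

/-- The Levi-Civita connection of the metric with matrix `G`. -/
noncomputable def leviCivita (G : EuclideanSpace ℝ (Fin m) → Matrix (Fin m) (Fin m) ℝ)
    (z : EuclideanSpace ℝ (Fin m)) : EuclideanSpace ℝ (Fin m) →L[ℝ] EuclideanSpace ℝ (Fin m) →L[ℝ]
    EuclideanSpace ℝ (Fin m) :=
  conn (Coord.christoffel G z)

/-- The frame dual to the standard basis, for the inner product with matrix `A`. -/
noncomputable def dualVec (A : Matrix (Fin m) (Fin m) ℝ) (i : Fin m) : EuclideanSpace ℝ (Fin m) :=
  ∑ j, A⁻¹ i j • stdVec j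

lemma bilin_stdVec_left (A : Matrix (Fin m) (Fin m) ℝ) (i : Fin m) (X : EuclideanSpace ℝ (Fin m)) :
    bilin A (stdVec i) X = ∑ j, A i j * X j := by
  simp [bilin_apply]

lemma bilin_dualVec {A : Matrix (Fin m) (Fin m) ℝ} (hA : A.det ≠ 0) (i : Fin m)
    (X : EuclideanSpace ℝ (Fin m)) :
    bilin A (dualVec A i) X = X i := by
  have h : A⁻¹ * A = 1 := Matrix.nonsing_inv_mul A (isUnit_iff_ne_zero.mpr hA)
  have h2 : ∀ b, ∑ j, A⁻¹ i j * A j b = if i = b then 1 else 0 := fun b => by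
    rw [← Matrix.mul_apply, h, Matrix.one_apply]
  simp only [dualVec, map_sum, map_smul, sum_apply, smul_apply, smul_eq_mul,
    bilin_stdVec_left, Finset.mul_sum]
  rw [Finset.sum_comm]
  simp only [← mul_assoc, ← Finset.sum_mul, h2]
  simp

/-- Raising the index of the standard basis turns g^{ij} b_{ij} into a sum over a dual pair, so no
orthonormal frame is needed. -/
lemma isDualFrame_dualVec {A : Matrix (Fin m) (Fin m) ℝ} (hA : A.det ≠ 0)
    (hs : ∀ X Y, bilin A X Y = bilin A Y X) : IsDualFrame (bilin A) stdVec (dualVec A) := by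
  have hl : ∀ X : EuclideanSpace ℝ (Fin m), ∑ i, bilin A (dualVec A i) X • stdVec i = X :=
      fun X => by
    simp only [bilin_dualVec hA, sum_stdVec]
  refine ⟨hl, fun X => ?_⟩
  ext k
  rw [← bilin_dualVec hA k (∑ i, bilin A (stdVec i) X • dualVec A i)]
  simp only [map_sum, map_smul, smul_eq_mul]
  simp only [hs (dualVec A k), bilin_dualVec hA]
  have h2 := congrArg (fun v => bilin A v X) (sum_stdVec (dualVec A k))
  simp only [map_sum, map_smul, sum_apply, smul_apply, smul_eq_mul,
    bilin_dualVec hA] at h2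
  rw [← h2]
  exact Finset.sum_congr rfl fun i _ => by ring

lemma det_ne_zero_of_pos {A : Matrix (Fin m) (Fin m) ℝ}
    (h : ∀ X : EuclideanSpace ℝ (Fin m), X ≠ 0 → 0 < bilin A X X) :
    A.det ≠ 0 := by
  intro h0
  obtain ⟨v, hv, hAv⟩ := Matrix.exists_mulVec_eq_zero_iff.mpr h0
  have hne : (WithLp.toLp 2 v : EuclideanSpace ℝ (Fin m)) ≠ 0 := fun h => hv (by
    simpa using congrArg (WithLp.ofLp) h)
  have := h _ hne
  rw [bilin_apply] at this
  have h2 : ∀ i, ∑ j, A i j * v i * v j = 0 := fun i => by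
    have h3 : ∑ j, A i j * v j = 0 := by
      simpa [Matrix.mulVec, dotProduct] using congrFun hAv i
    calc ∑ j, A i j * v i * v j = v i * ∑ j, A i j * v j := by
          rw [Finset.mul_sum]; exact Finset.sum_congr rfl fun j _ => by ring
      _ = 0 := by rw [h3, mul_zero]
  simp only [h2, Finset.sum_const_zero, lt_irrefl] at this

namespace IsHermitianMatrix

variable {Ω : Set (EuclideanSpace ℝ (Fin m))}
    {G J : EuclideanSpace ℝ (Fin m) → Matrix (Fin m) (Fin m) ℝ} {y : EuclideanSpace ℝ (Fin m)}

lemma eventually_mem (H : IsHermitianMatrix Ω G J) (hy : y ∈ Ω) : ∀ᶠ z in 𝓝 y, z ∈ Ω :=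
  H.isOpen.mem_nhds hy

lemma det_ne_zero (H : IsHermitianMatrix Ω G J) (hy : y ∈ Ω) : (G y).det ≠ 0 :=
  det_ne_zero_of_pos (H.pos y hy)

lemma entry_symm (H : IsHermitianMatrix Ω G J) (hy : y ∈ Ω) (i j : Fin m) :
    G y i j = G y j i := by
  simpa using H.symm y hy (stdVec i) (stdVec j)

lemma pd_symm (H : IsHermitianMatrix Ω G J) (hy : y ∈ Ω) (k i j : Fin m) :
    Coord.pd k (fun z => G z i j) y = Coord.pd k (fun z => G z j i) y := by
  have : (fun z => G z i j) =ᶠ[𝓝 y] fun z => G z j i := by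
    filter_upwards [H.eventually_mem hy] with z hz using H.entry_symm hz i j
  rw [Coord.pd, Coord.pd, this.fderiv_eq]

lemma smooth_christoffel (H : IsHermitianMatrix Ω G J) (hy : y ∈ Ω) (k i j : Fin m) :
    ContDiffAt ℝ ∞ (fun z => Coord.christoffel G z k i j) y := by
  have hG := H.smooth_G y hy
  exact contDiffAt_const.mul (ContDiffAt.sum fun l _ =>
    (smooth_inv hG (H.det_ne_zero hy) k l).mul
      (((smooth_pd (hG j l) i).add (smooth_pd (hG i l) j)).sub (smooth_pd (hG i j) l)))

lemma smooth_leviCivita (H : IsHermitianMatrix Ω G J) (hy : y ∈ Ω) :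
    ContDiffAt ℝ ∞ (leviCivita G) y :=
  smooth_conn (H.smooth_christoffel hy)

/-- The Koszul formula. -/
lemma koszul (H : IsHermitianMatrix Ω G J) (hy : y ∈ Ω) (i j l : Fin m) :
    bilin (G y) (leviCivita G y (stdVec i) (stdVec j)) (stdVec l)
      = 1 / 2 * (Coord.pd i (fun z => G z j l) y + Coord.pd j (fun z => G z i l) y
        - Coord.pd l (fun z => G z i j) y) := by
  have h : G y * (G y)⁻¹ = 1 :=
    Matrix.mul_nonsing_inv _ (isUnit_iff_ne_zero.mpr (H.det_ne_zero hy))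
  have h2 : ∀ b, ∑ k, G y l k * (G y)⁻¹ k b = if l = b then 1 else 0 := fun b => by
    rw [← Matrix.mul_apply, h, Matrix.one_apply]
  rw [H.symm y hy, bilin_stdVec_left]
  simp only [leviCivita, conn_stdVec, Coord.christoffel, Finset.mul_sum]
  rw [Finset.sum_comm]
  have h3 : ∀ b, ∑ k, G y l k * (1 / 2 * ((G y)⁻¹ k b * (Coord.pd i (fun z => G z j b) y
      + Coord.pd j (fun z => G z i b) y - Coord.pd b (fun z => G z i j) y)))
      = (if l = b then 1 else 0) * (1 / 2 * (Coord.pd i (fun z => G z j b) y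
      + Coord.pd j (fun z => G z i b) y - Coord.pd b (fun z => G z i j) y)) := fun b => by
    rw [← h2, Finset.sum_mul]
    exact Finset.sum_congr rfl fun k _ => by ring
  simp only [h3]
  simp

lemma isHermitianData (H : IsHermitianMatrix Ω G J) :
    IsHermitianData Ω (fun z => bilin (G z)) (fun z => endo (J z)) (leviCivita G) where
  isOpen := H.isOpen
  smooth_g y hy := smooth_bilin (H.smooth_G y hy)
  smooth_J y hy := smooth_endo (H.smooth_J y hy)
  smooth_Γ y hy := H.smooth_leviCivita hy
  g_symm := H.symm
  g_pos := H.pos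
  J_sq := H.J_sq
  J_isometry := H.J_isometry
  torsion_free y hy X Y := by
    refine linear_ext (L := fun X => leviCivita G y X Y) (L' := fun X => leviCivita G y Y X)
      ⟨by simp, by simp⟩ ⟨by simp, by simp⟩ (fun i => ?_) X
    refine linear_ext (L := fun Y => leviCivita G y (stdVec i) Y)
      (L' := fun Y => leviCivita G y Y (stdVec i))
      ⟨by simp, by simp⟩ ⟨by simp, by simp⟩ (fun j => ?_) Y
    ext k
    simp only [leviCivita, conn_stdVec, Coord.christoffel, H.pd_symm hy _ i j]
    congr 1
    exact Finset.sum_congr rfl fun l _ => by ring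
  metric y hy X Y Z := by
    refine linear_ext (L := fun X => fderiv ℝ (fun z => bilin (G z)) y X Y Z)
      (L' := fun X => bilin (G y) (leviCivita G y X Y) Z + bilin (G y) Y (leviCivita G y X Z))
      ⟨by simp, by simp⟩ ⟨by intros; simp; ring, by intros; simp; ring⟩ (fun i => ?_) X
    refine linear_ext (L := fun Y => fderiv ℝ (fun z => bilin (G z)) y (stdVec i) Y Z)
      (L' := fun Y => bilin (G y) (leviCivita G y (stdVec i) Y) Z
        + bilin (G y) Y (leviCivita G y (stdVec i) Z))
      ⟨by simp, by simp⟩ ⟨by intros; simp; ring, by intros; simp; ring⟩ (fun j => ?_) Y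
    refine linear_ext (L := fun Z => fderiv ℝ (fun z => bilin (G z)) y (stdVec i) (stdVec j) Z)
      (L' := fun Z => bilin (G y) (leviCivita G y (stdVec i) (stdVec j)) Z
        + bilin (G y) (stdVec j) (leviCivita G y (stdVec i) Z))
      ⟨by simp, by simp⟩ ⟨by intros; simp; ring, by intros; simp; ring⟩ (fun k => ?_) Z
    have hd := smooth_differentiableAt (smooth_bilin (H.smooth_G y hy))
    rw [H.symm y hy (stdVec j), H.koszul hy, H.koszul hy,
      ← fderiv_clm_const hd, ← fderiv_clm_const (hd.clm_apply (differentiableAt_const _))]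
    simp only [bilin_stdVec]
    rw [H.pd_symm hy i k j, Coord.pd]
    ring

end IsHermitianMatrix

end Charts

end TensorCalc

namespace TensorCalc

open Filter Topology

/-! ### Coordinate expressions as invariant ones -/

section Translation

variable {m n : ℕ}

lemma fderiv_coord {V : Type*} [NormedAddCommGroup V] [NormedSpace ℝ V]
    {v : V → EuclideanSpace ℝ (Fin n)} {y : V} (hv : DifferentiableAt ℝ v y) (X : V) (α : Fin n) :
    fderiv ℝ (fun z => v z α) y X = fderiv ℝ v y X α := by
  have h := ((EuclideanSpace.proj α : EuclideanSpace ℝ (Fin n) →L[ℝ] ℝ).hasFDerivAt.comp y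
    hv.hasFDerivAt).fderiv
  have h' : fderiv ℝ (fun z => v z α) y
      = (EuclideanSpace.proj α : EuclideanSpace ℝ (Fin n) →L[ℝ] ℝ).comp (fderiv ℝ v y) := h
  rw [h']; rfl

lemma pd_coord {v : EuclideanSpace ℝ (Fin m) → EuclideanSpace ℝ (Fin n)}
    {y : EuclideanSpace ℝ (Fin m)} (hv : DifferentiableAt ℝ v y) (i : Fin m) (α : Fin n) :
    Coord.pd i (fun z => v z α) y = fderiv ℝ v y (stdVec i) α :=
  fderiv_coord hv _ _

lemma conn_apply_stdVec_left (c : Fin m → Fin m → Fin m → ℝ) (i k : Fin m)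
    (X : EuclideanSpace ℝ (Fin m)) : conn c (stdVec i) X k = ∑ p, c k i p * X p := by
  simp [conn_apply]

lemma curv_eq {G : EuclideanSpace ℝ (Fin m) → Matrix (Fin m) (Fin m) ℝ}
    {y : EuclideanSpace ℝ (Fin m)} (hd : DifferentiableAt ℝ (leviCivita G) y) (l i j k : Fin m) :
    Coord.curv G y l i j k
      = curvature (leviCivita G) y (stdVec i) (stdVec j) (stdVec k) l := by
  have key : ∀ a b c : Fin m, Coord.pd a (fun z => Coord.christoffel G z l b c) y
      = fderiv ℝ (leviCivita G) y (stdVec a) (stdVec b) (stdVec c) l := fun a b c => by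
    have h1 : DifferentiableAt ℝ (fun z => leviCivita G z (stdVec b)) y :=
      hd.clm_apply (differentiableAt_const _)
    rw [← fderiv_clm_const hd, ← fderiv_clm_const h1,
      ← fderiv_coord (h1.clm_apply (differentiableAt_const _))]
    simp only [leviCivita, conn_stdVec]
    rfl
  rw [Coord.curv, key, key, curvature]
  simp only [PiLp.sub_apply, PiLp.add_apply]
  rw [Finset.sum_sub_distrib]
  have h2 : ∀ a b c : Fin m, leviCivita G y (stdVec a) (leviCivita G y (stdVec b) (stdVec c)) l
      = ∑ p, Coord.christoffel G y l a p * Coord.christoffel G y p b c := fun a b c => by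
    rw [leviCivita, conn_apply_stdVec_left]
    simp only [conn_stdVec]
  rw [h2, h2]
  ring

lemma sum_apply_coord {ι : Type*} (s : Finset ι) (v : ι → EuclideanSpace ℝ (Fin n)) (α : Fin n) :
    (∑ i ∈ s, v i) α = ∑ i ∈ s, v i α := by simp

/-- The trace of an endomorphism needs a basis and its dual only. The matrix A is therefore free,
and the Ricci tensor of one metric can be contracted with frames dual for a conformal one. -/
lemma ricci_eq {G : EuclideanSpace ℝ (Fin m) → Matrix (Fin m) (Fin m) ℝ}
    {y : EuclideanSpace ℝ (Fin m)} (hd : DifferentiableAt ℝ (leviCivita G) y)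
    {A : Matrix (Fin m) (Fin m) ℝ} (hA : A.det ≠ 0) (j k : Fin m) :
    Coord.ricci G y j k = ricTensor (bilin A) (curvature (leviCivita G) y) stdVec (dualVec A)
      (stdVec j) (stdVec k) := by
  simp only [Coord.ricci, ricTensor, curv_eq hd, bilin_dualVec hA]

lemma ricTensor_isBilin (g : EuclideanSpace ℝ (Fin m) →L[ℝ] EuclideanSpace ℝ (Fin m) →L[ℝ] ℝ)
    (Γ : EuclideanSpace ℝ (Fin m) → EuclideanSpace ℝ (Fin m) →L[ℝ] EuclideanSpace ℝ (Fin m) →L[ℝ]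
      EuclideanSpace ℝ (Fin m)) (y : EuclideanSpace ℝ (Fin m))
    (e f : Fin m → EuclideanSpace ℝ (Fin m)) :
    IsBilin (ricTensor g (curvature Γ y) e f) := by
  have h := fun i => curvature_isBilin Γ y (e i)
  constructor <;> intro Y <;> constructor <;> intros <;>
    simp only [ricTensor, ((h _).left _).map_add, ((h _).right _).map_add, ((h _).left _).map_smul,
      ((h _).right _).map_smul, map_add, map_smul, Finset.sum_add_distrib, ← Finset.smul_sum]

lemma IsBilin.sum_inv_mul {W : Type*} [AddCommGroup W] [Module ℝ W]
    {b : EuclideanSpace ℝ (Fin m) → EuclideanSpace ℝ (Fin m) → W} (hb : IsBilin b)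
    (A : Matrix (Fin m) (Fin m) ℝ) :
    ∑ i, ∑ j, A⁻¹ i j • b (stdVec i) (stdVec j) = ∑ i, b (stdVec i) (dualVec A i) := by
  refine Finset.sum_congr rfl fun i _ => ?_
  rw [dualVec, hb.sum_smul_right]

lemma IsBilin.sum_smul_sum_smul {W : Type*} [AddCommGroup W] [Module ℝ W]
    {b : EuclideanSpace ℝ (Fin m) → EuclideanSpace ℝ (Fin m) → W} (hb : IsBilin b)
    (A B : Matrix (Fin m) (Fin m) ℝ) (i j : Fin m) :
    ∑ k, ∑ l, (A k i * B l j) • b (stdVec k) (stdVec l)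
      = b (endo A (stdVec i)) (endo B (stdVec j)) := by
  rw [endo_stdVec_eq, endo_stdVec_eq, hb.sum_smul_left]
  refine Finset.sum_congr rfl fun k _ => ?_
  rw [hb.sum_smul_right, Finset.smul_sum]
  simp only [mul_smul]

lemma starRicci_eq {G J : EuclideanSpace ℝ (Fin m) → Matrix (Fin m) (Fin m) ℝ}
    {y : EuclideanSpace ℝ (Fin m)} (hd : DifferentiableAt ℝ (leviCivita G) y)
    {A : Matrix (Fin m) (Fin m) ℝ} (hA : A.det ≠ 0) (i j : Fin m) :
    Coord.starRicci G J y i j = starTensor (bilin A) (curvature (leviCivita G) y) (endo (J y))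
      stdVec (dualVec A) (stdVec i) (stdVec j) := by
  simp only [Coord.starRicci, starTensor, curv_eq hd, bilin_dualVec hA]
  refine Finset.sum_congr rfl fun k _ => ?_
  rw [← (curvature_isBilin (leviCivita G) y (stdVec i)).sum_smul_sum_smul]
  simp

lemma starTensor_isBilin (g : EuclideanSpace ℝ (Fin m) →L[ℝ] EuclideanSpace ℝ (Fin m) →L[ℝ] ℝ)
    (Γ : EuclideanSpace ℝ (Fin m) → EuclideanSpace ℝ (Fin m) →L[ℝ] EuclideanSpace ℝ (Fin m) →L[ℝ]
      EuclideanSpace ℝ (Fin m)) (y : EuclideanSpace ℝ (Fin m))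
    (J : EuclideanSpace ℝ (Fin m) →L[ℝ] EuclideanSpace ℝ (Fin m))
    (e f : Fin m → EuclideanSpace ℝ (Fin m)) :
    IsBilin (starTensor g (curvature Γ y) J e f) := by
  have h := fun X => curvature_isBilin Γ y X
  have h' := fun Z => curvature_isBilin' Γ y Z
  constructor <;> intro Y <;> constructor <;> intros <;>
    simp only [starTensor, ((h' _).left _).map_add, ((h _).right _).map_add,
      ((h' _).left _).map_smul, ((h _).right _).map_smul, map_add, map_smul,
      Finset.sum_add_distrib, ← Finset.smul_sum]

/-- The coordinate field v has to agree with w only near y. This allows the tension field to be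
replaced by a formula valid on an open set. -/
lemma covAlong_eq {H : EuclideanSpace ℝ (Fin n) → Matrix (Fin n) (Fin n) ℝ}
    {F : EuclideanSpace ℝ (Fin m) → EuclideanSpace ℝ (Fin n)}
    {v : EuclideanSpace ℝ (Fin m) → Fin n → ℝ} {y : EuclideanSpace ℝ (Fin m)}
    {w : EuclideanSpace ℝ (Fin m) → EuclideanSpace ℝ (Fin n)}
    (hvw : ∀ᶠ z in 𝓝 y, ∀ α, v z α = w z α)
    (hF : DifferentiableAt ℝ F y) (hw : DifferentiableAt ℝ w y) (i : Fin m) (α : Fin n) :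
    Coord.covAlong H F v i y α = cov (pullback (leviCivita H) F) w y (stdVec i) α := by
  have h1 : (fun z => v z α) =ᶠ[𝓝 y] fun z => w z α := hvw.mono fun z hz => hz α
  have h2 : Coord.pd i (fun z => v z α) y = fderiv ℝ w y (stdVec i) α := by
    rw [← pd_coord hw, Coord.pd, Coord.pd, h1.fderiv_eq]
  rw [Coord.covAlong, h2, cov_apply, PiLp.add_apply, pullback_apply, leviCivita, conn_apply]
  simp only [pd_coord hF, hvw.self_of_nhds]

lemma tension_eq {G : EuclideanSpace ℝ (Fin m) → Matrix (Fin m) (Fin m) ℝ}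
    {H : EuclideanSpace ℝ (Fin n) → Matrix (Fin n) (Fin n) ℝ}
    {F : EuclideanSpace ℝ (Fin m) → EuclideanSpace ℝ (Fin n)} {y : EuclideanSpace ℝ (Fin m)}
    (hF : ∀ᶠ z in 𝓝 y, ContDiffAt ℝ ∞ F z) (α : Fin n) :
    Coord.tension G H F y α
      = (∑ i, sff (leviCivita G) (leviCivita H) F y (stdVec i) (dualVec (G y) i)) α := by
  have hFy := smooth_differentiableAt hF.self_of_nhds
  rw [← (IsBilin.of_clm (sff (leviCivita G) (leviCivita H) F y)).sum_inv_mul]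
  simp only [sum_apply_coord, PiLp.smul_apply, smul_eq_mul, Coord.tension]
  refine Finset.sum_congr rfl fun i _ => Finset.sum_congr rfl fun j _ => ?_
  congr 1
  have hv : ∀ᶠ z in 𝓝 y, ∀ β, Coord.pd j (fun w => F w β) z = fderiv ℝ F z (stdVec j) β :=
    hF.mono fun z hz β => pd_coord (smooth_differentiableAt hz) j β
  have hd : DifferentiableAt ℝ (fun z => fderiv ℝ F z (stdVec j)) y :=
    smooth_differentiableAt ((smooth_fderiv hF.self_of_nhds).clm_apply contDiffAt_const)
  rw [covAlong_eq hv hFy hd, cov_pushforward (Γ := leviCivita G) hF.self_of_nhds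
    (differentiableAt_const _), cov_const, PiLp.add_apply]
  have : ∑ k, Coord.christoffel G y k i j * Coord.pd k (fun z => F z α) y
      = fderiv ℝ F y (leviCivita G y (stdVec i) (stdVec j)) α := by
    rw [linear_expand (L := fun X => fderiv ℝ F y X) ⟨by simp, by simp⟩, sum_apply_coord]
    simp [pd_coord hFy, leviCivita]
  rw [this]
  ring

lemma roughLaplacian_eq {G : EuclideanSpace ℝ (Fin m) → Matrix (Fin m) (Fin m) ℝ}
    {H : EuclideanSpace ℝ (Fin n) → Matrix (Fin n) (Fin n) ℝ}
    {F : EuclideanSpace ℝ (Fin m) → EuclideanSpace ℝ (Fin n)}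
    {v : EuclideanSpace ℝ (Fin m) → Fin n → ℝ} {y : EuclideanSpace ℝ (Fin m)}
    {w : EuclideanSpace ℝ (Fin m) → EuclideanSpace ℝ (Fin n)}
    (hvw : ∀ᶠ z in 𝓝 y, ∀ α, v z α = w z α)
    (hF : ∀ᶠ z in 𝓝 y, ContDiffAt ℝ ∞ F z) (hw : ∀ᶠ z in 𝓝 y, ContDiffAt ℝ ∞ w z)
    (hH : ContDiffAt ℝ ∞ (leviCivita H) (F y)) (α : Fin n) :
    Coord.roughLaplacian G H F v y α
      = (∑ i, cov₂ (leviCivita G) (pullback (leviCivita H) F) w y (stdVec i) (dualVec (G y) i))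
        α := by
  have hθ := smooth_pullback hH hF.self_of_nhds
  rw [← (cov₂_isBilin (Γ := leviCivita G) hθ hw.self_of_nhds).sum_inv_mul]
  simp only [sum_apply_coord, PiLp.smul_apply, smul_eq_mul, Coord.roughLaplacian]
  refine Finset.sum_congr rfl fun i _ => Finset.sum_congr rfl fun j _ => ?_
  congr 1
  have h1 : ∀ᶠ z in 𝓝 y, ∀ (k : Fin m) (β : Fin n), Coord.covAlong H F v k z β
      = cov (pullback (leviCivita H) F) w z (stdVec k) β := by
    filter_upwards [hvw.eventually_nhds, hF, hw] with z h1 h2 h3 k β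
    exact covAlong_eq h1 (smooth_differentiableAt h2) (smooth_differentiableAt h3) k β
  have hd : DifferentiableAt ℝ (fun z => cov (pullback (leviCivita H) F) w z (stdVec j)) y :=
    smooth_differentiableAt ((smooth_cov hθ hw.self_of_nhds).clm_apply contDiffAt_const)
  rw [covAlong_eq (h1.mono fun z hz => hz j) (smooth_differentiableAt hF.self_of_nhds) hd, cov₂,
    PiLp.sub_apply]
  have : ∑ k, Coord.christoffel G y k i j * Coord.covAlong H F v k y α
      = cov (pullback (leviCivita H) F) w y (leviCivita G y (stdVec i) (stdVec j)) α := by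
    rw [linear_expand (L := fun X => cov (pullback (leviCivita H) F) w y X)
      ⟨fun _ _ => map_add _ _ _, fun _ _ => map_smul _ _ _⟩, sum_apply_coord]
    simp only [PiLp.smul_apply, smul_eq_mul, h1.self_of_nhds, leviCivita, conn_stdVec]
  rw [this]

lemma ricciAlong_eq {G : EuclideanSpace ℝ (Fin m) → Matrix (Fin m) (Fin m) ℝ}
    {H : EuclideanSpace ℝ (Fin n) → Matrix (Fin n) (Fin n) ℝ}
    {F : EuclideanSpace ℝ (Fin m) → EuclideanSpace ℝ (Fin n)}
    {v : EuclideanSpace ℝ (Fin m) → Fin n → ℝ} {y : EuclideanSpace ℝ (Fin m)}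
    {w : EuclideanSpace ℝ (Fin n)} (hvw : ∀ α, v y α = w α)
    (hF : DifferentiableAt ℝ F y) (hH : DifferentiableAt ℝ (leviCivita H) (F y)) (α : Fin n) :
    Coord.ricciAlong G H F v y α
      = (∑ i, curvature (leviCivita H) (F y) w (fderiv ℝ F y (stdVec i))
        (fderiv ℝ F y (dualVec (G y) i))) α := by
  rw [← ((curvature_isBilin (leviCivita H) (F y) w).comp (fderiv ℝ F y)
    (fderiv ℝ F y)).sum_inv_mul]
  simp only [sum_apply_coord, PiLp.smul_apply, smul_eq_mul, Coord.ricciAlong]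
  refine Finset.sum_congr rfl fun i _ => Finset.sum_congr rfl fun j _ => ?_
  congr 1
  set A := fderiv ℝ F y (stdVec i) with hA
  set B := fderiv ℝ F y (stdVec j) with hB
  rw [linear_expand (((curvature_isBilin' (leviCivita H) (F y) B).left A)) w]
  rw [sum_apply_coord]
  refine Finset.sum_congr rfl fun β _ => ?_
  have h1 : curvature (leviCivita H) (F y) (stdVec β) A B
      = ∑ δ, A δ • ∑ ε, B ε • curvature (leviCivita H) (F y) (stdVec β) (stdVec δ) (stdVec ε) := by
    have hb := curvature_isBilin (leviCivita H) (F y) (stdVec β)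
    rw [linear_expand (hb.left B) A]
    exact Finset.sum_congr rfl fun δ _ => by rw [linear_expand (hb.right (stdVec δ)) B]
  rw [h1]
  simp only [PiLp.smul_apply, sum_apply_coord, smul_eq_mul, Finset.mul_sum, curv_eq hH, hvw,
    pd_coord hF]
  exact Finset.sum_congr rfl fun δ _ => Finset.sum_congr rfl fun ε _ => by ring

end Translation

/-! ### dΩ, the Nijenhuis tensor and types in coordinates -/

section ExteriorDerivative

variable {m : ℕ} {Ω : Set (EuclideanSpace ℝ (Fin m))}
  {G J : EuclideanSpace ℝ (Fin m) → Matrix (Fin m) (Fin m) ℝ} {y : EuclideanSpace ℝ (Fin m)}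

lemma fundForm_eq (z : EuclideanSpace ℝ (Fin m)) (i j : Fin m) :
    Coord.fundForm G J z i j = bilin (G z) (stdVec i) (endo (J z) (stdVec j)) := by
  simp [Coord.fundForm, bilin_stdVec_left]

lemma dFundForm_eq (i j k : Fin m) :
    Coord.dFundForm G J y i j k
      = dFund (fun z => bilin (G z)) (fun z => endo (J z)) y (stdVec i) (stdVec j) (stdVec k) := by
  simp only [Coord.dFundForm, dFund, fundForm_eq, Coord.pd]

lemma dFund_expand (H : IsHermitianMatrix Ω G J) (hy : y ∈ Ω)
    (X Y Z : EuclideanSpace ℝ (Fin m)) :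
    dFund (fun z => bilin (G z)) (fun z => endo (J z)) y X Y Z
      = ∑ i, ∑ j, ∑ k, Coord.dFundForm G J y i j k * X i * Y j * Z k := by
  have hg := smooth_differentiableAt (smooth_bilin (H.smooth_G y hy))
  have hJ := smooth_differentiableAt (smooth_endo (H.smooth_J y hy))
  set T := dFund (fun z => bilin (G z)) (fun z => endo (J z)) y with hT
  have h0 : T = fun X Y Z =>
      (fderiv ℝ (fun z => bilin (G z)) y X Y (endo (J y) Z)
        + bilin (G y) Y (fderiv ℝ (fun z => endo (J z)) y X Z))
      + (fderiv ℝ (fun z => bilin (G z)) y Y Z (endo (J y) X)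
        + bilin (G y) Z (fderiv ℝ (fun z => endo (J z)) y Y X))
      + (fderiv ℝ (fun z => bilin (G z)) y Z X (endo (J y) Y)
        + bilin (G y) X (fderiv ℝ (fun z => endo (J z)) y Z Y)) := by
    have key : ∀ A B C, fderiv ℝ (fun z => bilin (G z) B (endo (J z) C)) y A
        = fderiv ℝ (fun z => bilin (G z)) y A B (endo (J y) C)
          + bilin (G y) B (fderiv ℝ (fun z => endo (J z)) y A C) := fun A B C => by
      rw [fderiv_clm₂ hg (differentiableAt_const _) (hJ.clm_apply (differentiableAt_const _)),
        fderiv_clm_const hJ]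
      simp
    ext X Y Z
    rw [hT, dFund, key, key, key]
  have l1 : ∀ Y Z, IsLinearMap ℝ fun X => T X Y Z := fun Y Z => by
    rw [h0]; constructor <;> intros <;> simp <;> ring
  have l2 : ∀ X Z, IsLinearMap ℝ fun Y => T X Y Z := fun Y Z => by
    rw [h0]; constructor <;> intros <;> simp <;> ring
  have l3 : ∀ X Y, IsLinearMap ℝ fun Z => T X Y Z := fun Y Z => by
    rw [h0]; constructor <;> intros <;> simp <;> ring
  rw [linear_expand (l1 Y Z) X]
  refine Finset.sum_congr rfl fun i _ => ?_
  rw [linear_expand (l2 (stdVec i) Z) Y, Finset.smul_sum]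
  refine Finset.sum_congr rfl fun j _ => ?_
  rw [linear_expand (l3 (stdVec i) (stdVec j)) Z, Finset.smul_sum, Finset.smul_sum]
  refine Finset.sum_congr rfl fun k _ => ?_
  rw [dFundForm_eq, ← hT]
  simp only [smul_eq_mul]
  ring

lemma nijTensor_eq_zero (H : IsHermitianMatrix Ω G J) (hy : y ∈ Ω)
    (h : ∀ k i j, Coord.nijenhuis J y k i j = 0) (X Y : EuclideanSpace ℝ (Fin m)) :
    nijTensor (fun z => endo (J z)) y X Y = 0 := by
  have hJ := smooth_differentiableAt (smooth_endo (H.smooth_J y hy))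
  have hJi := fun i j => smooth_differentiableAt (H.smooth_J y hy i j)
  have key : ∀ (A : EuclideanSpace ℝ (Fin m)) (j k : Fin m),
      fderiv ℝ (fun z => endo (J z)) y A (stdVec j) k
        = ∑ a, A a * Coord.pd a (fun z => J z k j) y := fun A j k => by
    rw [← fderiv_clm_const hJ, ← fderiv_coord (hJ.clm_apply (differentiableAt_const _))]
    simp only [endo_stdVec]
    rw [linear_expand (L := fun A => fderiv ℝ (fun z => J z k j) y A) ⟨by simp, by simp⟩]
    rfl
  refine linear_ext (L := fun X => nijTensor (fun z => endo (J z)) y X Y) (L' := fun _ => 0)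
    ⟨fun _ _ => by simp [nijTensor]; abel, fun _ _ => by simp [nijTensor, smul_sub]⟩
    ⟨by simp, by simp⟩ (fun i => ?_) X
  refine linear_ext (L := fun Y => nijTensor (fun z => endo (J z)) y (stdVec i) Y)
    (L' := fun _ => 0)
    ⟨fun _ _ => by simp [nijTensor]; abel, fun _ _ => by simp [nijTensor, smul_sub]⟩
    ⟨by simp, by simp⟩ (fun j => ?_) Y
  ext k
  have h1 := h k i j
  rw [Coord.nijenhuis, Finset.sum_sub_distrib, Finset.sum_sub_distrib] at h1
  rw [nijTensor, PiLp.sub_apply, PiLp.sub_apply, key, key, endo_apply]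
  simp only [PiLp.sub_apply, key, endo_stdVec]
  simpa [Pi.single_apply] using h1

/-- The real form of the `(1,2)`-symplectic condition. -/
lemma dFund_one_two (H : IsHermitianMatrix Ω G J) (hy : y ∈ Ω)
    (h : ∀ Z W V : Fin m → ℂ, (∀ k, ∑ a, (J y k a : ℂ) * Z a = Complex.I * Z k) →
      (∀ k, ∑ a, (J y k a : ℂ) * W a = -(Complex.I * W k)) →
      (∀ k, ∑ a, (J y k a : ℂ) * V a = -(Complex.I * V k)) →
      ∑ i, ∑ j, ∑ k, (Coord.dFundForm G J y i j k : ℂ) * Z i * W j * V k = 0)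
    (X Y V : EuclideanSpace ℝ (Fin m)) :
    let T := dFund (fun z => bilin (G z)) (fun z => endo (J z)) y
    let K := endo (J y)
    T X Y V - T X (K Y) (K V) + T (K X) (K Y) V + T (K X) Y (K V) = 0 := by
  intro T K
  have hJ : ∀ (X : EuclideanSpace ℝ (Fin m)) k, ∑ a, J y k a * X a = K X k := fun X k =>
    (endo_apply _ _ _).symm
  have hC : ∀ (X : EuclideanSpace ℝ (Fin m)) k, ∑ a, (J y k a : ℂ) * (X a : ℂ) = (K X k : ℂ) :=
    fun X k => by rw [← hJ X k]; push_cast; rfl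
  have hKK : ∀ (X : EuclideanSpace ℝ (Fin m)) k, ((K (K X) k : ℝ) : ℂ) = -(X k : ℂ) :=
    fun X k => by rw [H.J_sq y hy]; simp
  have t10 : ∀ k, ∑ a, (J y k a : ℂ) * ((X a : ℂ) - Complex.I * K X a)
      = Complex.I * ((X k : ℂ) - Complex.I * K X k) := fun k => by
    have e : ∀ a, (J y k a : ℂ) * ((X a : ℂ) - Complex.I * K X a)
        = (J y k a : ℂ) * (X a : ℂ) - Complex.I * ((J y k a : ℂ) * K X a) := fun a => by ring
    simp only [e, Finset.sum_sub_distrib, ← Finset.mul_sum, hC, hKK]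
    linear_combination (K X k : ℂ) * Complex.I_mul_I
  have t01 : ∀ (Y : EuclideanSpace ℝ (Fin m)) k,
      ∑ a, (J y k a : ℂ) * ((Y a : ℂ) + Complex.I * K Y a)
      = -(Complex.I * ((Y k : ℂ) + Complex.I * K Y k)) := fun Y k => by
    have e : ∀ a, (J y k a : ℂ) * ((Y a : ℂ) + Complex.I * K Y a)
        = (J y k a : ℂ) * (Y a : ℂ) + Complex.I * ((J y k a : ℂ) * K Y a) := fun a => by ring
    simp only [e, Finset.sum_add_distrib, ← Finset.mul_sum, hC, hKK]
    linear_combination (K Y k : ℂ) * Complex.I_mul_I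
  -- The vectors are X - iJX of type (1,0), and Y + iJY and V + iJV of type (0,1). The real part
  -- keeps the terms with an even number of factors J.
  have h1 := congrArg Complex.re (h _ _ _ t10 (t01 Y) (t01 V))
  simp only [Complex.re_sum, Complex.zero_re] at h1
  have e : ∀ i j k, ((Coord.dFundForm G J y i j k : ℂ) * ((X i : ℂ) - Complex.I * K X i)
      * ((Y j : ℂ) + Complex.I * K Y j) * ((V k : ℂ) + Complex.I * K V k)).re
      = Coord.dFundForm G J y i j k * X i * Y j * V k
        - Coord.dFundForm G J y i j k * X i * K Y j * K V k
        + Coord.dFundForm G J y i j k * K X i * K Y j * V k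
        + Coord.dFundForm G J y i j k * K X i * Y j * K V k := fun i j k => by
    simp
    ring
  simp only [e, Finset.sum_add_distrib, Finset.sum_sub_distrib] at h1
  simp only [T, dFund_expand H hy]
  exact h1

end ExteriorDerivative

end TensorCalc

namespace TensorCalc

open Filter Topology

/-! ### Traces under a conformal change -/

section ConformalChange

variable {E W : Type*} [NormedAddCommGroup E] [NormedSpace ℝ E] [NormedAddCommGroup W]
  [NormedSpace ℝ W] {ι : Type*} [Fintype ι]
  {g : E → E →L[ℝ] E →L[ℝ] ℝ} {Γ Γc : E → E →L[ℝ] E →L[ℝ] E} {u : E → E} {y : E} {e f : ι → E}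

/-- The three correction terms trace to u + u - 4u. This is where dimension four produces the
constant 2 in the tension field. -/
lemma IsConformalChange.sum_eq (hc : IsConformalChange g u Γ Γc y) (hF : IsDualFrame (g y) e f)
    (hs : ∀ X Y, g y X Y = g y Y X) (hdim : ∑ i, g y (f i) (e i) = 4) (L : E →L[ℝ] W) :
    ∑ i, L (Γc y (e i) (f i)) = ∑ i, L (Γ y (e i) (f i)) - (2 : ℝ) • L (u y) := by
  have h1 := hF.right (u y)
  have h2 := hF.left (u y)
  have h3 : ∑ i, g y (e i) (f i) = 4 := by
    rw [← hdim]; exact Finset.sum_congr rfl fun i _ => hs _ _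
  simp only [← map_sum, ← map_smul, ← map_sub]
  congr 1
  simp only [hc _ _, Finset.sum_add_distrib, Finset.sum_sub_distrib, ← Finset.sum_smul,
    hs (u y), h1, h2, h3]
  module

lemma IsConformalChange.sum_cov₂ {θ : E → E →L[ℝ] W →L[ℝ] W} {v : E → W}
    (hc : IsConformalChange g u Γ Γc y) (hF : IsDualFrame (g y) e f)
    (hs : ∀ X Y, g y X Y = g y Y X) (hdim : ∑ i, g y (f i) (e i) = 4) :
    ∑ i, cov₂ Γc θ v y (e i) (f i)
      = ∑ i, cov₂ Γ θ v y (e i) (f i) + (2 : ℝ) • cov θ v y (u y) := by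
  simp only [cov₂, Finset.sum_sub_distrib, hc.sum_eq hF hs hdim (cov θ v y)]
  abel

lemma IsConformalChange.sum_sff {E' : Type*} [NormedAddCommGroup E'] [NormedSpace ℝ E']
    {Γ' : E' → E' →L[ℝ] E' →L[ℝ] E'} {F : E → E'}
    (hc : IsConformalChange g u Γ Γc y) (hF : IsDualFrame (g y) e f)
    (hs : ∀ X Y, g y X Y = g y Y X) (hdim : ∑ i, g y (f i) (e i) = 4) :
    ∑ i, sff Γc Γ' F y (e i) (f i)
      = ∑ i, sff Γ Γ' F y (e i) (f i) + (2 : ℝ) • fderiv ℝ F y (u y) := by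
  simp only [sff_apply, Finset.sum_sub_distrib, hc.sum_eq hF hs hdim (fderiv ℝ F y)]
  abel

end ConformalChange

/-! ### Rescaled metrics and gradients -/

section Matrices

variable {m : ℕ}

lemma bilin_smul (c : ℝ) (A : Matrix (Fin m) (Fin m) ℝ) : bilin (c • A) = c • bilin A := by
  ext X Y
  simp only [bilin_apply, smul_apply, Matrix.smul_apply, smul_eq_mul, Finset.mul_sum, mul_assoc]

lemma dualVec_smul {c : ℝ} (hc : c ≠ 0) {A : Matrix (Fin m) (Fin m) ℝ} (hA : A.det ≠ 0)
    (i : Fin m) : dualVec A i = c • dualVec (c • A) i := by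
  have : Invertible c := invertibleOfNonzero hc
  simp only [dualVec, Matrix.inv_smul A c (isUnit_iff_ne_zero.mpr hA), Finset.smul_sum, smul_smul,
    Matrix.smul_apply, smul_eq_mul, invOf_eq_inv, mul_inv_cancel_left₀ hc]

variable {Ω : Set (EuclideanSpace ℝ (Fin m))}
  {G J : EuclideanSpace ℝ (Fin m) → Matrix (Fin m) (Fin m) ℝ} {γ : EuclideanSpace ℝ (Fin m) → ℝ}
  {y : EuclideanSpace ℝ (Fin m)}

/-- The matrix of the metric `e^{-2γ} G`. -/
noncomputable def rescale (γ : EuclideanSpace ℝ (Fin m) → ℝ)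
    (G : EuclideanSpace ℝ (Fin m) → Matrix (Fin m) (Fin m) ℝ) (z : EuclideanSpace ℝ (Fin m)) :
    Matrix (Fin m) (Fin m) ℝ := Real.exp (-2 * γ z) • G z

/-- The gradient of `γ` for the metric with matrix `A`. -/
noncomputable def gradient (γ : EuclideanSpace ℝ (Fin m) → ℝ)
    (A : EuclideanSpace ℝ (Fin m) → Matrix (Fin m) (Fin m) ℝ) (z : EuclideanSpace ℝ (Fin m)) :
    EuclideanSpace ℝ (Fin m) := ∑ j, fderiv ℝ γ z (stdVec j) • dualVec (A z) j

lemma bilin_gradient {A : EuclideanSpace ℝ (Fin m) → Matrix (Fin m) (Fin m) ℝ}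
    (hA : (A y).det ≠ 0) (X : EuclideanSpace ℝ (Fin m)) :
    bilin (A y) (gradient γ A y) X = fderiv ℝ γ y X := by
  rw [gradient, (IsBilin.of_clm (bilin (A y))).sum_smul_left,
    linear_expand (L := fun X => fderiv ℝ γ y X) ⟨by simp, by simp⟩ X]
  exact Finset.sum_congr rfl fun j _ => by rw [bilin_dualVec hA, smul_eq_mul, smul_eq_mul, mul_comm]

lemma IsHermitianMatrix.smooth_gradient (H : IsHermitianMatrix Ω G J) (hy : y ∈ Ω)
    (hγ : ContDiffAt ℝ ∞ γ y) : ContDiffAt ℝ ∞ (gradient γ G) y :=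
  ContDiffAt.sum fun j _ => ((smooth_fderiv hγ).clm_apply contDiffAt_const).smul
    (ContDiffAt.sum fun k _ =>
      (smooth_inv (H.smooth_G y hy) (H.det_ne_zero hy) j k).smul contDiffAt_const)

lemma IsHermitianMatrix.rescale (H : IsHermitianMatrix Ω G J)
    (hγ : ∀ y ∈ Ω, ContDiffAt ℝ ∞ γ y) : IsHermitianMatrix Ω (rescale γ G) J where
  isOpen := H.isOpen
  smooth_G y hy i j := (contDiffAt_const.mul (hγ y hy)).exp.mul (H.smooth_G y hy i j)
  smooth_J := H.smooth_J
  symm y hy X Y := by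
    rw [TensorCalc.rescale, bilin_smul, smul_apply, smul_apply, smul_apply, smul_apply,
      H.symm y hy]
  pos y hy X hX := by
    rw [TensorCalc.rescale, bilin_smul, smul_apply, smul_apply, smul_eq_mul]
    exact mul_pos (Real.exp_pos _) (H.pos y hy X hX)
  J_sq := H.J_sq
  J_isometry y hy X Y := by
    rw [TensorCalc.rescale, bilin_smul, smul_apply, smul_apply, smul_apply, smul_apply,
      H.J_isometry y hy]

lemma pd_rescale (hG : ∀ i j, DifferentiableAt ℝ (fun z => G z i j) y)
    (hγ : DifferentiableAt ℝ γ y) (k i j : Fin m) :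
    Coord.pd k (fun z => rescale γ G z i j) y
      = Real.exp (-2 * γ y) * Coord.pd k (fun z => G z i j) y
        - 2 * fderiv ℝ γ y (stdVec k) * rescale γ G y i j := by
  simp only [Coord.pd, rescale, Matrix.smul_apply, smul_eq_mul]
  rw [fderiv_fun_mul (hγ.const_mul _).exp (hG i j), fderiv_exp (hγ.const_mul _),
    fderiv_const_mul hγ]
  simp only [add_apply, smul_apply, smul_eq_mul]
  ring

/-- Compare the Koszul formulas of G and e^{-2γ} G on basis vectors: the derivatives of the
exponential give the terms in dγ, which is the inner product with u. -/
lemma IsHermitianMatrix.isConformalChange (H : IsHermitianMatrix Ω G J)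
    (hγ : ∀ y ∈ Ω, ContDiffAt ℝ ∞ γ y) (hy : y ∈ Ω) :
    IsConformalChange (fun z => bilin (TensorCalc.rescale γ G z))
      (gradient γ (TensorCalc.rescale γ G))
      (leviCivita (TensorCalc.rescale γ G)) (leviCivita G) y := by
  have K := H.rescale hγ
  have hgrad := bilin_gradient (γ := γ) (K.det_ne_zero hy)
  set h := TensorCalc.rescale γ G with hh
  set u := gradient γ h
  intro X Y
  refine linear_ext (L := fun X => leviCivita G y X Y)
    (L' := fun X => leviCivita h y X Y + bilin (h y) (u y) X • Y + bilin (h y) (u y) Y • X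
      - bilin (h y) X Y • u y) ⟨by simp, by simp⟩
    ⟨fun _ _ => by simp only [map_add, add_apply]; module,
      fun _ _ => by simp only [map_smul, smul_apply, smul_eq_mul]; module⟩ (fun i => ?_) X
  refine linear_ext (L := fun Y => leviCivita G y (stdVec i) Y)
    (L' := fun Y => leviCivita h y (stdVec i) Y + bilin (h y) (u y) (stdVec i) • Y
      + bilin (h y) (u y) Y • stdVec i - bilin (h y) (stdVec i) Y • u y) ⟨by simp, by simp⟩
    ⟨fun _ _ => by simp only [map_add]; module,
      fun _ _ => by simp only [map_smul, smul_eq_mul]; module⟩ (fun j => ?_) Y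
  refine K.isHermitianData.eq_of_inner hy fun Z => ?_
  refine linear_ext (L := fun Z => bilin (h y) (leviCivita G y (stdVec i) (stdVec j)) Z)
    (L' := fun Z => bilin (h y) (leviCivita h y (stdVec i) (stdVec j)
      + bilin (h y) (u y) (stdVec i) • stdVec j
      + bilin (h y) (u y) (stdVec j) • stdVec i - bilin (h y) (stdVec i) (stdVec j) • u y) Z)
    ⟨by simp, by simp⟩ ⟨fun _ _ => map_add _ _ _, fun _ _ => map_smul _ _ _⟩ (fun l => ?_) Z
  have hG := fun i j => smooth_differentiableAt (H.smooth_G y hy i j)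
  have hγy := smooth_differentiableAt (hγ y hy)
  have k1 := H.koszul hy i j l
  have k2 := K.koszul hy i j l
  rw [pd_rescale hG hγy, pd_rescale hG hγy, pd_rescale hG hγy] at k2
  have e : bilin (h y) (leviCivita G y (stdVec i) (stdVec j)) (stdVec l)
      = Real.exp (-2 * γ y) * bilin (G y) (leviCivita G y (stdVec i) (stdVec j)) (stdVec l) := by
    rw [hh, TensorCalc.rescale, bilin_smul]; rfl
  rw [e, k1]
  simp only [map_add, map_sub, map_smul, add_apply, sub_apply, smul_apply, smul_eq_mul, hgrad,
    bilin_stdVec]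
  rw [k2]
  ring

end Matrices

/-! ### The theorem on an open subset of ℝ⁴ -/

section Local

lemma isBilin_ext {m : ℕ} {b b' : EuclideanSpace ℝ (Fin m) → EuclideanSpace ℝ (Fin m) → ℝ}
    (hb : IsBilin b) (hb' : IsBilin b')
    (h : ∀ i j, b (stdVec i) (stdVec j) = b' (stdVec i) (stdVec j))
    (X Y : EuclideanSpace ℝ (Fin m)) : b X Y = b' X Y :=
  linear_ext (hb.left Y) (hb'.left Y) (fun i => linear_ext (hb.right _) (hb'.right _) (h i) Y) X

variable {Ω : Set (EuclideanSpace ℝ (Fin 4))}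
  {G J : EuclideanSpace ℝ (Fin 4) → Matrix (Fin 4) (Fin 4) ℝ} {γ : EuclideanSpace ℝ (Fin 4) → ℝ}

lemma sum_bilin_dualVec {A : Matrix (Fin 4) (Fin 4) ℝ} (hA : A.det ≠ 0) :
    ∑ i, bilin A (dualVec A i) (stdVec i) = 4 := by
  simp [bilin_dualVec hA]

lemma IsHermitianMatrix.isKahlerData (H : IsHermitianMatrix Ω G J)
    (hclosed : ∀ y ∈ Ω, ∀ i j k, Coord.dFundForm G J y i j k = 0)
    (hnij : ∀ y ∈ Ω, ∀ k i j, Coord.nijenhuis J y k i j = 0) :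
    IsKahlerData Ω (fun z => bilin (G z)) (fun z => endo (J z)) (leviCivita G) :=
  H.isHermitianData.isKahlerData
    (fun y hy X Y Z => by rw [dFund_expand H hy]; simp [hclosed y hy])
    (fun y hy => nijTensor_eq_zero H hy (hnij y hy))

/-- The conditions on the curvature of a locally conformal Kähler metric, in terms of the
Kähler metric and the gradient of the conformal factor. -/
lemma IsHermitianMatrix.conformal_conditions (H : IsHermitianMatrix Ω G J)
    (hγ : ∀ y ∈ Ω, ContDiffAt ℝ ∞ γ y)
    (K : IsKahlerData Ω (fun z => bilin (TensorCalc.rescale γ G z)) (fun z => endo (J z))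
      (leviCivita (TensorCalc.rescale γ G)))
    (hRic : ∀ y ∈ Ω, ∀ i j, ∑ a, ∑ b, J y a i * J y b j * Coord.ricci G y a b
      = Coord.ricci G y i j)
    (hs : ∀ y ∈ Ω, Coord.scalar G y = Coord.starScalar G J y)
    {y : EuclideanSpace ℝ (Fin 4)} (hy : y ∈ Ω) :
    let h := TensorCalc.rescale γ G
    let u := gradient γ h
    (∀ X, cov (leviCivita h) u y (endo (J y) X) - bilin (h y) (u y) (endo (J y) X) • u y
      = endo (J y) (cov (leviCivita h) u y X - bilin (h y) (u y) X • u y)) ∧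
    ∑ i, bilin (h y) (cov (leviCivita h) u y (stdVec i) - bilin (h y) (u y) (stdVec i) • u y)
      (dualVec (h y) i) = -2 * bilin (h y) (u y) (u y) := by
  intro h u
  have Hh := H.rescale hγ
  have hdet : (h y).det ≠ 0 := Hh.det_ne_zero hy
  have hd := smooth_differentiableAt (H.smooth_leviCivita hy)
  have hu := Hh.smooth_gradient hy (hγ y hy)
  have ric := ricTensor_isBilin (bilin (h y)) (leviCivita G) y stdVec (dualVec (h y))
  have star := starTensor_isBilin (bilin (h y)) (leviCivita G) y (endo (J y)) stdVec
    (dualVec (h y))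
  refine K.conformal_conditions hy (isDualFrame_dualVec hdet (Hh.symm y hy))
    (sum_bilin_dualVec hdet) (H.smooth_leviCivita hy) hu
    ((H.eventually_mem hy).mono fun z hz => H.isConformalChange hγ hz) ?_ ?_ ?_
  · have hgrad : ∀ Y : EuclideanSpace ℝ (Fin 4),
        (fun z => bilin (h z) (u z) Y) =ᶠ[𝓝 y] fun z => fderiv ℝ γ z Y := fun Y => by
      filter_upwards [H.eventually_mem hy] with z hz using bilin_gradient (Hh.det_ne_zero hz) Y
    -- ∇u is the Hessian of γ for the Kähler metric, hence symmetric.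
    have key : ∀ X Y, bilin (h y) (cov (leviCivita h) u y X) Y
        = fderiv ℝ (fderiv ℝ γ) y X Y - fderiv ℝ γ y (leviCivita h y X Y) := fun X Y => by
      have h1 := K.fderiv_inner hy (smooth_differentiableAt hu) (differentiableAt_const Y) X
      rw [(hgrad Y).fderiv_eq,
        fderiv_clm_const (smooth_differentiableAt (smooth_fderiv (hγ y hy))), cov_const,
        bilin_gradient hdet] at h1
      linarith
    intro X Y
    rw [key, key, smooth_fderiv_symm (hγ y hy) X Y, K.torsion_free y hy X Y]
  · refine isBilin_ext (ric.comp (endo (J y)) (endo (J y))) ric fun i j => ?_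
    have h1 := hRic y hy i j
    simp only [ricci_eq hd hdet] at h1
    rw [← h1]
    exact (ric.sum_smul_sum_smul (J y) (J y) i j).symm
  -- Traces for g and for the Kähler metric differ by the factor e^{-2γ}, common to both scalar
  -- curvatures.
  · have hc : Real.exp (-2 * γ y) ≠ 0 := (Real.exp_pos _).ne'
    have e := dualVec_smul hc (H.det_ne_zero hy)
    have h1 := hs y hy
    have hsc : Coord.scalar G y = Real.exp (-2 * γ y) * ∑ i, ricTensor (bilin (h y))
        (curvature (leviCivita G) y) stdVec (dualVec (h y)) (stdVec i) (dualVec (h y) i) := by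
      refine Eq.trans (by simp only [Coord.scalar, ricci_eq hd hdet, smul_eq_mul])
        ((ric.sum_inv_mul (G y)).trans ?_)
      rw [Finset.mul_sum]
      exact Finset.sum_congr rfl fun i _ => by rw [e i, (ric.right _).map_smul]; rfl
    have hst : Coord.starScalar G J y = Real.exp (-2 * γ y) * ∑ i, starTensor (bilin (h y))
        (curvature (leviCivita G) y) (endo (J y)) stdVec (dualVec (h y)) (stdVec i)
        (dualVec (h y) i) := by
      refine Eq.trans (by simp only [Coord.starScalar, starRicci_eq hd hdet, smul_eq_mul])
        ((star.sum_inv_mul (G y)).trans ?_)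
      rw [Finset.mul_sum]
      exact Finset.sum_congr rfl fun i _ => by rw [e i, (star.right _).map_smul]; rfl
    rw [hsc, hst] at h1
    exact mul_left_cancel₀ hc h1

/-- The tension field of a holomorphic map from a locally conformal Kähler manifold of real
dimension four. -/
lemma IsHermitianMatrix.tension_eq {n : ℕ} (H : IsHermitianMatrix Ω G J)
    (hγ : ∀ y ∈ Ω, ContDiffAt ℝ ∞ γ y)
    (K : IsKahlerData Ω (fun z => bilin (TensorCalc.rescale γ G z)) (fun z => endo (J z))
      (leviCivita (TensorCalc.rescale γ G)))
    {Ω' : Set (EuclideanSpace ℝ (Fin n))}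
    {G' J' : EuclideanSpace ℝ (Fin n) → Matrix (Fin n) (Fin n) ℝ}
    (H' : IsHermitianMatrix Ω' G' J')
    (hQ : ∀ z ∈ Ω', ∀ X Y, covJ (fun z => endo (J' z)) (leviCivita G') z
      (endo (J' z) X) (endo (J' z) Y) = -covJ (fun z => endo (J' z)) (leviCivita G') z X Y)
    {F : EuclideanSpace ℝ (Fin 4) → EuclideanSpace ℝ (Fin n)}
    (hF : ∀ y ∈ Ω, ContDiffAt ℝ ∞ F y) (hmaps : ∀ y ∈ Ω, F y ∈ Ω')
    (hhol : ∀ y ∈ Ω, ∀ X, fderiv ℝ F y (endo (J y) X) = endo (J' (F y)) (fderiv ℝ F y X))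
    {z : EuclideanSpace ℝ (Fin 4)} (hz : z ∈ Ω) (α : Fin n) :
    Coord.tension G G' F z α = fderiv ℝ F z
      ((2 * Real.exp (-2 * γ z)) • gradient γ (TensorCalc.rescale γ G) z) α := by
  have Hh := H.rescale hγ
  have hdet := Hh.det_ne_zero hz
  have hdual := isDualFrame_dualVec hdet (Hh.symm z hz)
  have hev : ∀ᶠ w in 𝓝 z, w ∈ Ω := H.eventually_mem hz
  -- The map is harmonic for the Kähler metric, so only the conformal correction contributes to the
  -- tension field.
  have hJ := sff_J_J K H'.isHermitianData hz (hmaps z hz) (hF z hz) (hev.mono hhol)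
    (hQ _ (hmaps z hz))
  have h0 : ∑ i, sff (leviCivita (TensorCalc.rescale γ G)) (leviCivita G') F z (stdVec i)
      (dualVec (TensorCalc.rescale γ G z) i) = 0 :=
    hdual.sum_eq_zero
      (IsBilin.of_clm (sff (leviCivita (TensorCalc.rescale γ G)) (leviCivita G') F z))
      (K.J_sq z hz) (K.skew hz) (K.g_symm z hz) hJ
  have h1 := (H.isConformalChange hγ hz).sum_sff (Γ' := leviCivita G') (F := F) hdual
    (K.g_symm z hz) (sum_bilin_dualVec hdet)
  have h2 : ∑ i, sff (leviCivita G) (leviCivita G') F z (stdVec i) (dualVec (G z) i)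
      = Real.exp (-2 * γ z) • ∑ i, sff (leviCivita G) (leviCivita G') F z (stdVec i)
        (dualVec (TensorCalc.rescale γ G z) i) := by
    rw [Finset.smul_sum]
    refine Finset.sum_congr rfl fun i _ => ?_
    rw [dualVec_smul (Real.exp_pos (-2 * γ z)).ne' (H.det_ne_zero hz), map_smul]
    rfl
  rw [TensorCalc.tension_eq (hev.mono hF), h2, h1, h0, zero_add, smul_smul, map_smul, mul_comm]

/-- The theorem in local coordinates. -/
theorem bitension_eq_zero {n : ℕ} (H : IsHermitianMatrix Ω G J)
    (hγ : ∀ y ∈ Ω, ContDiffAt ℝ ∞ γ y)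
    (hclosed : ∀ y ∈ Ω, ∀ i j k, Coord.dFundForm (rescale γ G) J y i j k = 0)
    (hnij : ∀ y ∈ Ω, ∀ k i j, Coord.nijenhuis J y k i j = 0)
    (hRic : ∀ y ∈ Ω, ∀ i j, ∑ a, ∑ b, J y a i * J y b j * Coord.ricci G y a b
      = Coord.ricci G y i j)
    (hs : ∀ y ∈ Ω, Coord.scalar G y = Coord.starScalar G J y)
    {Ω' : Set (EuclideanSpace ℝ (Fin n))}
    {G' J' : EuclideanSpace ℝ (Fin n) → Matrix (Fin n) (Fin n) ℝ}
    (H' : IsHermitianMatrix Ω' G' J')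
    (h12 : ∀ y ∈ Ω', ∀ Z W V : Fin n → ℂ, (∀ k, ∑ a, (J' y k a : ℂ) * Z a = Complex.I * Z k) →
      (∀ k, ∑ a, (J' y k a : ℂ) * W a = -(Complex.I * W k)) →
      (∀ k, ∑ a, (J' y k a : ℂ) * V a = -(Complex.I * V k)) →
      ∑ i, ∑ j, ∑ k, (Coord.dFundForm G' J' y i j k : ℂ) * Z i * W j * V k = 0)
    {F : EuclideanSpace ℝ (Fin 4) → EuclideanSpace ℝ (Fin n)}
    (hF : ∀ y ∈ Ω, ContDiffAt ℝ ∞ F y) (hmaps : ∀ y ∈ Ω, F y ∈ Ω')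
    (hhol : ∀ y ∈ Ω, ∀ X, fderiv ℝ F y (endo (J y) X) = endo (J' (F y)) (fderiv ℝ F y X))
    {y : EuclideanSpace ℝ (Fin 4)} (hy : y ∈ Ω) (α : Fin n) :
    Coord.bitension G G' F y α = 0 := by
  have Hh := H.rescale hγ
  have K := Hh.isKahlerData hclosed hnij
  have N := H'.isHermitianData
  have hcond := fun z hz => H.conformal_conditions hγ K hRic hs (y := z) hz
  have hconf := fun z hz => H.isConformalChange hγ (y := z) hz
  have hQ : ∀ z ∈ Ω', ∀ X Y, covJ (fun z => endo (J' z)) (leviCivita G') z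
      (endo (J' z) X) (endo (J' z) Y)
      = -covJ (fun z => endo (J' z)) (leviCivita G') z X Y := fun z hz =>
    N.covJ_J_J hz (dFund_one_two H' hz (h12 z hz))
  have hgrad := fun z hz => bilin_gradient (γ := γ) (Hh.det_ne_zero (y := z) hz)
  have husm := fun z hz => Hh.smooth_gradient (y := z) hz (hγ z hz)
  have hdual := fun z hz =>
    isDualFrame_dualVec (Hh.det_ne_zero (y := z) hz) (Hh.symm z hz)
  have hdim := fun z hz => sum_bilin_dualVec (Hh.det_ne_zero (y := z) hz)
  have hdv : ∀ z ∈ Ω, ∀ i, dualVec (G z) i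
      = Real.exp (-2 * γ z) • dualVec (rescale γ G z) i := fun z hz =>
    dualVec_smul (Real.exp_pos _).ne' (H.det_ne_zero hz)
  set h := rescale γ G with hh
  set Γ := leviCivita h with hΓ
  set u := gradient γ h with hu
  -- With this ψ the gradient P = -ψ u absorbs the term u ⊗ u: ∇P = -ψ (∇u - u ⊗ u), as `hcovP`
  -- records.
  set ψ : EuclideanSpace ℝ (Fin 4) → ℝ := fun z => Real.exp (-γ z) with hψ
  set P : EuclideanSpace ℝ (Fin 4) → EuclideanSpace ℝ (Fin 4) := fun z => (-ψ z) • u z with hP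
  have hψ0 : ∀ z, ψ z ≠ 0 := fun z => (Real.exp_pos _).ne'
  have hψ2 : ∀ z, Real.exp (-2 * γ z) = ψ z * ψ z := fun z => by
    rw [hψ, ← Real.exp_add]; congr 1; ring
  have hψsm : ∀ z ∈ Ω, ContDiffAt ℝ ∞ ψ z := fun z hz => (hγ z hz).neg.exp
  have hPsm : ∀ z ∈ Ω, ContDiffAt ℝ ∞ P z := fun z hz => (hψsm z hz).neg.smul (husm z hz)
  have hdψ : ∀ z ∈ Ω, ∀ X, fderiv ℝ ψ z X = -ψ z * fderiv ℝ γ z X := fun z hz X => by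
    have hg := smooth_differentiableAt (hγ z hz)
    rw [hψ, fderiv_exp hg.fun_neg, fderiv_fun_neg]
    simp
  have hψP : ∀ z ∈ Ω, ∀ X, bilin (h z) (P z) X = fderiv ℝ ψ z X := fun z hz X => by
    rw [hdψ z hz, hP, map_smul, smul_apply, hgrad z hz, smul_eq_mul]
  have hcovP : ∀ z ∈ Ω, ∀ X, cov Γ P z X
      = (-ψ z) • (cov Γ u z X - bilin (h z) (u z) X • u z) := fun z hz X => by
    have hd := smooth_differentiableAt (hψsm z hz)
    rw [hP, cov_smul hd.fun_neg (smooth_differentiableAt (husm z hz)), fderiv_fun_neg, neg_apply,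
      hdψ z hz, hgrad z hz]
    module
  have hPJ : ∀ z ∈ Ω, ∀ X, cov Γ P z (endo (J z) X) = endo (J z) (cov Γ P z X) :=
    fun z hz X => by rw [hcovP z hz, hcovP z hz, (hcond z hz).1, map_smul]
  have htr : ψ y * ∑ i, bilin (h y) (cov Γ P y (stdVec i)) (dualVec (h y) i)
      = 2 * bilin (h y) (P y) (P y) := by
    have h0 : ∑ i, bilin (h y) (cov Γ u y (stdVec i) - bilin (h y) (u y) (stdVec i) • u y)
        (dualVec (h y) i) = -2 * bilin (h y) (u y) (u y) := (hcond y hy).2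
    have h1 : P y = (-ψ y) • u y := rfl
    simp only [hcovP y hy, h1, map_smul, smul_apply, smul_eq_mul, ← Finset.mul_sum, h0]
    ring
  have hev : ∀ᶠ z in 𝓝 y, z ∈ Ω := H.eventually_mem hy
  have core := bitension_core K N hy (hmaps y hy) (hdual y hy) (hev.mono hF) (hev.mono hhol) hQ
    (hev.mono hψsm) (hev.mono hPsm) (hev.mono hψP) (hψ0 y) (hev.mono hPJ) htr
  set τ : EuclideanSpace ℝ (Fin 4) → EuclideanSpace ℝ (Fin n) :=
    fun z => fderiv ℝ F z ((-2 * ψ z) • P z) with hτ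
  have hτsm : ∀ z ∈ Ω, ContDiffAt ℝ ∞ τ z := fun z hz =>
    (smooth_fderiv (hF z hz)).clm_apply ((contDiffAt_const.mul (hψsm z hz)).smul (hPsm z hz))
  have hten : ∀ z ∈ Ω, ∀ α, Coord.tension G G' F z α = τ z α := fun z hz α => by
    have h1 : (2 * (ψ z * ψ z)) • u z = (-2 * ψ z) • P z := by
      rw [hP, smul_smul]; congr 1; ring
    rw [H.tension_eq hγ K H' hQ hF hmaps hhol hz α, ← hu, hψ2, h1]
  rw [Coord.bitension, roughLaplacian_eq (hev.mono hten) (hev.mono hF) (hev.mono hτsm)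
      (H'.smooth_leviCivita (hmaps y hy)),
    ricciAlong_eq (hten y hy) (smooth_differentiableAt (hF y hy))
      (smooth_differentiableAt (H'.smooth_leviCivita (hmaps y hy))), ← PiLp.add_apply]
  have hb := cov₂_isBilin (Γ := leviCivita G)
    (smooth_pullback (H'.smooth_leviCivita (hmaps y hy)) (hF y hy)) (hτsm y hy)
  have hb' := curvature_isBilin (leviCivita G') (F y) (τ y)
  have h2 := (hconf y hy).sum_cov₂ (θ := pullback (leviCivita G') F) (v := τ) (hdual y hy)
    (K.g_symm y hy) (hdim y hy)
  simp only [hdv y hy, map_smul, (hb.right _).map_smul, (hb'.right _).map_smul,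
    ← Finset.smul_sum]
  rw [h2, ← smul_add]
  -- The first-order term from changing the Laplacian, rewritten by u = -P/ψ in the form used by
  -- `bitension_core`.
  have h3 : (2 : ℝ) • cov (pullback (leviCivita G') F) τ y (u y)
      = -((2 / ψ y) • cov (pullback (leviCivita G') F) τ y (P y)) := by
    rw [hP, map_smul, smul_smul, ← neg_smul]
    congr 1
    field_simp [hψ0 y]
  rw [h3, add_right_comm, ← sub_eq_add_neg, ← Finset.sum_add_distrib]
  rw [core]
  simp

end Local

end TensorCalc

namespace TensorCalc

open Filter Topology Bundle

/-! ### Smoothness of pushed-forward vector fields -/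

section Derivative

variable {E E' E'' : Type*} [NormedAddCommGroup E] [NormedSpace ℝ E]
  [NormedAddCommGroup E'] [NormedSpace ℝ E'] [NormedAddCommGroup E''] [NormedSpace ℝ E'']
  {H H' H'' : Type*} [TopologicalSpace H] [TopologicalSpace H'] [TopologicalSpace H'']
  {I : ModelWithCorners ℝ E H} {I' : ModelWithCorners ℝ E' H'} {I'' : ModelWithCorners ℝ E'' H''}
  {M M' P : Type*} [TopologicalSpace M] [ChartedSpace H M] [IsManifold I ∞ M]
  [TopologicalSpace M'] [ChartedSpace H' M'] [IsManifold I' ∞ M']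
  [TopologicalSpace P] [ChartedSpace H'' P]

lemma contMDiffAt_mfderiv_apply {f : M → M'} {s : Set M} (hs : IsOpen s)
    (hf : ContMDiffOn I I' ∞ f s) {b : P → M} {v : ∀ z, TangentSpace I (b z)} {z : P}
    (hv : ContMDiffAt I'' I.tangent ∞
      (fun z => (TotalSpace.mk' E (b z) (v z) : TangentBundle I M)) z)
    (hz : b z ∈ s) :
    ContMDiffAt I'' I'.tangent ∞
      (fun z => (TotalSpace.mk' E' (f (b z)) (mfderiv I I' f (b z) (v z)) : TangentBundle I' M'))
      z := by
  have : IsManifold I 1 M := IsManifold.of_le (n := ∞) (by norm_num)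
  have : IsManifold I' 1 M' := IsManifold.of_le (n := ∞) (by norm_num)
  have hb : ContMDiffAt I'' I ∞ b z := (contMDiffAt_totalSpace.mp hv).1
  have hso : IsOpen (TotalSpace.proj ⁻¹' s : Set (TangentBundle I M)) :=
    hs.preimage (FiberBundle.continuous_proj E (TangentSpace I))
  have ht := (hf.contMDiffOn_tangentMapWithin (m := ∞) (by simp) hs.uniqueMDiffOn).contMDiffAt
    (hso.mem_nhds (x := (⟨b z, v z⟩ : TangentBundle I M)) hz)
  refine (ContMDiffAt.comp z ht hv).congr_of_eventuallyEq ?_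
  filter_upwards [hb.continuousAt.preimage_mem_nhds (hs.mem_nhds hz)] with w hw
  simp only [Function.comp, tangentMapWithin]
  rw [mfderivWithin_of_isOpen hs hw]

end Derivative

/-! ### An almost Hermitian structure in a chart -/

section Charts

variable {m : ℕ} {M : Type*} [TopologicalSpace M] [ChartedSpace (EuclideanSpace ℝ (Fin m)) M]
  {c : OpenPartialHomeomorph M (EuclideanSpace ℝ (Fin m))} {y : EuclideanSpace ℝ (Fin m)}

/-- The derivative of a chart. -/
noncomputable def chartDeriv (c : OpenPartialHomeomorph M (EuclideanSpace ℝ (Fin m))) (x : M) :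
    TangentSpace (𝓡 m) x →L[ℝ] EuclideanSpace ℝ (Fin m) := mfderiv (𝓡 m) (𝓡 m) c x

/-- The derivative of the inverse of a chart. -/
noncomputable def chartSymmDeriv (c : OpenPartialHomeomorph M (EuclideanSpace ℝ (Fin m)))
    (y : EuclideanSpace ℝ (Fin m)) :
    EuclideanSpace ℝ (Fin m) →L[ℝ] TangentSpace (𝓡 m) (c.symm y) :=
  mfderiv (𝓡 m) (𝓡 m) c.symm y

lemma bilin_metricMatrix
    (h : ∀ x : M, TangentSpace (𝓡 m) x →L[ℝ] TangentSpace (𝓡 m) x →L[ℝ] ℝ)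
    (X Y : EuclideanSpace ℝ (Fin m)) :
    bilin (metricMatrix h c y) X Y
      = h (c.symm y) (chartSymmDeriv c y X) (chartSymmDeriv c y Y) := by
  refine isBilin_ext (b' := fun X Y => h (c.symm y) (chartSymmDeriv c y X) (chartSymmDeriv c y Y))
    (IsBilin.of_clm _) ⟨fun Y => ⟨by simp, by simp⟩, fun X => ⟨by simp, by simp⟩⟩
    (fun i j => ?_) X Y
  rw [bilin_stdVec]
  rfl

lemma endo_endoMatrix (A : ∀ x : M, TangentSpace (𝓡 m) x →L[ℝ] TangentSpace (𝓡 m) x)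
    (X : EuclideanSpace ℝ (Fin m)) :
    endo (endoMatrix A c y) X = chartDeriv c (c.symm y) (A (c.symm y) (chartSymmDeriv c y X)) := by
  refine linear_ext (L := fun X => endo (endoMatrix A c y) X)
    (L' := fun X => chartDeriv c (c.symm y) (A (c.symm y) (chartSymmDeriv c y X)))
    ⟨by simp, by simp⟩ ⟨by simp, by simp⟩ (fun i => ?_) X
  ext k
  rw [endo_stdVec]
  rfl

lemma mdifferentiable_of_mem_maximalAtlas (hc : c ∈ IsManifold.maximalAtlas (𝓡 m) ∞ M) :
    c.MDifferentiable (𝓡 m) (𝓡 m) :=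
  ⟨(contMDiffOn_of_mem_maximalAtlas hc).mdifferentiableOn (by simp),
    (contMDiffOn_symm_of_mem_maximalAtlas hc).mdifferentiableOn (by simp)⟩

lemma chartDeriv_symm (hc : c ∈ IsManifold.maximalAtlas (𝓡 m) ∞ M) (hy : y ∈ c.target)
    (X : EuclideanSpace ℝ (Fin m)) : chartDeriv c (c.symm y) (chartSymmDeriv c y X) = X :=
  DFunLike.congr_fun ((mdifferentiable_of_mem_maximalAtlas hc).comp_symm_deriv hy) X

lemma chartSymmDeriv_chartDeriv (hc : c ∈ IsManifold.maximalAtlas (𝓡 m) ∞ M) (hy : y ∈ c.target)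
    (v : TangentSpace (𝓡 m) (c.symm y)) :
    chartSymmDeriv c y (chartDeriv c (c.symm y) v) = v := by
  have h := (mdifferentiable_of_mem_maximalAtlas hc).symm_comp_deriv (c.map_target hy)
  rw [c.right_inv hy] at h
  exact DFunLike.congr_fun h v

lemma chartSymmDeriv_injective (hc : c ∈ IsManifold.maximalAtlas (𝓡 m) ∞ M) (hy : y ∈ c.target) :
    Function.Injective (chartSymmDeriv c y) := fun X Y h => by
  rw [← chartDeriv_symm hc hy X, h, chartDeriv_symm hc hy]

variable [IsManifold (𝓡 m) ∞ M]

lemma contMDiffAt_coordVec (hc : c ∈ IsManifold.maximalAtlas (𝓡 m) ∞ M) (hy : y ∈ c.target)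
    (i : Fin m) : ContMDiffAt (𝓡 m) (𝓡 m).tangent ∞
      (fun z => (TotalSpace.mk' (EuclideanSpace ℝ (Fin m)) (c.symm z) (coordVec c z i) :
        TangentBundle (𝓡 m) M)) y :=
  contMDiffAt_mfderiv_apply (b := fun z => z) (v := fun _ => EuclideanSpace.single i (1 : ℝ))
    c.open_target (contMDiffOn_symm_of_mem_maximalAtlas hc)
    (contMDiffAt_vectorSpace_iff_contDiffAt.mpr contDiffAt_const) hy

variable (S : AlmostHermitian m M)

lemma smooth_gMat (hc : c ∈ IsManifold.maximalAtlas (𝓡 m) ∞ M) (hy : y ∈ c.target)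
    (i j : Fin m) : ContDiffAt ℝ ∞ (fun z => S.gMat c z i j) y := by
  rw [← contMDiffAt_iff_contDiffAt]
  have hcs := contMDiffAt_symm_of_mem_maximalAtlas hc hy
  have : ContMDiffAt (𝓡 m) ((𝓡 m).prod 𝓘(ℝ)) ∞
      (fun z => TotalSpace.mk' ℝ (E := Bundle.Trivial M ℝ) (c.symm z)
        (S.g.inner (c.symm z) (coordVec c z i) (coordVec c z j))) y := by
    apply ContMDiffAt.clm_bundle_apply₂ (F₁ := EuclideanSpace ℝ (Fin m))
      (F₂ := EuclideanSpace ℝ (Fin m))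
    · exact ContMDiffAt.comp y S.g.contMDiff.contMDiffAt hcs
    · exact contMDiffAt_coordVec hc hy i
    · exact contMDiffAt_coordVec hc hy j
  exact (contMDiffAt_totalSpace.mp this).2

lemma smooth_jMat (hc : c ∈ IsManifold.maximalAtlas (𝓡 m) ∞ M) (hy : y ∈ c.target)
    (i j : Fin m) : ContDiffAt ℝ ∞ (fun z => S.jMat c z i j) y := by
  have hcs := contMDiffAt_symm_of_mem_maximalAtlas hc hy
  have h1 : ContMDiffAt (𝓡 m) (𝓡 m).tangent ∞
      (fun z => (TotalSpace.mk' (EuclideanSpace ℝ (Fin m)) (c.symm z)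
        (S.J (c.symm z) (coordVec c z j)) : TangentBundle (𝓡 m) M)) y := by
    apply ContMDiffAt.clm_bundle_apply (F₁ := EuclideanSpace ℝ (Fin m))
    · exact ContMDiffAt.comp y S.J.contMDiff_toFun.contMDiffAt hcs
    · exact contMDiffAt_coordVec hc hy j
  have h2 := contMDiffAt_mfderiv_apply c.open_source (contMDiffOn_of_mem_maximalAtlas hc) h1
    (c.map_target hy)
  have h3 := (contMDiff_snd_tangentBundle_modelSpace (n := ∞) (EuclideanSpace ℝ (Fin m))
    (𝓡 m)).contMDiffAt.comp y h2
  rw [contMDiffAt_iff_contDiffAt] at h3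
  exact (EuclideanSpace.proj i : EuclideanSpace ℝ (Fin m) →L[ℝ] ℝ).contDiff.contDiffAt.comp y h3

/-- The matrices of an almost Hermitian structure in a chart. -/
lemma isHermitianMatrix_chart (hc : c ∈ IsManifold.maximalAtlas (𝓡 m) ∞ M)
    {Ω : Set (EuclideanSpace ℝ (Fin m))} (hΩ : IsOpen Ω) (hsub : Ω ⊆ c.target) :
    IsHermitianMatrix Ω (S.gMat c) (S.jMat c) where
  isOpen := hΩ
  smooth_G y hy := smooth_gMat S hc (hsub hy)
  smooth_J y hy := smooth_jMat S hc (hsub hy)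
  symm y hy X Y := by
    rw [AlmostHermitian.gMat, bilin_metricMatrix, bilin_metricMatrix, S.g.symm]
  pos y hy X hX := by
    rw [AlmostHermitian.gMat, bilin_metricMatrix]
    refine S.g.pos _ _ fun h => hX (chartSymmDeriv_injective hc (hsub hy) ?_)
    rw [h, map_zero]
  J_sq y hy X := by
    rw [AlmostHermitian.jMat, endo_endoMatrix, endo_endoMatrix,
      chartSymmDeriv_chartDeriv hc (hsub hy), S.J_sq, map_neg, chartDeriv_symm hc (hsub hy)]
  J_isometry y hy X Y := by
    rw [AlmostHermitian.gMat, AlmostHermitian.jMat, bilin_metricMatrix, bilin_metricMatrix,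
      endo_endoMatrix, endo_endoMatrix, chartSymmDeriv_chartDeriv hc (hsub hy),
      chartSymmDeriv_chartDeriv hc (hsub hy), S.J_isometry]

lemma metricMatrix_smul (S : AlmostHermitian m M) (γ : M → ℝ) :
    metricMatrix (fun x => Real.exp (-2 * γ x) • S.g.inner x) c
      = rescale (fun z => γ (c.symm z)) (S.gMat c) := by
  ext z i j
  rfl

end Charts

/-! ### A holomorphic map in charts -/

section Maps

variable {m n : ℕ} {M N : Type*} [TopologicalSpace M] [ChartedSpace (EuclideanSpace ℝ (Fin m)) M]
  [TopologicalSpace N] [ChartedSpace (EuclideanSpace ℝ (Fin n)) N]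
  {c : OpenPartialHomeomorph M (EuclideanSpace ℝ (Fin m))}
  {d : OpenPartialHomeomorph N (EuclideanSpace ℝ (Fin n))}
  {φ : M → N} {y : EuclideanSpace ℝ (Fin m)}

lemma contDiffAt_chart_comp (hc : c ∈ IsManifold.maximalAtlas (𝓡 m) ∞ M)
    (hd : d ∈ IsManifold.maximalAtlas (𝓡 n) ∞ N) (hφ : ContMDiff (𝓡 m) (𝓡 n) ∞ φ)
    (hy : y ∈ c.target) (hφy : φ (c.symm y) ∈ d.source) :
    ContDiffAt ℝ ∞ (fun z => d (φ (c.symm z))) y :=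
  contMDiffAt_iff_contDiffAt.mp <| (contMDiffAt_of_mem_maximalAtlas hd hφy).comp y
    ((hφ _).comp y (contMDiffAt_symm_of_mem_maximalAtlas hc hy))

lemma fderiv_chart_comp (hc : c ∈ IsManifold.maximalAtlas (𝓡 m) ∞ M)
    (hd : d ∈ IsManifold.maximalAtlas (𝓡 n) ∞ N) (hφ : ContMDiff (𝓡 m) (𝓡 n) ∞ φ)
    (hy : y ∈ c.target) (hφy : φ (c.symm y) ∈ d.source) (X : EuclideanSpace ℝ (Fin m)) :
    fderiv ℝ (fun z => d (φ (c.symm z))) y X = chartDeriv d (φ (c.symm y))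
      (mfderiv (𝓡 m) (𝓡 n) φ (c.symm y) (chartSymmDeriv c y X)) := by
  have h1 : HasMFDerivAt (𝓡 m) (𝓡 m) c.symm y _ :=
    ((mdifferentiable_of_mem_maximalAtlas hc).mdifferentiableAt_symm hy).hasMFDerivAt
  have h2 : HasMFDerivAt (𝓡 m) (𝓡 n) φ (c.symm y) _ :=
    ((hφ _).mdifferentiableAt (by simp)).hasMFDerivAt
  have h3 : HasMFDerivAt (𝓡 n) (𝓡 n) d (φ (c.symm y)) _ :=
    ((mdifferentiable_of_mem_maximalAtlas hd).mdifferentiableAt hφy).hasMFDerivAt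
  rw [← mfderiv_eq_fderiv]
  exact DFunLike.congr_fun (h3.comp y (h2.comp y h1)).mfderiv X

variable [IsManifold (𝓡 m) ∞ M] [IsManifold (𝓡 n) ∞ N]

lemma fderiv_chart_comp_endo (S : AlmostHermitian m M) (T : AlmostHermitian n N)
    (hc : c ∈ IsManifold.maximalAtlas (𝓡 m) ∞ M)
    (hd : d ∈ IsManifold.maximalAtlas (𝓡 n) ∞ N) (hφ : S.IsHolomorphic T φ)
    (hy : y ∈ c.target) (hφy : φ (c.symm y) ∈ d.source) (X : EuclideanSpace ℝ (Fin m)) :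
    fderiv ℝ (fun z => d (φ (c.symm z))) y (endo (S.jMat c y) X)
      = endo (T.jMat d (d (φ (c.symm y)))) (fderiv ℝ (fun z => d (φ (c.symm z))) y X) := by
  have key : ∀ v : TangentSpace (𝓡 n) (φ (c.symm y)),
      endo (T.jMat d (d (φ (c.symm y)))) (chartDeriv d (φ (c.symm y)) v)
        = chartDeriv d (φ (c.symm y)) (T.J (φ (c.symm y)) v) := by
    -- The tangent space depends on the point, so the point is first written as `d.symm w`; the
    -- chart matrix of the target structure is then evaluated at w.
    obtain ⟨w, hw, hwd⟩ : ∃ w ∈ d.target, φ (c.symm y) = d.symm w :=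
      ⟨_, d.map_source hφy, (d.left_inv hφy).symm⟩
    rw [hwd, d.right_inv hw]
    intro v
    rw [AlmostHermitian.jMat, endo_endoMatrix, chartSymmDeriv_chartDeriv hd hw]
  rw [fderiv_chart_comp hc hd hφ.1 hy hφy, fderiv_chart_comp hc hd hφ.1 hy hφy, key, ← hφ.2,
    AlmostHermitian.jMat, endo_endoMatrix, chartSymmDeriv_chartDeriv hc hy]

end Maps

end TensorCalc

theorem proposition4
    {M : Type*} [TopologicalSpace M] [ChartedSpace (EuclideanSpace ℝ (Fin 4)) M]
    [IsManifold (𝓡 4) ∞ M] (S : AlmostHermitian 4 M)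
    (hlck : S.IsLCK) (hRic : S.RicciJInvariant) (hs : S.ScalarEqStarScalar)
    {n : ℕ} {N : Type*} [TopologicalSpace N] [ChartedSpace (EuclideanSpace ℝ (Fin n)) N]
    [IsManifold (𝓡 n) ∞ N] (T : AlmostHermitian n N) (hT : T.IsOneTwoSymplectic)
    (φ : M → N) (hφ : S.IsHolomorphic T φ) :
    S.IsBiharmonic T φ := by
  refine ⟨hφ.1, fun c hc d hd y hy hφy α => ?_⟩
  obtain ⟨U, hU, hyU, γ, hγ, hK⟩ := hlck.2 (c.symm y)
  -- On V the Kähler metric exists and φ lands in the target chart. It is open, so all germs needed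
  -- at the given point are available.
  set V : Set M := U ∩ φ ⁻¹' d.source with hV
  have hVo : IsOpen V := hU.inter (d.open_source.preimage hφ.1.continuous)
  set Ω : Set (EuclideanSpace ℝ (Fin 4)) := c.target ∩ c.symm ⁻¹' V with hΩ
  have hΩo : IsOpen Ω := c.isOpen_inter_preimage_symm hVo
  refine TensorCalc.bitension_eq_zero (γ := fun z => γ (c.symm z)) (Ω := Ω) (Ω' := d.target)
    (J := S.jMat c) (J' := T.jMat d)
    (TensorCalc.isHermitianMatrix_chart S hc hΩo Set.inter_subset_left) (fun z hz => ?_)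
    (fun z hz i j k => ?_) (fun z hz => hlck.1 c hc z hz.1) (fun z hz => hRic c hc z hz.1)
    (fun z hz => hs c hc z hz.1)
    (TensorCalc.isHermitianMatrix_chart T hd d.open_target subset_rfl) (hT d hd)
    (fun z hz => TensorCalc.contDiffAt_chart_comp hc hd hφ.1 hz.1 hz.2.2)
    (fun z hz => d.map_source hz.2.2)
    (fun z hz => TensorCalc.fderiv_chart_comp_endo S T hc hd hφ hz.1 hz.2.2)
    ⟨hy, hyU, hφy⟩ α
  · exact contMDiffAt_iff_contDiffAt.mp (ContMDiffAt.comp z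
      (hγ.contMDiffAt (hU.mem_nhds hz.2.1)) (contMDiffAt_symm_of_mem_maximalAtlas hc hz.1))
  · rw [← TensorCalc.metricMatrix_smul]
    exact hK.closed c hc z hz.1 hz.2.1 i j k
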